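/- Let $G$ be a finite simple undirected graph that is $5$-connected. Let $K$ be a (not necessarily induced) subgraph of $G$ isomorphic to $K_{2,3}$, let $x_1,x_2$ be the two vertices of degree $3$ in $K$, and let $x_3,x_4,x_5$ be the three vertices of degree $2$ in $K$. Suppose that $G$ has an induced path $P$ with ends $x_1$ and $x_2$ such that $x_3,x_4,x_5\notin V(P)$ and the graph $G-P=G-V(P)$ is $2$-connected. Then $G$ contains a subdivision of $K_5$ as a subgraph. Here a graph is $k$-connected if it has more than $k$ vertices and remains connected after the deletion of any set of fewer than $k$ vertices. A subdivision of $K_5$ is a graph obtained from $K_5$ by replacing its edges with internally disjoint paths between their ends. -/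

import Mathlib

namespace SimpleGraph

/-- `G` is `k`-connected (`κ(G) ≥ k`): it has more than `k` vertices, and deleting fewer than `k`
vertices always leaves a connected graph. -/
def IsVertexConnected {V : Type*} (G : SimpleGraph V) (k : ℕ) : Prop :=
  (k : ℕ∞) < ENat.card V ∧
    ∀ X : Finset V, X.card < k → (G.induce {v | v ∉ X}).Connected

/-- The subgraph `S` of `G` is a subdivision of `H` (a `TH`): it is obtained by placing the vertices
of `H` at distinct vertices of `G` and replacing the edges of `H` by paths of `G` between the
corresponding vertices. No such path passes through a further vertex of `H`, and two such
paths for distinct edges of `H` meet at most in vertices of `H`. Each edge of `H` gives two darts,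
which carry the same path, traversed in opposite directions. -/
def Subgraph.IsSubdivisionOf {V W : Type*} {G : SimpleGraph V} (S : G.Subgraph)
    (H : SimpleGraph W) : Prop :=
  ∃ (f : W ↪ V) (p : ∀ d : H.Dart, G.Walk (f d.fst) (f d.snd)),
    (∀ d, (p d).IsPath) ∧
    (∀ d, p d.symm = (p d).reverse) ∧
    (∀ d w, f w ∈ (p d).support → w = d.fst ∨ w = d.snd) ∧
    (∀ d d', d.edge ≠ d'.edge →
      ∀ v, v ∈ (p d).support → v ∈ (p d').support → v ∈ Set.range f) ∧
    S = (⨆ w, G.singletonSubgraph (f w)) ⊔ ⨆ d, (p d).toSubgraph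

/-- `TH ⊆ G`: some subgraph of `G` is a subdivision of `H`. -/
def ContainsSubdivision {V W : Type*} (G : SimpleGraph V) (H : SimpleGraph W) : Prop :=
  ∃ S : G.Subgraph, S.IsSubdivisionOf H

end SimpleGraph

/-!
Suppose that `G` contains no subdivision of `K₅`. Write `P` for the vertex set of the path, `y 0`,
`y 1`, `y 2` for the three vertices of degree `2` of the complete bipartite graph, and `H = G - P`.
Paths are handled through connected vertex sets: a subdivision of `K₅` is given by five vertices and
pairwise disjoint connected sets through which they are joined (`containsSubdivision_top_of_joinedIn`),
and Menger's theorem is used in the form of `IsLinkage.augment`. All the connections that cannot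
exist come from two patterns. In `Config.false_of_cycle`, the graph `H` has a cycle through all
`y i`, which together with the path gives the branch vertices `x₁`, `x₂`, `y 0`, `y 1`, `y 2`. In
`Config.false_of_center`, some vertex `v` of `H` is joined to two of the `y i` and to two vertices of
the path, while the two `y i` are joined to each other, and `x₁`, `x₂` are joined through the third
one. The vertex `v` is usually the centre of a fan with five ends, which exists in every connected set
touching three vertices because `G` is `5`-connected (`ConnSet.exists_fan_five`).

As there is no cycle in `H` through all `y i`, the `2`-connectedness of `H` yields two disjoint
connected sets touching all `y i`, and if their union is as large as possible, these two sides `A`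
and `B` partition `H` without the `y i` (`Config.exists_partition`). Again since there is no such
cycle, each `y i` is separated inside `A` from the two others by a vertex `n i`. It is chosen as far
away from `y i` as possible (`IsGate`), so that every vertex of `A` can be linked within `A` to
suitable `y i` in a way disjoint from a connection between the two others. A comparison of these links
for the ends of an edge between `A` and `B` shows that the parts cut off from the two sides fit
together (`Config.eq_of_linkedIn`). Sides in which one vertex separates all `y i` from each other need
a separate discussion (`IsStarCenter`). In all cases one arrives at cuts of `A` and `B` for which `y i`
and the parts `C i` of `A` and `D i` of `B` belonging to it are attached to the rest of `H` only at
two vertices `n i` and `m i` (`IsDoubleCut`).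

In this situation, `n i` has only one neighbour `c i` in `C i ∪ D i`: otherwise there are two disjoint
paths from `n i` to `P` in this set, and `n i` could serve as `v` above
(`IsDoubleCut.exists_separator`). Therefore the part of `A` that belongs to none of the `y i` has no
neighbours besides `c 0`, `c 1`, `c 2`, at most one vertex of `B`, and vertices of `P`, and a fan with
five ends from it gives the final contradiction (`IsDoubleCut.false_of_middle`).
-/

namespace SimpleGraph

/-! ### Connected vertex sets -/

section ConnSet

variable {V : Type*} {G : SimpleGraph V}

/-- A set of vertices is connected in `G` if it is nonempty and no proper nonempty part of it is
closed under adjacency inside the set. -/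
def ConnSet (G : SimpleGraph V) (S : Set V) : Prop :=
  S.Nonempty ∧ ∀ T ⊆ S, T.Nonempty → (∀ a ∈ T, ∀ b ∈ S, G.Adj a b → b ∈ T) → S ⊆ T

/-- The vertex `v` has a neighbour in `S`. -/
def Touches (G : SimpleGraph V) (S : Set V) (v : V) : Prop :=
  ∃ s ∈ S, G.Adj s v

/-- The vertices that can be joined to `a` by a connected subset of `W`: the component of `a` in the
subgraph induced on `W`, and the empty set if `a ∉ W`. -/
def compIn (G : SimpleGraph V) (W : Set V) (a : V) : Set V :=
  {b | ∃ Z ⊆ W, G.ConnSet Z ∧ a ∈ Z ∧ b ∈ Z}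

theorem Touches.mono {S T : Set V} {v : V} (h : G.Touches S v) (hST : S ⊆ T) : G.Touches T v :=
  let ⟨s, hs, hv⟩ := h
  ⟨s, hST hs, hv⟩

theorem connSet_singleton (a : V) : G.ConnSet {a} := by
  refine ⟨⟨a, rfl⟩, fun T hT hne _ => ?_⟩
  obtain ⟨t, ht⟩ := hne
  have : t = a := hT ht
  rintro b rfl
  exact this ▸ ht

theorem ConnSet.exists_boundary {S T : Set V} (hS : G.ConnSet S) {a b : V} (ha : a ∈ S)
    (haT : a ∈ T) (hb : b ∈ S) (hbT : b ∉ T) : ∃ c ∈ S, c ∈ T ∧ ∃ d ∈ S, d ∉ T ∧ G.Adj c d := by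
  by_contra! h
  exact hbT (hS.2 (S ∩ T) Set.inter_subset_left ⟨a, ha, haT⟩
    (fun c hc d hd hcd => ⟨hd, by_contra fun hdT => h c hc.1 hc.2 d hd hdT hcd⟩) hb).2

protected theorem ConnSet.union {S T : Set V} (hS : G.ConnSet S) (hT : G.ConnSet T)
    {a b : V} (ha : a ∈ S) (hb : b ∈ T)
    (hab : a = b ∨ G.Adj a b) : G.ConnSet (S ∪ T) := by
  refine ⟨⟨a, Or.inl ha⟩, fun U hU ⟨u, hu⟩ hcl => ?_⟩
  have key : ∀ {X : Set V}, G.ConnSet X → X ⊆ S ∪ T → (X ∩ U).Nonempty → X ⊆ U := by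
    intro X hX hXs hne x hx
    exact (hX.2 (X ∩ U) Set.inter_subset_left hne
      (fun c hc d hd hcd => ⟨hd, hcl c hc.2 d (hXs hd) hcd⟩) hx).2
  have hadj : a ∈ U ↔ b ∈ U := by
    rcases hab with rfl | hab
    · rfl
    · exact ⟨fun h => hcl a h b (Or.inr hb) hab, fun h => hcl b h a (Or.inl ha) hab.symm⟩
  have hSU := key hS Set.subset_union_left
  have hTU := key hT Set.subset_union_right
  rcases hU hu with h | h
  · have h1 := hSU ⟨u, h, hu⟩
    exact Set.union_subset h1 (hTU ⟨b, hb, hadj.1 (h1 ha)⟩)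
  · have h1 := hTU ⟨u, h, hu⟩
    exact Set.union_subset (hSU ⟨a, ha, hadj.2 (h1 hb)⟩) h1

theorem ConnSet.union_of_mem {S T : Set V} (hS : G.ConnSet S) (hT : G.ConnSet T) {a : V}
    (ha : a ∈ S) (hb : a ∈ T) : G.ConnSet (S ∪ T) :=
  hS.union hT ha hb (Or.inl rfl)

theorem ConnSet.union_of_adj {S T : Set V} (hS : G.ConnSet S) (hT : G.ConnSet T) {a b : V}
    (ha : a ∈ S) (hb : b ∈ T) (hab : G.Adj a b) : G.ConnSet (S ∪ T) :=
  hS.union hT ha hb (Or.inr hab)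

protected theorem ConnSet.insert {S : Set V} (hS : G.ConnSet S) {v : V} (h : G.Touches S v) :
    G.ConnSet (insert v S) := by
  obtain ⟨s, hs, hv⟩ := h
  rw [Set.insert_eq]
  exact (connSet_singleton v).union_of_adj hS rfl hs hv.symm

theorem compIn_subset {W : Set V} {a : V} : G.compIn W a ⊆ W :=
  fun _ ⟨_, hZ, _, _, hb⟩ => hZ hb

theorem mem_compIn_self {W : Set V} {a : V} (ha : a ∈ W) : a ∈ G.compIn W a :=
  ⟨{a}, Set.singleton_subset_iff.2 ha, connSet_singleton a, rfl, rfl⟩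

theorem ConnSet.subset_compIn {W Z : Set V} {a : V} (hZ : G.ConnSet Z) (hZW : Z ⊆ W)
    (ha : a ∈ Z) : Z ⊆ G.compIn W a :=
  fun _ hb => ⟨Z, hZW, hZ, ha, hb⟩

theorem compIn_closed {W : Set V} {a b c : V} (hb : b ∈ G.compIn W a) (hc : c ∈ W)
    (hbc : G.Adj b c) : c ∈ G.compIn W a := by
  obtain ⟨Z, hZ, hZc, ha, hb⟩ := hb
  refine ⟨insert c Z, ?_, hZc.insert ⟨b, hb, hbc⟩, Or.inr ha, Or.inl rfl⟩
  exact Set.insert_subset hc hZ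

theorem connSet_compIn {W : Set V} {a : V} (ha : a ∈ W) : G.ConnSet (G.compIn W a) := by
  refine ⟨⟨a, mem_compIn_self ha⟩, fun T hT ⟨t, ht⟩ hcl => ?_⟩
  have key : ∀ {X : Set V}, G.ConnSet X → X ⊆ G.compIn W a → (X ∩ T).Nonempty → X ⊆ T := by
    intro X hX hXs hne x hx
    exact (hX.2 (X ∩ T) Set.inter_subset_left hne
      (fun c hc d hd hcd => ⟨hd, hcl c hc.2 d (hXs hd) hcd⟩) hx).2
  have haT : a ∈ T := by
    obtain ⟨Z, hZ, hZc, haZ, htZ⟩ := hT ht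
    exact key hZc (hZc.subset_compIn hZ haZ) ⟨t, htZ, ht⟩ haZ
  rintro b ⟨Z, hZ, hZc, haZ, hbZ⟩
  exact key hZc (hZc.subset_compIn hZ haZ) ⟨a, haZ, haT⟩ hbZ

/-- The component of a vertex of a connected set `S` after the deletion of another vertex `n` has a
neighbour of `n`. -/
theorem ConnSet.touches_compIn {S : Set V} (hS : G.ConnSet S) {n a : V} (hn : n ∈ S) (ha : a ∈ S)
    (han : a ≠ n) : G.Touches (G.compIn (S \ {n}) a) n := by
  obtain ⟨c, -, hcT, d, hdS, hdT, hcd⟩ := hS.exists_boundary (T := G.compIn (S \ {n}) a) ha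
    (mem_compIn_self ⟨ha, han⟩) hn (fun h => (compIn_subset h).2 rfl)
  have : d = n := by
    by_contra hdn
    exact hdT (compIn_closed hcT ⟨hdS, hdn⟩ hcd)
  exact ⟨c, hcT, this ▸ hcd⟩

/-- A component of `W` that lies in a connected set reaching outside of `W` has a neighbour there. -/
theorem ConnSet.exists_adj_compIn {S W : Set V} (hS : G.ConnSet S) {a b : V} (ha : a ∈ S)
    (haW : a ∈ W) (hb : b ∈ S) (hbW : b ∉ W) :
    ∃ c ∈ G.compIn W a, c ∈ S ∧ ∃ d ∈ S, d ∉ W ∧ G.Adj c d := by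
  obtain ⟨c, hcS, hcT, d, hdS, hdT, hcd⟩ := hS.exists_boundary (T := G.compIn W a) ha
    (mem_compIn_self haW) hb (fun h => hbW (compIn_subset h))
  exact ⟨c, hcT, hcS, d, hdS, fun hdW => hdT (compIn_closed hcT hdW hcd), hcd⟩

/-- If a part `E` of a connected set is attached to the rest only at `n`, then both the rest and `E`
together with `n` are connected. -/
theorem ConnSet.diff_of_attached {A E : Set V} (hA : G.ConnSet A) {n : V} (hn : n ∈ A) (hnE : n ∉ E)
    (h : ∀ e ∈ E, ∀ a ∈ A, a ∉ E → G.Adj e a → a = n) : G.ConnSet (A \ E) := by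
  refine ⟨⟨n, hn, hnE⟩, fun T hT ⟨t, ht⟩ hcl => ?_⟩
  by_cases hnT : n ∈ T
  · have := hA.2 (T ∪ (A ∩ E)) (Set.union_subset (fun x hx => (hT hx).1) Set.inter_subset_left)
      ⟨t, Or.inl ht⟩ ?_
    · rintro x ⟨hxA, hxE⟩
      rcases this hxA with h1 | h1
      · exact h1
      · exact absurd h1.2 hxE
    · rintro a (ha | ha) b hb hab
      · by_cases hbE : b ∈ E
        · exact Or.inr ⟨hb, hbE⟩
        · exact Or.inl (hcl a ha b ⟨hb, hbE⟩ hab)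
      · by_cases hbE : b ∈ E
        · exact Or.inr ⟨hb, hbE⟩
        · exact Or.inl (h a ha.2 b hb hbE hab ▸ hnT)
  · have := hA.2 T (fun x hx => (hT hx).1) ⟨t, ht⟩ ?_
    · exact absurd (this hn) hnT
    · intro a ha b hb hab
      by_cases hbE : b ∈ E
      · have := h b hbE a (hT ha).1 (hT ha).2 hab.symm
        exact absurd (this ▸ ha) hnT
      · exact hcl a ha b ⟨hb, hbE⟩ hab

theorem ConnSet.insert_of_attached {A E : Set V} (hA : G.ConnSet A) {n : V} (hn : n ∈ A)
    (hEA : E ⊆ A) (h : ∀ e ∈ E, ∀ a ∈ A, a ∉ E → G.Adj e a → a = n) :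
    G.ConnSet (insert n E) := by
  by_cases hAE : A ⊆ insert n E
  · rwa [show insert n E = A from Set.Subset.antisymm (Set.insert_subset hn hEA) hAE]
  have : insert n E = A \ (A \ insert n E) := by
    rw [Set.sdiff_sdiff_cancel_left (Set.insert_subset hn hEA)]
  rw [this]
  refine hA.diff_of_attached hn (fun h => h.2 (Or.inl rfl)) ?_
  rintro e ⟨heA, he⟩ a haA ha hea
  rcases not_not.1 (fun h => ha ⟨haA, h⟩) with rfl | haE
  · rfl
  · exact absurd (Or.inl (h a haE e heA (fun h => he (Or.inr h)) hea.symm)) he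

/-- A connected set meeting `T` can be trimmed around `a` so as to meet `T` exactly once. -/
theorem ConnSet.exists_trim {K T : Set V} (hK : G.ConnSet K) {a : V} (ha : a ∈ K)
    (hKT : (K ∩ T).Nonempty) : ∃ K' ⊆ K, G.ConnSet K' ∧ a ∈ K' ∧ ∃ y, K' ∩ T = {y} := by
  by_cases haT : a ∈ T
  · exact ⟨{a}, by simpa, connSet_singleton a, rfl, a, by simpa⟩
  obtain ⟨b, hbK, hbT⟩ := hKT
  have haW : a ∈ K \ T := ⟨ha, haT⟩
  obtain ⟨c, hc, -, d, hdK, hdT, hcd⟩ :=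
    hK.exists_adj_compIn (W := K \ T) ha haW hbK (fun h => h.2 hbT)
  have hd : d ∈ T := by_contra fun h => hdT ⟨hdK, h⟩
  refine ⟨insert d (G.compIn (K \ T) a), Set.insert_subset hdK fun x hx => (compIn_subset hx).1,
    (connSet_compIn haW).insert ⟨c, hc, hcd⟩, Or.inr (mem_compIn_self haW), d, ?_⟩
  ext x
  constructor
  · rintro ⟨rfl | hx, hxT⟩
    · rfl
    · exact absurd hxT (compIn_subset hx).2
  · rintro rfl
    exact ⟨Or.inl rfl, hd⟩

/-- Among the subsets of a finite set with some property there is a minimal one. -/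
theorem exists_minimal_subset [Finite V] {Q : Set V → Prop} {S : Set V} (hS : Q S) :
    ∃ S' ⊆ S, Q S' ∧ ∀ S'' ⊆ S', Q S'' → S'' = S' := by
  obtain ⟨S', hle, hmin⟩ := exists_minimal_le_of_wellFoundedLT Q S hS
  exact ⟨S', hle, hmin.prop, fun S'' h1 h2 => (hmin.eq_of_le h2 h1).symm ▸ rfl⟩

end ConnSet

end SimpleGraph

namespace SimpleGraph

/-! ### Linkages and Menger's theorem -/

section Menger

variable {V : Type*} {G : SimpleGraph V}

/-- `X` can be linked from `S` inside `Ω`: there are pairwise disjoint connected subsets of `Ω`, one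
for each `x ∈ X`, that meet `S` and meet `T` exactly in `x`. Each of them contains a path from `S` to
`x`, so this is a set form of a family of disjoint `S`–`T` paths with set of ends `X`. -/
def IsLinkage (G : SimpleGraph V) (Ω S T : Set V) (X : Finset V) (Z : V → Set V) : Prop :=
  (∀ x ∈ X, G.ConnSet (Z x) ∧ Z x ⊆ Ω ∧ (Z x ∩ S).Nonempty ∧ Z x ∩ T = {x}) ∧
    ∀ x ∈ X, ∀ x' ∈ X, x ≠ x' → Disjoint (Z x) (Z x')

/-- In a minimal connected set containing `x` and meeting `S`, every other vertex `w` separates `x`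
from `S`. -/
theorem ConnSet.split_minimal {S Z : Set V} (hZ : G.ConnSet Z) {x w : V} (hx : x ∈ Z)
    (hS : (Z ∩ S).Nonempty)
    (hmin : ∀ Z' ⊆ Z, (G.ConnSet Z' ∧ x ∈ Z' ∧ (Z' ∩ S).Nonempty) → Z' = Z)
    (hw : w ∈ Z) (hwx : w ≠ x) :
    ∃ R ⊆ Z, G.ConnSet R ∧ x ∈ R ∧ w ∉ R ∧ G.Touches R w ∧ G.ConnSet (Z \ R) ∧
      ((Z \ R) ∩ S).Nonempty := by
  have hxW : x ∈ Z \ {w} := ⟨hx, hwx.symm⟩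
  have hwR : w ∉ G.compIn (Z \ {w}) x := fun h => (compIn_subset h).2 rfl
  have hRZ : G.compIn (Z \ {w}) x ⊆ Z := fun y hy => (compIn_subset hy).1
  refine ⟨G.compIn (Z \ {w}) x, hRZ, connSet_compIn hxW, mem_compIn_self hxW, hwR,
    hZ.touches_compIn hw hx hwx.symm, hZ.diff_of_attached hw hwR ?_, ?_⟩
  · intro e he a ha haR hea
    by_contra haw
    exact haR (compIn_closed he ⟨ha, haw⟩ hea)
  · obtain ⟨s, hsZ, hsS⟩ := hS
    refine ⟨s, ⟨hsZ, fun hsR => ?_⟩, hsS⟩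
    have := hmin _ hRZ ⟨connSet_compIn hxW, mem_compIn_self hxW, s, hsR, hsS⟩
    exact hwR (this.symm ▸ hw)

variable [Finite V]

/-- Replacing the sets of a linkage by minimal ones. -/
theorem IsLinkage.exists_minimal {Ω S T : Set V} {X : Finset V} {Z : V → Set V}
    (hZ : G.IsLinkage Ω S T X Z) : ∃ Z' : V → Set V, G.IsLinkage Ω S T X Z' ∧
      (∀ x ∈ X, Z' x ⊆ Z x) ∧ ∀ x ∈ X, ∀ Z'' ⊆ Z' x,
        (G.ConnSet Z'' ∧ x ∈ Z'' ∧ (Z'' ∩ S).Nonempty) → Z'' = Z' x := by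
  have : ∀ x, ∃ Z', x ∈ X → Z' ⊆ Z x ∧ (G.ConnSet Z' ∧ x ∈ Z' ∧ (Z' ∩ S).Nonempty) ∧
      ∀ Z'' ⊆ Z', (G.ConnSet Z'' ∧ x ∈ Z'' ∧ (Z'' ∩ S).Nonempty) → Z'' = Z' := by
    intro x
    by_cases hx : x ∈ X
    · obtain ⟨h1, h2, h3, h4⟩ := hZ.1 x hx
      have hxZ : x ∈ Z x := (h4.symm.subset rfl : x ∈ Z x ∩ T).1
      obtain ⟨Z', h5, h6, h7⟩ := exists_minimal_subset
        (Q := fun Z' => G.ConnSet Z' ∧ x ∈ Z' ∧ (Z' ∩ S).Nonempty) (S := Z x) ⟨h1, hxZ, h3⟩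
      exact ⟨Z', fun _ => ⟨h5, h6, h7⟩⟩
    · exact ⟨∅, fun h => absurd h hx⟩
  choose Z' hZ' using this
  refine ⟨Z', ⟨fun x hx => ?_, fun x hx x' hx' hne => ?_⟩, fun x hx => (hZ' x hx).1,
    fun x hx => (hZ' x hx).2.2⟩
  · obtain ⟨h1, h2, h3, h4⟩ := hZ.1 x hx
    obtain ⟨h5, h6, h7⟩ := hZ' x hx
    refine ⟨h6.1, h5.trans h2, h6.2.2, Set.Subset.antisymm ?_ ?_⟩
    · exact fun y hy => h4.subset ⟨h5 hy.1, hy.2⟩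
    · rintro y rfl
      exact ⟨h6.2.1, (h4.symm.subset rfl : y ∈ Z y ∩ T).2⟩
  · exact (hZ.2 x hx x' hx' hne).mono (hZ' x hx).1 (hZ' x' hx').1

/-- Menger's theorem in its augmenting form: a linkage from `S` to `T` that uses too few ends to
separate `S` from `T` can be replaced by one that keeps all its ends and has a further one. The proof
is by induction on the size of the linkage: if a connected set `K` of new vertices meets `T` and is
attached to the old linkage at `w`, then `K`, `w` and the part of the old set behind `w` are added
to `T`. -/
theorem IsLinkage.augment_aux [DecidableEq V] {Ω S : Set V} (m : ℕ) :
    ∀ (T : Set V) (X : Finset V) (Z : V → Set V), G.IsLinkage Ω S T X Z →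
      ∑ x ∈ X, (Z x).ncard = m →
      (∀ C : Finset V, C.card ≤ X.card →
        ∃ K, G.ConnSet K ∧ K ⊆ Ω ∧ (∀ c ∈ C, c ∉ K) ∧ (K ∩ S).Nonempty ∧ (K ∩ T).Nonempty) →
      ∃ y ∉ X, ∃ Z', G.IsLinkage Ω S T (insert y X) Z' := by
  induction m using Nat.strong_induction_on with
  | _ m ih => ?_
  intro T X Z₀ hZ₀ hm hsep
  obtain ⟨Z, hZ, hle, hmin⟩ := hZ₀.exists_minimal
  have hm' : ∑ x ∈ X, (Z x).ncard ≤ m :=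
    (Finset.sum_le_sum fun x hx => Set.ncard_le_ncard (hle x hx) (Set.toFinite _)).trans hm.le
  clear hZ₀ hm hle
  have hself : ∀ x ∈ X, x ∈ Z x ∧ x ∈ T := fun x hx => (hZ.1 x hx).2.2.2.symm.subset rfl
  have honly : ∀ x ∈ X, ∀ z ∈ Z x, z ∈ T → z = x := fun x hx z hz hzT =>
    (hZ.1 x hx).2.2.2.subset ⟨hz, hzT⟩
  obtain ⟨K₀, hK₀, hK₀Ω, hK₀X, ⟨s, hsK, hsS⟩, ⟨b, hbK, hbT⟩⟩ := hsep X le_rfl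
  set U : Set V := {v | ∃ x ∈ X, v ∈ Z x} with hU
  have hbU : b ∉ U := by
    rintro ⟨x, hx, hbx⟩
    exact hK₀X x hx (honly x hx b hbx hbT ▸ hbK)
  have hbW : b ∈ Ω \ U := ⟨hK₀Ω hbK, hbU⟩
  set K := G.compIn (Ω \ U) b with hK
  have hKc : G.ConnSet K := connSet_compIn hbW
  have hKΩ : K ⊆ Ω := fun z hz => (compIn_subset hz).1
  have hKU : ∀ x ∈ X, Disjoint (Z x) K := fun x hx =>
    Set.disjoint_left.2 fun z hz hzK => (compIn_subset hzK).2 ⟨x, hx, hz⟩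
  have hbKK : b ∈ K := mem_compIn_self hbW
  by_cases hKS : (K ∩ S).Nonempty
  · obtain ⟨s', hs'K, hs'S⟩ := hKS
    obtain ⟨K', hK'K, hK'c, hs'K', y, hy⟩ := hKc.exists_trim hs'K ⟨b, hbKK, hbT⟩
    have hyK : y ∈ K' ∧ y ∈ T := hy.symm.subset rfl
    have hyX : y ∉ X := fun h =>
      Set.disjoint_left.1 (hKU y h) (hself y h).1 (hK'K hyK.1)
    have hne : ∀ x ∈ X, x ≠ y := fun x hx h => hyX (h ▸ hx)
    refine ⟨y, hyX, Function.update Z y K', ?_, ?_⟩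
    · intro x hx
      rcases Finset.mem_insert.1 hx with rfl | hx
      · rw [Function.update_self]
        exact ⟨hK'c, hK'K.trans hKΩ, ⟨s', hs'K', hs'S⟩, hy⟩
      · rw [Function.update_of_ne (hne x hx)]
        exact hZ.1 x hx
    · intro x hx x' hx' hxx'
      rcases Finset.mem_insert.1 hx with h | h <;> rcases Finset.mem_insert.1 hx' with h' | h'
      · exact absurd (h.trans h'.symm) hxx'
      · rw [h, Function.update_self, Function.update_of_ne (hne x' h')]
        exact ((hKU x' h').mono_right hK'K).symm
      · rw [h', Function.update_self, Function.update_of_ne (hne x h)]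
        exact (hKU x h).mono_right hK'K
      · rw [Function.update_of_ne (hne x h), Function.update_of_ne (hne x' h')]
        exact hZ.2 x h x' h' hxx'
  · obtain ⟨c, hcK₀, hcK, w, hwK₀, hwK, hcw⟩ :=
      hK₀.exists_boundary hbK hbKK hsK (fun h => hKS ⟨s, h, hsS⟩)
    have hwU : w ∈ U := by_contra fun h => hwK (compIn_closed hcK ⟨hK₀Ω hwK₀, h⟩ hcw)
    obtain ⟨x, hx, hwx⟩ := hwU
    have hwne : w ≠ x := fun h => hK₀X x hx (h ▸ hwK₀)
    have hwT : w ∉ T := fun h => hwne (honly x hx w hwx h)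
    have hwX : w ∉ X := fun h => hwT (hself w h).2
    have hneX : ∀ z ∈ X, z ≠ w := fun z hz h => hwX (h ▸ hz)
    obtain ⟨hxc, hxΩ, hxS, hxT⟩ := hZ.1 x hx
    obtain ⟨R, hRZ, hRc, hxR, hwR, ⟨r, hrR, hrw⟩, hQc, hQS⟩ :=
      hxc.split_minimal (hself x hx).1 hxS (hmin x hx) hwx hwne
    have hdisj : ∀ x' ∈ X, x' ≠ x → ∀ z ∈ Z x', z ∉ Z x := fun x' hx' hne z hz hz' =>
      Set.disjoint_left.1 (hZ.2 x' hx' x hx hne) hz hz'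
    -- the smaller linkage, which ends in `w` instead of `x`
    set T' : Set V := T ∪ {w} ∪ R ∪ K with hT'
    set X' : Finset V := insert w (X.erase x) with hX'
    have hmemX' : ∀ z ∈ X, z ≠ x → z ∈ X' := fun z hz hne =>
      Finset.mem_insert_of_mem (Finset.mem_erase.2 ⟨hne, hz⟩)
    have hlink : G.IsLinkage Ω S T' X' (Function.update Z w (Z x \ R)) := by
      refine ⟨fun z hz => ?_, fun z hz z' hz' hzz' => ?_⟩
      · rcases Finset.mem_insert.1 hz with rfl | hz
        · rw [Function.update_self]
          refine ⟨hQc, fun v hv => hxΩ hv.1, hQS, Set.Subset.antisymm ?_ ?_⟩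
          · rintro v ⟨⟨hvZ, hvR⟩, ((hv | hv) | hv) | hv⟩
            · exact absurd (honly x hx v hvZ hv ▸ hxR) hvR
            · exact hv
            · exact absurd hv hvR
            · exact absurd hv (Set.disjoint_left.1 (hKU x hx) hvZ)
          · rintro v rfl
            exact ⟨⟨hwx, hwR⟩, Or.inl (Or.inl (Or.inr rfl))⟩
        · obtain ⟨hzx, hzX⟩ := Finset.mem_erase.1 hz
          rw [Function.update_of_ne (hneX _ hzX)]
          refine ⟨(hZ.1 z hzX).1, (hZ.1 z hzX).2.1, (hZ.1 z hzX).2.2.1,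
            Set.Subset.antisymm ?_ ?_⟩
          · rintro v ⟨hvZ, ((hv | hv) | hv) | hv⟩
            · exact honly z hzX v hvZ hv
            · exact absurd (hv ▸ hwx) (hdisj z hzX hzx v hvZ)
            · exact absurd (hRZ hv) (hdisj z hzX hzx v hvZ)
            · exact absurd hv (Set.disjoint_left.1 (hKU z hzX) hvZ)
          · rintro v rfl
            exact ⟨(hself v hzX).1, Or.inl (Or.inl (Or.inl (hself v hzX).2))⟩
      · rcases Finset.mem_insert.1 hz with h | h <;> rcases Finset.mem_insert.1 hz' with h' | h'
        · exact absurd (h.trans h'.symm) hzz'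
        · obtain ⟨hzx, hzX⟩ := Finset.mem_erase.1 h'
          rw [h, Function.update_self, Function.update_of_ne (hneX _ hzX)]
          exact (hZ.2 x hx z' hzX hzx.symm).mono_left Set.sdiff_subset
        · obtain ⟨hzx, hzX⟩ := Finset.mem_erase.1 h
          rw [h', Function.update_self, Function.update_of_ne (hneX _ hzX)]
          exact (hZ.2 z hzX x hx hzx).mono_right Set.sdiff_subset
        · obtain ⟨hzx, hzX⟩ := Finset.mem_erase.1 h
          obtain ⟨hzx', hzX'⟩ := Finset.mem_erase.1 h'
          rw [Function.update_of_ne (hneX _ hzX),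
            Function.update_of_ne (hneX _ hzX')]
          exact hZ.2 z hzX z' hzX' hzz'
    have hcard : X'.card = X.card := by
      rw [hX', Finset.card_insert_of_notMem (fun h => hwX (Finset.mem_of_mem_erase h)),
        Finset.card_erase_add_one hx]
    have hlt : ∑ z ∈ X', (Function.update Z w (Z x \ R) z).ncard < m := by
      have hsum : ∑ z ∈ X.erase x, (Function.update Z w (Z x \ R) z).ncard =
          ∑ z ∈ X.erase x, (Z z).ncard := Finset.sum_congr rfl fun z hz => by
        rw [Function.update_of_ne (hneX z (Finset.mem_of_mem_erase hz))]
      rw [hX', Finset.sum_insert (fun h => hwX (Finset.mem_of_mem_erase h)), Function.update_self,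
        hsum]
      rw [← Finset.add_sum_erase X _ hx] at hm'
      have : (Z x \ R).ncard < (Z x).ncard :=
        Set.ncard_lt_ncard ⟨Set.sdiff_subset, fun h => (h (hself x hx).1).2 hxR⟩ (Set.toFinite _)
      omega
    obtain ⟨y', hy'X, Z', hZ'⟩ := ih _ hlt T' X' _ hlink rfl fun C hC => by
      obtain ⟨K₁, h1, h2, h3, h4, v, hv, hvT⟩ := hsep C (hcard ▸ hC)
      exact ⟨K₁, h1, h2, h3, h4, v, hv, Or.inl (Or.inl (Or.inl hvT))⟩
    have hwX' : w ∈ insert y' X' := Finset.mem_insert_of_mem (Finset.mem_insert_self _ _)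
    have hyX' : y' ∈ insert y' X' := Finset.mem_insert_self _ _
    have hzX' : ∀ z ∈ X, z ≠ x → z ∈ insert y' X' := fun z hz hne =>
      Finset.mem_insert_of_mem (hmemX' z hz hne)
    have hself' : ∀ z ∈ insert y' X', z ∈ Z' z ∧ z ∈ T' := fun z hz =>
      (hZ'.1 z hz).2.2.2.symm.subset rfl
    have honly' : ∀ z ∈ insert y' X', ∀ v ∈ Z' z, v ∈ T' → v = z := fun z hz v hv hvT =>
      (hZ'.1 z hz).2.2.2.subset ⟨hv, hvT⟩
    have hTT' : T ⊆ T' := fun v hv => Or.inl (Or.inl (Or.inl hv))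
    have hRT' : R ⊆ T' := fun v hv => Or.inl (Or.inr hv)
    have hKT' : K ⊆ T' := fun v hv => Or.inr hv
    have hRK : ∀ v ∈ R, v ∉ K := fun v hv => Set.disjoint_left.1 (hKU x hx) (hRZ hv)
    have hRΩ : R ⊆ Ω := hRZ.trans hxΩ
    have hyw : y' ≠ w := fun h => hy'X (h ▸ Finset.mem_insert_self _ _)
    have hw0 : ∀ v ∈ Z' w, v ∉ T := fun v hv hvT => hwT (honly' w hwX' v hv (hTT' hvT) ▸ hvT)
    have hRT : ∀ v ∈ R, v ∈ T → v = x := fun v hv hvT => honly x hx v (hRZ hv) hvT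
    -- it suffices to find new sets for `x` and for one further end `y`
    suffices h : ∃ y ∉ X, ∃ Zx Zy : Set V, (G.ConnSet Zx ∧ Zx ⊆ Ω ∧ (Zx ∩ S).Nonempty ∧ Zx ∩ T = {x}) ∧
        (G.ConnSet Zy ∧ Zy ⊆ Ω ∧ (Zy ∩ S).Nonempty ∧ Zy ∩ T = {y}) ∧ Disjoint Zx Zy ∧
        (Zx ∪ Zy ⊆ Z' w ∪ Z' y' ∪ R ∪ K) by
      obtain ⟨y, hyX, Zx, Zy, hZx, hZy, hxy, hsub⟩ := h
      have hyx : y ≠ x := fun h => hyX (h ▸ hx)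
      have hney : ∀ z ∈ X, z ≠ y := fun z hz h => hyX (h ▸ hz)
      have hother : ∀ z ∈ X, z ≠ x → Disjoint (Z' z) (Zx ∪ Zy) := by
        intro z hz hzx
        refine Set.disjoint_left.2 fun v hv hv' => ?_
        have hzw : z ≠ w := fun h => hwX (h ▸ hz)
        have hzy : z ≠ y' := fun h => hy'X (h ▸ hmemX' z hz hzx)
        rcases hsub hv' with ((h | h) | h) | h
        · exact Set.disjoint_left.1 (hZ'.2 z (hzX' z hz hzx) w hwX' hzw) hv h
        · exact Set.disjoint_left.1 (hZ'.2 z (hzX' z hz hzx) y' hyX' hzy) hv h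
        · have := honly' z (hzX' z hz hzx) v hv (hRT' h)
          exact hdisj z hz hzx z (hself z hz).1 (hRZ (this ▸ h))
        · have := honly' z (hzX' z hz hzx) v hv (hKT' h)
          exact Set.disjoint_left.1 (hKU z hz) (hself z hz).1 (this ▸ h)
      have hval : ∀ z ∈ X, z ≠ x → Function.update (Function.update Z' x Zx) y Zy z = Z' z := by
        intro z hz hzx
        rw [Function.update_of_ne (hney z hz), Function.update_of_ne hzx]
      have hvalx : Function.update (Function.update Z' x Zx) y Zy x = Zx := by
        rw [Function.update_of_ne hyx.symm, Function.update_self]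
      have hvaly : Function.update (Function.update Z' x Zx) y Zy y = Zy := Function.update_self ..
      refine ⟨y, hyX, Function.update (Function.update Z' x Zx) y Zy, ?_, ?_⟩
      · intro z hz
        rcases Finset.mem_insert.1 hz with h | h
        · rw [h, hvaly]; exact hZy
        · by_cases hzx : z = x
          · rw [hzx, hvalx]; exact hZx
          · rw [hval z h hzx]
            obtain ⟨h1, h2, h3, h4⟩ := hZ'.1 z (hzX' z h hzx)
            refine ⟨h1, h2, h3, Set.Subset.antisymm ?_ ?_⟩
            · exact fun v hv => h4.subset ⟨hv.1, hTT' hv.2⟩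
            · rintro v rfl
              exact ⟨(hself' v (hzX' v h hzx)).1, (hself v h).2⟩
      · have hsymm : ∀ z ∈ insert y X, z = y ∨ z = x ∨ (z ∈ X ∧ z ≠ x) := by
          intro z hz
          rcases Finset.mem_insert.1 hz with h | h
          · exact Or.inl h
          · by_cases hzx : z = x
            · exact Or.inr (Or.inl hzx)
            · exact Or.inr (Or.inr ⟨h, hzx⟩)
        intro z hz z' hz' hzz'
        rcases hsymm z hz with h | h | ⟨h, hzx⟩ <;> rcases hsymm z' hz' with h' | h' | ⟨h', hzx'⟩
        · exact absurd (h.trans h'.symm) hzz'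
        · rw [h, h', hvaly, hvalx]; exact hxy.symm
        · rw [h, hvaly, hval z' h' hzx']
          exact ((hother z' h' hzx').mono_right Set.subset_union_right).symm
        · rw [h, h', hvaly, hvalx]; exact hxy
        · exact absurd (h.trans h'.symm) hzz'
        · rw [h, hvalx, hval z' h' hzx']
          exact ((hother z' h' hzx').mono_right Set.subset_union_left).symm
        · rw [h', hvaly, hval z h hzx]
          exact (hother z h hzx).mono_right Set.subset_union_right
        · rw [h', hvalx, hval z h hzx]
          exact (hother z h hzx).mono_right Set.subset_union_left
        · rw [hval z h hzx, hval z' h' hzx']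
          exact hZ'.2 z (hzX' z h hzx) z' (hzX' z' h' hzx') hzz'
    obtain ⟨hwc, hwΩ, hwS, -⟩ := hZ'.1 w hwX'
    obtain ⟨hyc, hyΩ, hyS, -⟩ := hZ'.1 y' hyX'
    have hwy : Disjoint (Z' w) (Z' y') := hZ'.2 w hwX' y' hyX' hyw.symm
    have hwR' : ∀ v ∈ Z' w, v ∉ R := fun v hv h => hwR (honly' w hwX' v hv (hRT' h) ▸ h)
    have hwK' : ∀ v ∈ Z' w, v ∉ K := fun v hv h => hwK (honly' w hwX' v hv (hKT' h) ▸ h)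
    by_cases hyR : y' ∈ R
    · obtain ⟨K', hK'K, hK'c, hcK', y, hy⟩ := hKc.exists_trim hcK ⟨b, hbKK, hbT⟩
      have hyK : y ∈ K' ∧ y ∈ T := hy.symm.subset rfl
      refine ⟨y, fun h => Set.disjoint_left.1 (hKU y h) (hself y h).1 (hK'K hyK.1),
        Z' y' ∪ R, Z' w ∪ K',
        ⟨hyc.union_of_mem hRc (hself' y' hyX').1 hyR, Set.union_subset hyΩ hRΩ,
          hyS.mono (Set.inter_subset_inter_left _ Set.subset_union_left),
          Set.Subset.antisymm ?_ ?_⟩,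
        ⟨hwc.union_of_adj hK'c (hself' w hwX').1 hcK' hcw.symm,
          Set.union_subset hwΩ (hK'K.trans hKΩ),
          hwS.mono (Set.inter_subset_inter_left _ Set.subset_union_left),
          Set.Subset.antisymm ?_ ?_⟩, Set.disjoint_left.2 ?_, ?_⟩
      · rintro v ⟨hv | hv, hvT⟩
        · have := honly' y' hyX' v hv (hTT' hvT)
          exact hRT v (this ▸ hyR) hvT
        · exact hRT v hv hvT
      · rintro v rfl
        exact ⟨Or.inr hxR, (hself v hx).2⟩
      · rintro v ⟨hv | hv, hvT⟩
        · exact absurd hvT (hw0 v hv)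
        · exact hy.subset ⟨hv, hvT⟩
      · rintro v rfl
        exact ⟨Or.inr hyK.1, hyK.2⟩
      · rintro v (hv | hv) (hv' | hv')
        · exact Set.disjoint_left.1 hwy hv' hv
        · have := honly' y' hyX' v hv (hKT' (hK'K hv'))
          exact hRK y' hyR (this ▸ hK'K hv')
        · exact hwR' v hv' hv
        · exact hRK v hv (hK'K hv')
      · rintro v ((hv | hv) | (hv | hv))
        · exact Or.inl (Or.inl (Or.inr hv))
        · exact Or.inl (Or.inr hv)
        · exact Or.inl (Or.inl (Or.inl hv))
        · exact Or.inr (hK'K hv)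
    · have hK' : ∃ K', G.ConnSet K' ∧ (∀ v ∈ K', v ∈ K ∨ v = y') ∧ y' ∈ K' ∧ ∃ y ∉ X,
          K' ∩ T = {y} := by
        by_cases hyT : y' ∈ T
        · refine ⟨{y'}, connSet_singleton y', fun v hv => Or.inr hv, rfl, y', fun h => ?_, by simpa⟩
          exact hy'X (hmemX' y' h fun h => hyR (h ▸ hxR))
        · have hyK : y' ∈ K := by
            rcases (hself' y' hyX').2 with ((h | h) | h) | h
            · exact absurd h hyT
            · exact absurd h hyw
            · exact absurd h hyR
            · exact h
          obtain ⟨K', hK'K, hK'c, hcK', y, hy⟩ := hKc.exists_trim hyK ⟨b, hbKK, hbT⟩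
          have hyK : y ∈ K' ∧ y ∈ T := hy.symm.subset rfl
          exact ⟨K', hK'c, fun v hv => Or.inl (hK'K hv), hcK', y, fun h =>
            Set.disjoint_left.1 (hKU y h) (hself y h).1 (hK'K hyK.1), hy⟩
      obtain ⟨K', hK'c, hK'K, hyK', y, hyX, hy⟩ := hK'
      have hyK : y ∈ K' ∧ y ∈ T := hy.symm.subset rfl
      have hyΩ' : y' ∈ Ω := hyΩ (hself' y' hyX').1
      refine ⟨y, hyX, Z' w ∪ R, Z' y' ∪ K',
        ⟨hwc.union_of_adj hRc (hself' w hwX').1 hrR hrw.symm, Set.union_subset hwΩ hRΩ,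
          hwS.mono (Set.inter_subset_inter_left _ Set.subset_union_left),
          Set.Subset.antisymm ?_ ?_⟩,
        ⟨hyc.union_of_mem hK'c (hself' y' hyX').1 hyK',
          Set.union_subset hyΩ fun v hv => (hK'K v hv).elim (fun h => hKΩ h) (fun h => h ▸ hyΩ'),
          hyS.mono (Set.inter_subset_inter_left _ Set.subset_union_left),
          Set.Subset.antisymm ?_ ?_⟩, Set.disjoint_left.2 ?_, ?_⟩
      · rintro v ⟨hv | hv, hvT⟩
        · exact absurd hvT (hw0 v hv)
        · exact hRT v hv hvT
      · rintro v rfl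
        exact ⟨Or.inr hxR, (hself v hx).2⟩
      · rintro v ⟨hv | hv, hvT⟩
        · have := honly' y' hyX' v hv (hTT' hvT)
          exact hy.subset ⟨this ▸ hyK', hvT⟩
        · exact hy.subset ⟨hv, hvT⟩
      · rintro v rfl
        exact ⟨Or.inr hyK.1, hyK.2⟩
      · rintro v (hv | hv) (hv' | hv')
        · exact Set.disjoint_left.1 hwy hv hv'
        · rcases hK'K v hv' with h | h
          · exact hwK' v hv h
          · exact Set.disjoint_left.1 hwy hv (h ▸ (hself' y' hyX').1)
        · exact hyR (honly' y' hyX' v hv' (hRT' hv) ▸ hv)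
        · rcases hK'K v hv' with h | h
          · exact hRK v hv h
          · exact hyR (h ▸ hv)
      · rintro v ((hv | hv) | (hv | hv))
        · exact Or.inl (Or.inl (Or.inl hv))
        · exact Or.inl (Or.inr hv)
        · exact Or.inl (Or.inl (Or.inr hv))
        · rcases hK'K v hv with h | h
          · exact Or.inr h
          · exact Or.inl (Or.inl (Or.inr (h ▸ (hself' y' hyX').1)))

theorem IsLinkage.augment [DecidableEq V] {Ω S T : Set V} {X : Finset V} {Z : V → Set V}
    (hZ : G.IsLinkage Ω S T X Z)
    (hsep : ∀ C : Finset V, C.card ≤ X.card →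
      ∃ K, G.ConnSet K ∧ K ⊆ Ω ∧ (∀ c ∈ C, c ∉ K) ∧ (K ∩ S).Nonempty ∧ (K ∩ T).Nonempty) :
    ∃ y ∉ X, ∃ Z', G.IsLinkage Ω S T (insert y X) Z' :=
  IsLinkage.augment_aux _ T X Z hZ rfl hsep

/-- Menger's theorem for two paths. -/
theorem exists_two_linkage {Ω S T : Set V}
    (h0 : ∃ K, G.ConnSet K ∧ K ⊆ Ω ∧ (K ∩ S).Nonempty ∧ (K ∩ T).Nonempty)
    (h1 : ∀ c, ∃ K, G.ConnSet K ∧ K ⊆ Ω ∧ c ∉ K ∧ (K ∩ S).Nonempty ∧ (K ∩ T).Nonempty) :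
    ∃ a b, a ≠ b ∧ ∃ Za Zb, Disjoint Za Zb ∧
      (G.ConnSet Za ∧ Za ⊆ Ω ∧ (Za ∩ S).Nonempty ∧ Za ∩ T = {a}) ∧
      (G.ConnSet Zb ∧ Zb ⊆ Ω ∧ (Zb ∩ S).Nonempty ∧ Zb ∩ T = {b}) := by
  classical
  have hZ : G.IsLinkage Ω S T ∅ fun _ => ∅ := ⟨by simp, by simp⟩
  obtain ⟨a, ha, Z₁, hZ₁⟩ := hZ.augment fun C hC => by
    obtain ⟨K, h⟩ := h0
    have : C = ∅ := by simpa using hC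
    exact ⟨K, h.1, h.2.1, by simp [this], h.2.2⟩
  obtain ⟨b, hb, Z₂, hZ₂⟩ := hZ₁.augment fun C hC => by
    rw [Finset.card_insert_of_notMem ha, Finset.card_empty] at hC
    have : Nonempty V := ⟨a⟩
    rcases Finset.card_le_one_iff_subset_singleton.1 hC with ⟨c, hc⟩
    obtain ⟨K, h⟩ := h1 c
    exact ⟨K, h.1, h.2.1, fun c' hc' => by rw [Finset.mem_singleton.1 (hc hc')]; exact h.2.2.1,
      h.2.2.2⟩
  have hab : a ≠ b := fun h => hb (h ▸ Finset.mem_insert_self _ _)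
  exact ⟨a, b, hab, Z₂ a, Z₂ b, hZ₂.2 a (by simp) b (by simp) hab, hZ₂.1 a (by simp),
    hZ₂.1 b (by simp)⟩

end Menger

end SimpleGraph

namespace SimpleGraph

/-! ### Fans -/

section Fan

variable {V : Type*} {G : SimpleGraph V}

/-- In a minimal connected set `W` touching both `a` and `b`, every vertex `w` has two disjoint
branches, one leading to `a` and one to `b`. -/
theorem exists_branches_of_minimal {W : Set V} (hW : G.ConnSet W) {a b : V} (hab : a ≠ b)
    (ha : a ∉ W) (hb : b ∉ W) (hWa : G.Touches W a) (hWb : G.Touches W b)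
    (hmin : ∀ W' ⊆ W, (G.ConnSet W' ∧ G.Touches W' a ∧ G.Touches W' b) → W' = W)
    {w : V} (hw : w ∈ W) :
    ∃ Za Zb : Set V, Disjoint Za Zb ∧
      (G.ConnSet Za ∧ a ∈ Za ∧ Za ⊆ insert a (W \ {w}) ∧ G.Touches Za w) ∧
      (G.ConnSet Zb ∧ b ∈ Zb ∧ Zb ⊆ insert b (W \ {w}) ∧ G.Touches Zb w) := by
  have key : ∀ {a : V}, G.Touches W a → ∃ K ⊆ W \ {w}, G.ConnSet (insert a K) ∧
      G.Touches (insert a K) w ∧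
      ∀ z ∈ K, ∃ Z ⊆ W \ {w}, G.ConnSet Z ∧ z ∈ Z ∧ G.Touches Z a := by
    intro a hWa
    by_cases haw : G.Adj a w
    · refine ⟨∅, Set.empty_subset _, ?_, ⟨a, Or.inl rfl, haw⟩, by simp⟩
      simpa using connSet_singleton a
    · obtain ⟨s, hs, hsa⟩ := hWa
      have hsw : s ≠ w := fun h => haw (h ▸ hsa).symm
      have hsW : s ∈ W \ {w} := ⟨hs, hsw⟩
      have hK := connSet_compIn (G := G) hsW
      have hsK := mem_compIn_self (G := G) hsW
      refine ⟨G.compIn (W \ {w}) s, compIn_subset, hK.insert ⟨s, hsK, hsa⟩,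
        (hW.touches_compIn hw hs hsw).mono (Set.subset_insert _ _), fun z hz => ?_⟩
      exact ⟨_, compIn_subset, hK, hz, s, hsK, hsa⟩
  obtain ⟨Ka, hKa, h1, h2, h3⟩ := key hWa
  obtain ⟨Kb, hKb, h4, h5, h6⟩ := key hWb
  refine ⟨insert a Ka, insert b Kb, Set.disjoint_left.2 ?_,
    ⟨h1, Or.inl rfl, Set.insert_subset_insert hKa, h2⟩,
    ⟨h4, Or.inl rfl, Set.insert_subset_insert hKb, h5⟩⟩
  rintro z (rfl | hz) (rfl | hz')
  · exact hab rfl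
  · exact ha (hKb hz').1
  · exact hb (hKa hz).1
  · obtain ⟨Z, hZ, hZc, hzZ, hZa⟩ := h3 z hz
    obtain ⟨Z', hZ', hZc', hzZ', hZb⟩ := h6 z hz'
    have := hmin (Z ∪ Z') (Set.union_subset (hZ.trans Set.sdiff_subset)
      (hZ'.trans Set.sdiff_subset)) ⟨hZc.union_of_mem hZc' hzZ hzZ',
        hZa.mono Set.subset_union_left, hZb.mono Set.subset_union_right⟩
    exact (Set.union_subset hZ hZ' (this.symm ▸ hw)).2 rfl

/-- There is a minimal connected subset touching two given vertices. -/
theorem ConnSet.exists_minimal_touching [Finite V] {W : Set V} (hW : G.ConnSet W) {a b : V}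
    (hWa : G.Touches W a) (hWb : G.Touches W b) :
    ∃ W₀ ⊆ W, G.ConnSet W₀ ∧ G.Touches W₀ a ∧ G.Touches W₀ b ∧
      ∀ W' ⊆ W₀, (G.ConnSet W' ∧ G.Touches W' a ∧ G.Touches W' b) → W' = W₀ := by
  obtain ⟨W₀, h1, ⟨h2, h3, h4⟩, h5⟩ := exists_minimal_subset
    (Q := fun W' => G.ConnSet W' ∧ G.Touches W' a ∧ G.Touches W' b) ⟨hW, hWa, hWb⟩
  exact ⟨W₀, h1, h2, h3, h4, h5⟩

/-- A fan: the vertex `v` of `U` is joined to the vertices of `X`, all outside of `U`, by disjoint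
connected sets `Z x` that stay inside `U` up to their ends. -/
structure IsFan (G : SimpleGraph V) (U : Set V) (v : V) (X : Finset V) (Z : V → Set V) : Prop where
  mem : v ∈ U
  notMem : ∀ x ∈ X, x ∉ U
  conn : ∀ x ∈ X, G.ConnSet (Z x)
  self_mem : ∀ x ∈ X, x ∈ Z x
  sub : ∀ x ∈ X, Z x ⊆ insert x U
  center : ∀ x ∈ X, v ∉ Z x
  touches : ∀ x ∈ X, G.Touches (Z x) v
  disj : ∀ x ∈ X, ∀ x' ∈ X, x ≠ x' → Disjoint (Z x) (Z x')

theorem IsFan.touches_end {U : Set V} {v : V} {X : Finset V} {Z : V → Set V}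
    (h : G.IsFan U v X Z) {x : V} (hx : x ∈ X) : G.Touches U x := by
  by_cases hZ : ∃ z ∈ Z x, z ≠ x
  · obtain ⟨z, hz, hzx⟩ := hZ
    obtain ⟨c, hcZ, hcx, d, -, hdx, hcd⟩ :=
      (h.conn x hx).exists_boundary (T := {x}ᶜ) hz hzx (h.self_mem x hx) (fun h => h rfl)
    have : d = x := not_not.1 hdx
    exact ⟨c, (h.sub x hx hcZ).resolve_left hcx, this ▸ hcd⟩
  · push Not at hZ
    obtain ⟨z, hz, hzv⟩ := h.touches x hx
    exact ⟨v, h.mem, hZ z hz ▸ hzv.symm⟩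

/-- Three vertices touched by a connected set are the ends of a fan. -/
theorem ConnSet.exists_fan_three [Finite V] [DecidableEq V] {U : Set V} (hU : G.ConnSet U)
    {a b c : V} (hab : a ≠ b) (hac : a ≠ c) (hbc : b ≠ c) (ha : a ∉ U) (hb : b ∉ U) (hc : c ∉ U)
    (hUa : G.Touches U a) (hUb : G.Touches U b) (hUc : G.Touches U c) :
    ∃ v Z, G.IsFan U v {a, b, c} Z := by
  obtain ⟨W, hWU, hW, hWa, hWb, hmin⟩ := hU.exists_minimal_touching hUa hUb
  have h3 : ∃ w ∈ W, ∃ Zc, G.ConnSet Zc ∧ c ∈ Zc ∧ Zc ⊆ insert c (U \ W) ∧ G.Touches Zc w := by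
    by_cases hWc : G.Touches W c
    · obtain ⟨w, hw, hwc⟩ := hWc
      exact ⟨w, hw, {c}, connSet_singleton c, rfl, by simp, c, rfl, hwc.symm⟩
    · obtain ⟨u, hu, huc⟩ := hUc
      obtain ⟨w₀, hw₀⟩ := hW.1
      have huW : u ∈ U \ W := ⟨hu, fun h => hWc ⟨u, h, huc⟩⟩
      obtain ⟨e, he, -, w, hwU, hwW, hew⟩ := hU.exists_adj_compIn (W := U \ W) hu huW
        (hWU hw₀) (fun h => h.2 hw₀)
      refine ⟨w, by_contra fun h => hwW ⟨hwU, h⟩, insert c (G.compIn (U \ W) u),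
        (connSet_compIn huW).insert ⟨u, mem_compIn_self huW, huc⟩, Or.inl rfl,
        Set.insert_subset_insert compIn_subset, e, Or.inr he, hew⟩
  obtain ⟨w, hw, Zc, h4, h5, h6, h7⟩ := h3
  obtain ⟨Za, Zb, hd, ⟨a1, a2, a3, a4⟩, ⟨b1, b2, b3, b4⟩⟩ := exists_branches_of_minimal hW hab
    (fun h => ha (hWU h)) (fun h => hb (hWU h)) hWa hWb hmin hw
  have hsub : ∀ {x : V}, insert x (W \ {w}) ⊆ insert x U := fun {x} =>
    Set.insert_subset_insert fun z hz => hWU hz.1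
  have hac' : Disjoint Za Zc := Set.disjoint_left.2 fun z hz hz' => by
    rcases a3 hz with rfl | h <;> rcases h6 hz' with rfl | h'
    · exact hac rfl
    · exact ha h'.1
    · exact hc (hWU h.1)
    · exact h'.2 h.1
  have hbc' : Disjoint Zb Zc := Set.disjoint_left.2 fun z hz hz' => by
    rcases b3 hz with rfl | h <;> rcases h6 hz' with rfl | h'
    · exact hbc rfl
    · exact hb h'.1
    · exact hc (hWU h.1)
    · exact h'.2 h.1
  have hwU := hWU hw
  have hwa : w ≠ a := fun h => ha (h ▸ hwU)
  have hwb : w ≠ b := fun h => hb (h ▸ hwU)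
  have hwc : w ≠ c := fun h => hc (h ▸ hwU)
  let Z : V → Set V := fun x => if x = a then Za else if x = b then Zb else Zc
  have hZa : Z a = Za := by simp [Z]
  have hZb : Z b = Zb := by simp [Z, hab.symm]
  have hZc : Z c = Zc := by simp [Z, hac.symm, hbc.symm]
  have hall : ∀ {Q : V → Prop}, Q a → Q b → Q c → ∀ x ∈ ({a, b, c} : Finset V), Q x := by
    intro Q qa qb qc x hx
    simp only [Finset.mem_insert, Finset.mem_singleton] at hx
    rcases hx with rfl | rfl | rfl <;> assumption
  refine ⟨w, Z, hwU, hall ha hb hc, hall (hZa ▸ a1) (hZb ▸ b1) (hZc ▸ h4),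
    hall (hZa ▸ a2) (hZb ▸ b2) (hZc ▸ h5),
    hall (hZa ▸ a3.trans hsub) (hZb ▸ b3.trans hsub)
      (hZc ▸ h6.trans (Set.insert_subset_insert Set.sdiff_subset)),
    hall (hZa ▸ fun h => (a3 h).elim hwa fun h => h.2 rfl)
      (hZb ▸ fun h => (b3 h).elim hwb fun h => h.2 rfl)
      (hZc ▸ fun h => (h6 h).elim hwc fun h => h.2 hw),
    hall (hZa ▸ a4) (hZb ▸ b4) (hZc ▸ h7), ?_⟩
  refine hall (hall ?_ ?_ ?_) (hall ?_ ?_ ?_) (hall ?_ ?_ ?_) <;> intro hne <;>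
    simp only [hZa, hZb, hZc] <;>
    first
      | exact absurd rfl hne
      | assumption
      | exact hd.symm
      | exact hac'.symm
      | exact hbc'.symm

/-- If no four vertices separate two others, then three vertices touched by a connected set `U` are
among the ends of a fan with five ends. -/
theorem ConnSet.exists_fan_five [Finite V] [DecidableEq V]
    (h5 : ∀ X : Finset V, X.card ≤ 4 → ∀ a ∉ X, ∀ b ∉ X,
      ∃ K, G.ConnSet K ∧ a ∈ K ∧ b ∈ K ∧ ∀ c ∈ X, c ∉ K)
    {U : Set V} (hU : G.ConnSet U) (hout : ∀ X : Finset V, X.card ≤ 4 → ∃ t ∉ U, t ∉ X)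
    {a b c : V} (hab : a ≠ b) (hac : a ≠ c) (hbc : b ≠ c) (ha : a ∉ U) (hb : b ∉ U) (hc : c ∉ U)
    (hUa : G.Touches U a) (hUb : G.Touches U b) (hUc : G.Touches U c) :
    ∃ v X Z, G.IsFan U v X Z ∧ X.card = 5 ∧ a ∈ X ∧ b ∈ X ∧ c ∈ X := by
  obtain ⟨v, Z, hZ⟩ := hU.exists_fan_three hab hac hbc ha hb hc hUa hUb hUc
  have hsep : ∀ C : Finset V, C.card ≤ 4 → ∃ K, G.ConnSet K ∧ K ⊆ ({v}ᶜ : Set V) ∧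
      (∀ c ∈ C, c ∉ K) ∧ (K ∩ {w | G.Adj v w}).Nonempty ∧ (K ∩ Uᶜ).Nonempty := by
    intro C hC
    obtain ⟨t, htU, htC⟩ := hout C hC
    have htv : t ≠ v := fun h => htU (h ▸ hZ.mem)
    obtain ⟨K, hK, hvK, htK, hCK⟩ := h5 (C.erase v) ((Finset.card_erase_le).trans hC) v
      (by simp) t (fun h => htC (Finset.mem_of_mem_erase h))
    have htK' : t ∈ K \ {v} := ⟨htK, htv⟩
    obtain ⟨w, hw, hwv⟩ := hK.touches_compIn hvK htK htv
    refine ⟨G.compIn (K \ {v}) t, connSet_compIn htK', fun z hz => (compIn_subset hz).2, ?_,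
      ⟨w, hw, hwv.symm⟩, t, mem_compIn_self htK', htU⟩
    intro c hc hcK
    obtain ⟨h1, h2⟩ := compIn_subset hcK
    exact hCK c (Finset.mem_erase.2 ⟨h2, hc⟩) h1
  have hL : G.IsLinkage {v}ᶜ {w | G.Adj v w} Uᶜ {a, b, c} Z := by
    refine ⟨fun x hx => ⟨hZ.conn x hx, fun z hz h => hZ.center x hx (h ▸ hz), ?_, ?_⟩, hZ.disj⟩
    · obtain ⟨s, hs, hsv⟩ := hZ.touches x hx
      exact ⟨s, hs, hsv.symm⟩
    · refine Set.Subset.antisymm (fun z hz => (hZ.sub x hx hz.1).resolve_right hz.2) ?_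
      rintro z rfl
      exact ⟨hZ.self_mem z hx, hZ.notMem z hx⟩
  have h3 : ({a, b, c} : Finset V).card = 3 := Finset.card_eq_three.2 ⟨a, b, c, hab, hac, hbc, rfl⟩
  obtain ⟨d, hd, Z₁, hL₁⟩ := hL.augment fun C hC => hsep C (by omega)
  have h4 : (insert d {a, b, c} : Finset V).card = 4 := by
    rw [Finset.card_insert_of_notMem hd, h3]
  obtain ⟨e, he, Z₂, hL₂⟩ := hL₁.augment fun C hC => hsep C (by omega)
  have hmem : ∀ x ∈ insert e (insert d ({a, b, c} : Finset V)), x ∈ Z₂ x ∧ x ∉ U := fun x hx =>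
    (hL₂.1 x hx).2.2.2.symm.subset rfl
  refine ⟨v, _, Z₂, ⟨hZ.mem, fun x hx => (hmem x hx).2, fun x hx => (hL₂.1 x hx).1,
    fun x hx => (hmem x hx).1, fun x hx z hz => ?_, fun x hx h => (hL₂.1 x hx).2.1 h rfl,
    fun x hx => ?_, hL₂.2⟩, by rw [Finset.card_insert_of_notMem he, h4], by simp, by simp, by simp⟩
  · by_cases hzU : z ∈ U
    · exact Or.inr hzU
    · exact Or.inl ((hL₂.1 x hx).2.2.2.subset ⟨hz, hzU⟩)
  · obtain ⟨s, hs, hsv⟩ := (hL₂.1 x hx).2.2.1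
    exact ⟨s, hs, hsv.symm⟩

end Fan

/-! ### Subdivisions from disjoint connected sets -/

section Subdivision

variable {V : Type*} {G : SimpleGraph V}

/-- The vertices `a` and `b` can be joined through `W`: by an edge, or by a path all of whose inner
vertices are in `W`. -/
def JoinedIn (G : SimpleGraph V) (W : Set V) (a b : V) : Prop :=
  ∃ S, G.ConnSet S ∧ a ∈ S ∧ b ∈ S ∧ S ⊆ W ∪ {a, b}

theorem JoinedIn.mono {W W' : Set V} {a b : V} (h : G.JoinedIn W a b) (hW : W ⊆ W') :
    G.JoinedIn W' a b :=
  let ⟨S, h1, h2, h3, h4⟩ := h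
  ⟨S, h1, h2, h3, h4.trans (Set.union_subset_union_left _ hW)⟩

theorem JoinedIn.symm {W : Set V} {a b : V} (h : G.JoinedIn W a b) : G.JoinedIn W b a :=
  let ⟨S, h1, h2, h3, h4⟩ := h
  ⟨S, h1, h3, h2, Set.pair_comm a b ▸ h4⟩

theorem joinedIn_of_adj {W : Set V} {a b : V} (h : G.Adj a b) : G.JoinedIn W a b :=
  ⟨{b, a}, (connSet_singleton a).insert ⟨a, rfl, h⟩, Or.inr rfl, Or.inl rfl,
    fun _ hx => Or.inr (hx.elim Or.inr Or.inl)⟩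

theorem ConnSet.joinedIn {W S : Set V} (hS : G.ConnSet S) {a b : V} (ha : G.Touches S a)
    (hb : b ∈ S) (hW : S \ {b} ⊆ W) : G.JoinedIn W a b := by
  refine ⟨insert a S, hS.insert ha, Or.inl rfl, Or.inr hb, ?_⟩
  rintro x (rfl | hx)
  · exact Or.inr (Or.inl rfl)
  · by_cases hxb : x = b
    · exact Or.inr (Or.inr hxb)
    · exact Or.inl (hW ⟨hx, hxb⟩)

theorem ConnSet.joinedIn_of_touches {W S : Set V} (hS : G.ConnSet S) {a b : V}
    (ha : G.Touches S a) (hb : G.Touches S b) (hW : S ⊆ W) : G.JoinedIn W a b := by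
  refine (hS.insert hb).joinedIn (ha.mono (Set.subset_insert _ _)) (Or.inl rfl) ?_
  rintro x ⟨rfl | hx, hxb⟩
  · exact absurd rfl hxb
  · exact hW hx

theorem ConnSet.exists_path {S : Set V} (hS : G.ConnSet S) {a b : V} (ha : a ∈ S) (hb : b ∈ S) :
    ∃ p : G.Walk a b, p.IsPath ∧ ∀ v ∈ p.support, v ∈ S := by
  classical
  have := hS.2 {v | v ∈ S ∧ ∃ p : G.Walk a v, ∀ w ∈ p.support, w ∈ S} (fun v hv => hv.1)
    ⟨a, ha, Walk.nil, by simpa⟩ (by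
      rintro c ⟨hc, p, hp⟩ d hd hcd
      refine ⟨hd, p.concat hcd, fun w hw => ?_⟩
      rw [Walk.support_concat, List.mem_append, List.mem_singleton] at hw
      rcases hw with hw | rfl
      · exact hp w hw
      · exact hd)
  obtain ⟨-, p, hp⟩ := this hb
  exact ⟨p.bypass, p.bypass_isPath, fun v hv => hp v (p.support_bypass_subset_support hv)⟩

/-- Distinct branch vertices, any two of which can be joined through sets that are pairwise disjoint
and contain no branch vertex, give a subdivision of a complete graph. -/
theorem containsSubdivision_top_of_joinedIn {W : Type*} [LinearOrder W] (f : W ↪ V)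
    (L : W → W → Set V) (hL : ∀ i j, i < j → G.JoinedIn (L i j) (f i) (f j))
    (hdisj : ∀ i j k l, i < j → k < l → (i, j) ≠ (k, l) → Disjoint (L i j) (L k l))
    (hf : ∀ i j k, i < j → f k ∉ L i j) : G.ContainsSubdivision (⊤ : SimpleGraph W) := by
  have hq : ∀ i j, i < j → ∃ p : G.Walk (f i) (f j), p.IsPath ∧
      ∀ v ∈ p.support, v ∈ L i j ∪ {f i, f j} := by
    intro i j hij
    obtain ⟨S, hS, ha, hb, hsub⟩ := hL i j hij
    obtain ⟨p, hp, hpS⟩ := hS.exists_path ha hb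
    exact ⟨p, hp, fun v hv => hsub (hpS v hv)⟩
  choose q hqp hqs using hq
  let p : ∀ d : (⊤ : SimpleGraph W).Dart, G.Walk (f d.fst) (f d.snd) := fun d =>
    if h : d.fst < d.snd then q d.fst d.snd h
    else (q d.snd d.fst (lt_of_le_of_ne (not_lt.1 h) d.adj.ne.symm)).reverse
  have hp : ∀ d, (p d).IsPath := by
    intro d
    by_cases h : d.fst < d.snd
    · simp only [p, dif_pos h]
      exact hqp _ _ h
    · simp only [p, dif_neg h]
      exact (hqp _ _ _).reverse
  have hsupp : ∀ d, ∃ i j, i < j ∧ s(i, j) = d.edge ∧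
      ∀ v ∈ (p d).support, v ∈ L i j ∪ {f i, f j} := by
    intro d
    by_cases h : d.fst < d.snd
    · refine ⟨d.fst, d.snd, h, rfl, ?_⟩
      simp only [p, dif_pos h]
      exact hqs _ _ h
    · refine ⟨d.snd, d.fst, lt_of_le_of_ne (not_lt.1 h) d.adj.ne.symm, Sym2.eq_swap, ?_⟩
      simp only [p, dif_neg h, Walk.support_reverse, List.mem_reverse]
      exact hqs _ _ _
  refine ⟨_, f, p, hp, ?_, ?_, ?_, rfl⟩
  · intro d
    by_cases h : d.fst < d.snd
    · have h' : ¬ d.symm.fst < d.symm.snd := not_lt.2 h.le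
      simp only [p, dif_pos h, dif_neg h']
      rfl
    · have h' : d.symm.fst < d.symm.snd := lt_of_le_of_ne (not_lt.1 h) d.adj.ne.symm
      simp only [p, dif_neg h, dif_pos h', Walk.reverse_reverse]
      rfl
  · intro d w hw
    obtain ⟨i, j, hij, he, h⟩ := hsupp d
    have hw' : w ∈ d.edge := by
      rw [← he, Sym2.mem_iff]
      rcases h _ hw with h | h | h
      · exact absurd h (hf i j w hij)
      · exact Or.inl (f.injective h)
      · exact Or.inr (f.injective h)
    exact Sym2.mem_iff.1 hw'
  · intro d d' hne v hv hv'
    obtain ⟨i, j, hij, he, h⟩ := hsupp d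
    obtain ⟨k, l, hkl, he', h'⟩ := hsupp d'
    rcases h v hv with h1 | rfl | rfl
    · rcases h' v hv' with h2 | rfl | rfl
      · refine absurd h2 (Set.disjoint_left.1 (hdisj i j k l hij hkl ?_) h1)
        rintro ⟨⟩
        exact hne (he.symm.trans he')
      · exact ⟨_, rfl⟩
      · exact ⟨_, rfl⟩
    · exact ⟨_, rfl⟩
    · exact ⟨_, rfl⟩

end Subdivision

end SimpleGraph

namespace SimpleGraph

section Subdivision

variable {V : Type*} {G : SimpleGraph V}

/-- A subdivision of `K₅` in which the two branch vertices `x₁`, `x₂` are adjacent to the two branch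
vertices `a`, `b`. The list contains the sets through which the six other pairs are joined. -/
theorem containsSubdivision_top_five {x₁ x₂ a b c : V} (hne : [x₁, x₂, a, b, c].Nodup)
    (h1a : G.Adj x₁ a) (h1b : G.Adj x₁ b) (h2a : G.Adj x₂ a) (h2b : G.Adj x₂ b)
    {S L₁ L₂ Tab Tac Tbc : Set V} (hS : G.JoinedIn S x₁ x₂) (hL₁ : G.JoinedIn L₁ c x₁)
    (hL₂ : G.JoinedIn L₂ c x₂) (hab : G.JoinedIn Tab a b) (hac : G.JoinedIn Tac a c)
    (hbc : G.JoinedIn Tbc b c) (hd : [S, L₁, L₂, Tab, Tac, Tbc].Pairwise Disjoint)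
    (hm : ∀ T ∈ [S, L₁, L₂, Tab, Tac, Tbc], ∀ v ∈ [x₁, x₂, a, b, c], v ∉ T) :
    G.ContainsSubdivision (⊤ : SimpleGraph (Fin 5)) := by
  let e : Fin 5 → Fin 5 → Option (Fin 6) :=
    ![![none, some 0, none, none, some 1], ![none, none, none, none, some 2],
      ![none, none, none, some 3, some 4], ![none, none, none, none, some 5],
      ![none, none, none, none, none]]
  let T : Fin 6 → Set V := [S, L₁, L₂, Tab, Tac, Tbc].get
  have hT : ∀ s t, s ≠ t → Disjoint (T s) (T t) := by
    have := List.pairwise_iff_get.1 hd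
    intro s t hst
    rcases lt_or_gt_of_ne hst with h | h
    · exact this s t h
    · exact (this t s h).symm
  let f : Fin 5 → V := [x₁, x₂, a, b, c].get
  have hf : Function.Injective f := List.nodup_iff_injective_get.1 hne
  have hempty : ∀ o : Option (Fin 6), o = none → o.elim ∅ T = ∅ := by
    rintro _ rfl
    rfl
  refine containsSubdivision_top_of_joinedIn ⟨f, hf⟩ (fun i j => (e i j).elim ∅ T) ?_ ?_ ?_
  · have hlist : ∀ (Q : Fin 5 → Fin 5 → Prop), Q 0 1 → Q 0 2 → Q 0 3 → Q 0 4 → Q 1 2 → Q 1 3 →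
        Q 1 4 → Q 2 3 → Q 2 4 → Q 3 4 → ∀ i j, i < j → Q i j := by
      intro Q _ _ _ _ _ _ _ _ _ _ i j hij
      fin_cases i <;> fin_cases j <;> first | assumption | exact absurd hij (by decide)
    exact hlist _ hS (joinedIn_of_adj h1a) (joinedIn_of_adj h1b) hL₁.symm (joinedIn_of_adj h2a)
      (joinedIn_of_adj h2b) hL₂.symm hab hac hbc
  · have he : ∀ i j k l : Fin 5, (i, j) ≠ (k, l) → e i j = none ∨ e k l = none ∨
        ∃ s t, s ≠ t ∧ e i j = some s ∧ e k l = some t := by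
      decide
    intro i j k l _ _ hne
    rcases he i j k l hne with h | h | ⟨s, t, hst, h, h'⟩
    · rw [h]
      exact Set.empty_disjoint _
    · rw [h]
      exact Set.disjoint_empty _
    · rw [h, h']
      exact hT s t hst
  · intro i j k _ hk
    rcases h : e i j with _ | s
    · rw [h] at hk
      exact hk
    · rw [h] at hk
      exact hm (T s) (List.get_mem _ _) (f k) (List.get_mem _ _) hk

end Subdivision

/-! ### The path and the copy of the complete bipartite graph -/

section Config

variable {V : Type*} {G : SimpleGraph V}

/-- A hypothetical counterexample: `G` is `5`-connected and contains no subdivision of `K₅`, the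
vertices `x₁`, `x₂` are the ends of an induced path with vertex set `P`, both are adjacent to the
three vertices `y i` outside of `P`, and `G - P` is `2`-connected. Of the path, only the ways in
which its vertex set can be split into connected parts are recorded. -/
structure Config (G : SimpleGraph V) (P : Set V) (x₁ x₂ : V) (y : Fin 3 → V) : Prop where
  not_subdivision : ¬ G.ContainsSubdivision (⊤ : SimpleGraph (Fin 5))
  conn_five : ∀ X : Finset V, X.card ≤ 4 → G.ConnSet {v | v ∉ X}
  conn_two : ∀ c, G.ConnSet {v | v ∉ P ∧ v ≠ c}
  conn_path : G.ConnSet P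
  mem₁ : x₁ ∈ P
  mem₂ : x₂ ∈ P
  ne : x₁ ≠ x₂
  inj : Function.Injective y
  notMem : ∀ i, y i ∉ P
  adj₁ : ∀ i, G.Adj x₁ (y i)
  adj₂ : ∀ i, G.Adj x₂ (y i)
  split : ∀ l ∈ P, ∀ r ∈ P, l ≠ r → ∃ Q₁ Q₂, Disjoint Q₁ Q₂ ∧ Q₁ ⊆ P ∧ Q₂ ⊆ P ∧ G.ConnSet Q₁ ∧
    G.ConnSet Q₂ ∧ x₁ ∈ Q₁ ∧ x₂ ∈ Q₂ ∧ (l ∈ Q₁ ∧ r ∈ Q₂ ∨ r ∈ Q₁ ∧ l ∈ Q₂)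
  split_at : ∀ p ∈ P, p ≠ x₁ → p ≠ x₂ → ∃ Q₁ Q₂, Disjoint Q₁ Q₂ ∧ Q₁ ⊆ P \ {p} ∧ Q₂ ⊆ P \ {p} ∧
    G.ConnSet Q₁ ∧ G.ConnSet Q₂ ∧ x₁ ∈ Q₁ ∧ x₂ ∈ Q₂ ∧ G.Touches Q₁ p ∧ G.Touches Q₂ p
  degree_path : ∀ p ∈ P, ∃ a b, ∀ q ∈ P, G.Adj p q → q = a ∨ q = b

namespace Config

variable {P : Set V} {x₁ x₂ : V} {y : Fin 3 → V}

/-- Four vertices do not separate a set from a vertex outside of it. -/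
theorem false_of_closed_five (h : G.Config P x₁ x₂ y) {U : Set V} {X : Finset V}
    (hX : X.card ≤ 4) (hU : ∀ u ∈ U, ∀ w, G.Adj u w → w ∈ U ∨ w ∈ X) {u t : V} (hu : u ∈ U)
    (huX : u ∉ X) (ht : t ∉ U) (htX : t ∉ X) : False := by
  obtain ⟨c, -, hcU, d, hdX, hdU, hcd⟩ := (h.conn_five X hX).exists_boundary (T := U) huX hu htX ht
  exact (hU c hcU d hcd).elim hdU hdX

/-- One vertex does not separate a set of vertices of `G - P` from another vertex of `G - P`. -/
theorem false_of_closed_two (h : G.Config P x₁ x₂ y) {U : Set V} {c : V}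
    (hU : ∀ u ∈ U, ∀ w ∉ P, G.Adj u w → w ∈ U ∨ w = c) {u t : V} (hu : u ∈ U) (huP : u ∉ P)
    (huc : u ≠ c) (ht : t ∉ U) (htP : t ∉ P) (htc : t ≠ c) : False := by
  obtain ⟨a, -, haU, b, ⟨hbP, hbc⟩, hbU, hab⟩ :=
    (h.conn_two c).exists_boundary (T := U) ⟨huP, huc⟩ hu ⟨htP, htc⟩ ht
  exact (hU a haU b hbP hab).elim hbU hbc

theorem ne₁ (h : G.Config P x₁ x₂ y) (i : Fin 3) : x₁ ≠ y i := (h.adj₁ i).ne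

theorem ne₂ (h : G.Config P x₁ x₂ y) (i : Fin 3) : x₂ ≠ y i := (h.adj₂ i).ne

/-- The set `U` of `exists_fan` misses the five vertices `x₁`, `x₂`, `y i`, so that no four vertices
contain everything outside of `U`. -/
theorem exists_notMem (h : G.Config P x₁ x₂ y) {U : Set V} (hUP : ∀ u ∈ U, u ∉ P)
    (hUy : ∀ i, y i ∉ U) (X : Finset V) (hX : X.card ≤ 4) : ∃ t ∉ U, t ∉ X := by
  classical
  by_contra! hall
  have h1 := h.ne₁
  have h2 := h.ne₂
  have hsub : ({x₁, x₂, y 0, y 1, y 2} : Finset V) ⊆ X := by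
    intro t ht
    simp only [Finset.mem_insert, Finset.mem_singleton] at ht
    rcases ht with rfl | rfl | rfl | rfl | rfl
    · exact hall _ fun hx => hUP _ hx h.mem₁
    · exact hall _ fun hx => hUP _ hx h.mem₂
    all_goals exact hall _ (hUy _)
  have h01 := h.inj.ne (show (0 : Fin 3) ≠ 1 by decide)
  have h02 := h.inj.ne (show (0 : Fin 3) ≠ 2 by decide)
  have h12 := h.inj.ne (show (1 : Fin 3) ≠ 2 by decide)
  have : ({x₁, x₂, y 0, y 1, y 2} : Finset V).card = 5 := by
    rw [Finset.card_insert_of_notMem, Finset.card_insert_of_notMem, Finset.card_insert_of_notMem,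
      Finset.card_insert_of_notMem, Finset.card_singleton]
    all_goals have := h.ne; simp [h1, h2, h01, h02, h12, this]
  have := Finset.card_le_card hsub
  omega

/-- The three vertices `y i` cannot be joined pairwise through disjoint sets: together with `x₁`
and `x₂`, which are joined by the path, they would be the branch vertices of a subdivision. -/
theorem false_of_cycle (h : G.Config P x₁ x₂ y) {i j k : Fin 3} (hij : i ≠ j) (hik : i ≠ k)
    (hjk : j ≠ k) {R S T : Set V} (hR : G.JoinedIn R (y i) (y j)) (hS : G.JoinedIn S (y i) (y k))
    (hT : G.JoinedIn T (y j) (y k)) (hRS : Disjoint R S) (hRT : Disjoint R T) (hST : Disjoint S T)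
    (hP : ∀ v ∈ R ∪ S ∪ T, v ∉ P ∧ v ≠ y i ∧ v ≠ y j ∧ v ≠ y k) : False := by
  have hyij := h.inj.ne hij
  have hyik := h.inj.ne hik
  have hyjk := h.inj.ne hjk
  have hP' : G.JoinedIn (P \ {x₁, x₂}) x₁ x₂ :=
    ⟨P, h.conn_path, h.mem₁, h.mem₂, fun v hv => by by_cases hv' : v ∈ ({x₁, x₂} : Set V) <;> simp_all⟩
  have h1 := h.ne₁
  have h2 := h.ne₂
  have h3 := h.notMem
  have h4 := h.mem₁
  have h5 := h.mem₂
  refine h.not_subdivision (containsSubdivision_top_five (x₁ := x₁) (x₂ := x₂) (a := y i) (b := y j)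
    (c := y k) ?_ (h.adj₁ i) (h.adj₁ j) (h.adj₂ i) (h.adj₂ j) hP'
    (joinedIn_of_adj (W := ∅) (h.adj₁ k).symm) (joinedIn_of_adj (W := ∅) (h.adj₂ k).symm)
    hR hS hT ?_ ?_)
  · have := h.ne
    simp only [List.nodup_cons, List.mem_cons, List.not_mem_nil, or_false, not_or]
    grind
  · simp only [List.pairwise_cons, List.mem_cons, List.not_mem_nil, or_false, Set.disjoint_left] at *
    grind
  · simp only [List.mem_cons, List.not_mem_nil, or_false] at *
    grind

/-- If a vertex `v` outside of the path is joined to `y i`, to `y j` and to two vertices `l`, `r` of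
the path by sets that are disjoint from each other and from a set joining `y i` and `y j`, then `x₁`,
`x₂`, `y i`, `y j` and `v` are the branch vertices of a subdivision in which `x₁` and `x₂` are joined
through `y k`. -/
theorem false_of_center (h : G.Config P x₁ x₂ y) {i j k : Fin 3} {v l r : V} {R S T L M : Set V}
    (hvP : v ∉ P) (hR : G.ConnSet R) (hS : G.ConnSet S) (hT : G.ConnSet T) (hL : G.ConnSet L)
    (hM : G.ConnSet M) (hRv : G.Touches R v) (hSv : G.Touches S v) (hLv : G.Touches L v)
    (hMv : G.Touches M v) (hRi : y i ∈ R) (hSj : y j ∈ S) (hTi : G.Touches T (y i))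
    (hTj : G.Touches T (y j)) (hLP : L ∩ P = {l}) (hMP : M ∩ P = {r})
    (hP : ∀ w ∈ R ∪ S ∪ T, w ∉ P)
    (hd : [R, S, T, L, M, {v}, {y k}].Pairwise Disjoint) : False := by
  have hl : l ∈ L ∧ l ∈ P := hLP.symm.subset rfl
  have hr : r ∈ M ∧ r ∈ P := hMP.symm.subset rfl
  have hl' : ∀ w ∈ L, w ∈ P → w = l := fun w hw hwP => hLP.subset ⟨hw, hwP⟩
  have hr' : ∀ w ∈ M, w ∈ P → w = r := fun w hw hwP => hMP.subset ⟨hw, hwP⟩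
  simp only [List.pairwise_cons, List.mem_cons, List.not_mem_nil, or_false, Set.disjoint_left,
    forall_eq_or_imp, forall_eq, Set.mem_singleton_iff] at hd
  obtain ⟨⟨hRS, hRT, hRL, hRM, hRv', hRk⟩, ⟨hST, hSL, hSM, hSv', hSk⟩, ⟨hTL, hTM, hTv', hTk⟩,
    ⟨hLM, hLv', hLk⟩, ⟨hMv', hMk⟩, hvk, -⟩ := hd
  have hlr : l ≠ r := fun e => hLM hl.1 (e ▸ hr.1)
  have key : ∃ Q₁ Q₂ L M : Set V, Disjoint Q₁ Q₂ ∧ Q₁ ⊆ P ∧ Q₂ ⊆ P ∧ G.ConnSet (L ∪ Q₁) ∧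
      G.ConnSet (M ∪ Q₂) ∧ x₁ ∈ Q₁ ∧ x₂ ∈ Q₂ ∧ (∀ w ∈ L, w ∉ M ∧ w ∉ Q₂ ∧ w ∉ R ∧ w ∉ S ∧ w ∉ T ∧
        w ≠ v ∧ w ≠ y k) ∧ (∀ w ∈ M, w ∉ Q₁ ∧ w ∉ R ∧ w ∉ S ∧ w ∉ T ∧ w ≠ v ∧ w ≠ y k) ∧
      G.Touches L v ∧ G.Touches M v := by
    obtain ⟨Q₁, Q₂, hQ, hQ₁, hQ₂, hc₁, hc₂, hx₁, hx₂, hlr' | hlr'⟩ := h.split l hl.2 r hr.2 hlr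
    · refine ⟨Q₁, Q₂, L, M, hQ, hQ₁, hQ₂, hL.union_of_mem hc₁ hl.1 hlr'.1,
        hM.union_of_mem hc₂ hr.1 hlr'.2, hx₁, hx₂, ?_, ?_, hLv, hMv⟩
      · rw [Set.disjoint_left] at hQ
        grind
      · rw [Set.disjoint_left] at hQ
        grind
    · refine ⟨Q₁, Q₂, M, L, hQ, hQ₁, hQ₂, hM.union_of_mem hc₁ hr.1 hlr'.1,
        hL.union_of_mem hc₂ hl.1 hlr'.2, hx₁, hx₂, ?_, ?_, hMv, hLv⟩
      · rw [Set.disjoint_left] at hQ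
        grind
      · rw [Set.disjoint_left] at hQ
        grind
  clear! L M
  obtain ⟨Q₁, Q₂, L, M, hQ, hQ₁, hQ₂, hc₁, hc₂, hx₁, hx₂, hL, hM, hLv, hMv⟩ := key
  have h1 := h.ne₁
  have h2 := h.ne₂
  have h3 := h.notMem
  rw [Set.disjoint_left] at hQ
  have hvx₁ : v ≠ x₁ := fun e => hvP (e ▸ h.mem₁)
  have hvx₂ : v ≠ x₂ := fun e => hvP (e ▸ h.mem₂)
  have hvi : v ≠ y i := fun e => hRv' hRi e.symm
  have hvj : v ≠ y j := fun e => hSv' hSj e.symm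
  have hij : y i ≠ y j := fun e => hRS hRi (e ▸ hSj)
  have hki : y k ≠ y i := fun e => hRk hRi e.symm
  have hkj : y k ≠ y j := fun e => hSk hSj e.symm
  have hnd : [x₁, x₂, y i, y j, v].Nodup := by
    have := h.ne
    simp only [List.nodup_cons, List.mem_cons, List.not_mem_nil, or_false, not_or]
    grind
  have ha : G.JoinedIn {y k} x₁ x₂ := by
    refine (connSet_singleton (y k)).joinedIn_of_touches ⟨_, rfl, (h.adj₁ k).symm⟩
      ⟨_, rfl, (h.adj₂ k).symm⟩ subset_rfl
  have hb : G.JoinedIn ((L ∪ Q₁) \ {x₁}) v x₁ :=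
    hc₁.joinedIn (hLv.mono Set.subset_union_left) (Or.inr hx₁) subset_rfl
  have hc : G.JoinedIn ((M ∪ Q₂) \ {x₂}) v x₂ :=
    hc₂.joinedIn (hMv.mono Set.subset_union_left) (Or.inr hx₂) subset_rfl
  have hTij : G.JoinedIn T (y i) (y j) := hT.joinedIn_of_touches hTi hTj subset_rfl
  have hRiv : G.JoinedIn (R \ {y i}) (y i) v := (hR.joinedIn hRv hRi subset_rfl).symm
  have hSjv : G.JoinedIn (S \ {y j}) (y j) v := (hS.joinedIn hSv hSj subset_rfl).symm
  have hx1P := h.mem₁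
  have hx2P := h.mem₂
  refine h.not_subdivision (containsSubdivision_top_five hnd (h.adj₁ i) (h.adj₁ j) (h.adj₂ i)
    (h.adj₂ j) ha hb hc hTij hRiv hSjv ?_ ?_)
  · simp only [List.pairwise_cons, List.mem_cons, List.not_mem_nil, or_false, Set.disjoint_left,
      forall_eq_or_imp, forall_eq, Set.mem_singleton_iff, Set.mem_sdiff, Set.mem_union,
      List.Pairwise.nil, and_true] at *
    and_intros <;> grind
  · simp only [List.mem_cons, List.not_mem_nil, or_false,
      forall_eq_or_imp, forall_eq, Set.mem_singleton_iff, Set.mem_sdiff, Set.mem_union] at *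
    and_intros <;> grind

end Config

end Config

end SimpleGraph

namespace SimpleGraph

/-! ### Fans ending on the path -/

section Fans

variable {V : Type*} {G : SimpleGraph V} {P : Set V} {x₁ x₂ : V} {y : Fin 3 → V}

namespace Config

/-- A fan with four ends `a`, `b`, `l`, `d` is extended to the situation of `false_of_center` by
disjoint sets leading from `a` to `y i`, from `b` to `y j` and from `d` to the path. -/
theorem false_of_fan (h : G.Config P x₁ x₂ y) {i j k : Fin 3} {U : Set V} {v : V} {X : Finset V}
    {Z : V → Set V} (hZ : G.IsFan U v X Z) {a b l d r : V} (ha : a ∈ X) (hb : b ∈ X) (hl : l ∈ X)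
    (hdX : d ∈ X) {R S T M : Set V} (hR : G.ConnSet R) (hS : G.ConnSet S) (hT : G.ConnSet T)
    (hM : G.ConnSet M) (haR : a ∈ R) (hbS : b ∈ S) (hdM : d ∈ M) (hRi : y i ∈ R) (hSj : y j ∈ S)
    (hTi : G.Touches T (y i)) (hTj : G.Touches T (y j)) (hlP : l ∈ P) (hMP : M ∩ P = {r})
    (hlr : l ≠ r) (hP : ∀ w ∈ R ∪ S ∪ T ∪ U, w ∉ P)
    (hd : [R, S, T, M, U, {y k}].Pairwise Disjoint) : False := by
  have hr : r ∈ M ∧ r ∈ P := hMP.symm.subset rfl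
  have hr' : ∀ w ∈ M, w ∈ P → w = r := fun w hw hwP => hMP.subset ⟨hw, hwP⟩
  simp only [List.pairwise_cons, List.mem_cons, List.not_mem_nil, or_false, Set.disjoint_left,
    forall_eq_or_imp, forall_eq, Set.mem_singleton_iff] at hd
  obtain ⟨⟨hRS, hRT, hRM, hRU, hRk⟩, ⟨hST, hSM, hSU, hSk⟩, ⟨hTM, hTU, hTk⟩, ⟨hMU, hMk⟩, hUk, -⟩ := hd
  have hab : a ≠ b := fun e => hRS haR (e ▸ hbS)
  have had : a ≠ d := fun e => hRM haR (e ▸ hdM)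
  have hbd : b ≠ d := fun e => hSM hbS (e ▸ hdM)
  have hal : a ≠ l := fun e => hP a (by simp [haR]) (e ▸ hlP)
  have hbl : b ≠ l := fun e => hP b (by simp [hbS]) (e ▸ hlP)
  have hdl : d ≠ l := fun e => hlr (hr' l (e ▸ hdM) hlP)
  have hlM : l ∉ M := fun hl => hlr (hr' l hl hlP)
  have h1 := Set.disjoint_left.1 (hZ.disj a ha b hb hab)
  have h2 := Set.disjoint_left.1 (hZ.disj a ha d hdX had)
  have h3 := Set.disjoint_left.1 (hZ.disj b hb d hdX hbd)
  have h4 := Set.disjoint_left.1 (hZ.disj a ha l hl hal)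
  have h5 := Set.disjoint_left.1 (hZ.disj b hb l hl hbl)
  have h6 := Set.disjoint_left.1 (hZ.disj d hdX l hl hdl)
  have hsa := fun w hw => Set.mem_insert_iff.1 (hZ.sub a ha (a := w) hw)
  have hsb := fun w hw => Set.mem_insert_iff.1 (hZ.sub b hb (a := w) hw)
  have hsl := fun w hw => Set.mem_insert_iff.1 (hZ.sub l hl (a := w) hw)
  have hsd := fun w hw => Set.mem_insert_iff.1 (hZ.sub d hdX (a := w) hw)
  have hca := hZ.center a ha
  have hcb := hZ.center b hb
  have hcl := hZ.center l hl
  have hcd := hZ.center d hdX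
  have hvU := hZ.mem
  have hyP := h.notMem
  simp only [Set.mem_union] at hP
  have hdP : d ∈ P → d = r := hr' d hdM
  refine h.false_of_center (i := i) (j := j) (k := k) (v := v) (l := l) (r := r)
    (R := Z a ∪ R) (S := Z b ∪ S) (T := T) (L := Z l) (M := Z d ∪ M) (hP v (by simp [hvU]))
    ((hZ.conn a ha).union_of_mem hR (hZ.self_mem a ha) haR)
    ((hZ.conn b hb).union_of_mem hS (hZ.self_mem b hb) hbS) hT (hZ.conn l hl)
    ((hZ.conn d hdX).union_of_mem hM (hZ.self_mem d hdX) hdM)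
    ((hZ.touches a ha).mono Set.subset_union_left) ((hZ.touches b hb).mono Set.subset_union_left)
    (hZ.touches l hl) ((hZ.touches d hdX).mono Set.subset_union_left) (Or.inr hRi) (Or.inr hSj)
    hTi hTj ?_ ?_ ?_ ?_
  · refine Set.Subset.antisymm (fun w hw => ?_) ?_
    · exact (hsl w hw.1).resolve_right fun hwU => hP w (by simp [hwU]) hw.2
    · rintro w rfl
      exact ⟨hZ.self_mem w hl, hlP⟩
  · refine Set.Subset.antisymm (fun w hw => ?_) ?_
    · rcases hw.1 with hw' | hw'
      · rcases hsd w hw' with rfl | hwU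
        · exact hdP hw.2
        · exact absurd hw.2 (hP w (by simp [hwU]))
      · exact hr' w hw' hw.2
    · rintro w rfl
      exact ⟨Or.inr hr.1, hr.2⟩
  · rintro w ((h | h) | h) <;> grind
  · simp only [List.pairwise_cons, List.mem_cons, List.not_mem_nil, or_false, Set.disjoint_left,
      forall_eq_or_imp, forall_eq, Set.mem_singleton_iff, Set.mem_union, List.Pairwise.nil,
      and_true]
    and_intros <;> grind

variable [Finite V]

/-- A set `U` whose neighbours outside of the path are among three vertices `a`, `b`, `c` sends a fan
to `a`, `b` and two vertices of the path. -/
theorem exists_fan (h : G.Config P x₁ x₂ y) {U : Set V} (hU : G.ConnSet U) (hUP : ∀ u ∈ U, u ∉ P)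
    (hUy : ∀ i, y i ∉ U) {a b c : V} (hab : a ≠ b) (ha : a ∉ U) (hb : b ∉ U) (haP : a ∉ P)
    (hbP : b ∉ P) (hcP : c ∉ P) (hUa : G.Touches U a) (hUb : G.Touches U b)
    (hN : ∀ u ∈ U, ∀ w, G.Adj u w → w ∈ U ∨ w ∈ P ∨ w = a ∨ w = b ∨ w = c) :
    ∃ v X Z l r, G.IsFan U v X Z ∧ a ∈ X ∧ b ∈ X ∧ l ∈ X ∧ r ∈ X ∧ l ∈ P ∧ r ∈ P ∧ l ≠ r := by
  classical
  have hl : ∃ l ∈ P, G.Touches U l := by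
    by_contra! hl
    obtain ⟨u, hu⟩ := hU.1
    by_cases hcU : c ∈ U
    · refine h.false_of_closed_five (U := U) (X := {a, b}) (Finset.card_le_two.trans (by omega))
        (fun u hu w huw => ?_) hu (by simp; grind) (t := x₁) (fun hx => hUP _ hx h.mem₁)
        (by have := h.mem₁; simp; grind)
      rcases hN u hu w huw with hw | hw | hw | hw | hw
      · exact Or.inl hw
      · exact absurd ⟨u, hu, huw⟩ (hl w hw)
      · simp [hw]
      · simp [hw]
      · exact Or.inl (hw ▸ hcU)
    · refine h.false_of_closed_five (U := U) (X := {a, b, c})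
        (Finset.card_le_three.trans (by omega))
        (fun u hu w huw => ?_) hu (by simp; grind) (t := x₁) (fun hx => hUP _ hx h.mem₁)
        (by have := h.mem₁; simp; grind)
      rcases hN u hu w huw with hw | hw | hw | hw | hw
      · exact Or.inl hw
      · exact absurd ⟨u, hu, huw⟩ (hl w hw)
      · simp [hw]
      · simp [hw]
      · simp [hw]
  obtain ⟨l, hlP, hUl⟩ := hl
  obtain ⟨v, X, Z, hZ, hX, haX, hbX, hlX⟩ := hU.exists_fan_five
    (fun X hX a ha b hb => ⟨_, h.conn_five X hX, ha, hb, fun c hc hc' => hc' hc⟩)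
    (fun X hX => h.exists_notMem hUP hUy X hX) hab (fun e => haP (e ▸ hlP))
    (fun e => hbP (e ▸ hlP)) ha hb (fun hl => hUP l hl hlP) hUa hUb hUl
  obtain ⟨r, hrX, hr⟩ : ∃ r ∈ X, r ∉ ({a, b, l, c} : Finset V) := by
    by_contra! hsub
    have := (Finset.card_le_card (fun r hr => hsub r hr)).trans Finset.card_le_four
    omega
  simp only [Finset.mem_insert, Finset.mem_singleton, not_or] at hr
  refine ⟨v, X, Z, l, r, hZ, haX, hbX, hlX, hrX, hlP, ?_, Ne.symm hr.2.2.1⟩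
  obtain ⟨u, hu, hur⟩ := hZ.touches_end hrX
  have := hN u hu r hur
  have := hZ.notMem r hrX
  grind

/-- A set `U` that is attached only to three vertices `a`, `b`, `c` and to the path contains the centre
of a fan to `a`, `b` and two vertices of the path. Hence `a` and `b` cannot be linked to `y i` and `y j`
by disjoint sets if `y i` and `y j` are joined elsewhere. -/
theorem false_of_attached (h : G.Config P x₁ x₂ y) {i j k : Fin 3} {U : Set V} (hU : G.ConnSet U)
    (hUy : ∀ i, y i ∉ U) {a b c : V} (hcP : c ∉ P) (hUa : G.Touches U a) (hUb : G.Touches U b)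
    (hN : ∀ u ∈ U, ∀ w, G.Adj u w → w ∈ U ∨ w ∈ P ∨ w = a ∨ w = b ∨ w = c)
    {R S T : Set V} (hR : G.ConnSet R) (hS : G.ConnSet S) (hT : G.ConnSet T) (haR : a ∈ R)
    (hbS : b ∈ S) (hRi : y i ∈ R) (hSj : y j ∈ S) (hTi : G.Touches T (y i))
    (hTj : G.Touches T (y j)) (hP : ∀ w ∈ R ∪ S ∪ T ∪ U, w ∉ P)
    (hd : [R, S, T, U, {y k}].Pairwise Disjoint) : False := by
  simp only [List.pairwise_cons, List.mem_cons, List.not_mem_nil, or_false, Set.disjoint_left,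
    forall_eq_or_imp, forall_eq, Set.mem_singleton_iff] at hd
  obtain ⟨⟨hRS, hRT, hRU, hRk⟩, ⟨hST, hSU, hSk⟩, ⟨hTU, hTk⟩, hUk, -⟩ := hd
  obtain ⟨v, X, Z, l, r, hZ, ha, hb, hl, hr, hlP, hrP, hlr⟩ := h.exists_fan hU
    (fun u hu => hP u (Or.inr hu)) hUy (fun e => hRS haR (by rwa [e])) (hRU haR) (hSU hbS)
    (hP a (by simp [haR])) (hP b (by simp [hbS])) hcP hUa hUb hN
  have hyk := h.notMem k
  simp only [Set.mem_union] at hP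
  refine h.false_of_fan (i := i) (j := j) (k := k) (r := r) (M := {r}) hZ ha hb hl hr hR hS hT
    (connSet_singleton r) haR hbS rfl hRi hSj hTi hTj hlP (by simpa) hlr (by simpa using hP) ?_
  simp only [List.pairwise_cons, List.mem_cons, List.not_mem_nil, or_false, Set.disjoint_left,
    forall_eq_or_imp, forall_eq, Set.mem_singleton_iff, List.Pairwise.nil,
    and_true]
  and_intros <;> grind

end Config

end Fans

end SimpleGraph

namespace SimpleGraph

/-! ### A partition of the remaining vertices into two connected sides -/

section Split

variable {V : Type*} {G : SimpleGraph V}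

/-- Two vertices of a minimal connected set touching `a` and `b`, or of `{a, b}`, can be joined to
`a` and `b` by disjoint connected sets. -/
theorem exists_split_of_minimal {W : Set V} (hW : G.ConnSet W) {a b : V} (hab : a ≠ b)
    (ha : a ∉ W) (hb : b ∉ W) (hWa : G.Touches W a) (hWb : G.Touches W b)
    (hmin : ∀ W' ⊆ W, (G.ConnSet W' ∧ G.Touches W' a ∧ G.Touches W' b) → W' = W)
    {c d : V} (hc : c ∈ W ∪ {a, b}) (hd : d ∈ W ∪ {a, b}) (hcd : c ≠ d) :
    ∃ Za Zb : Set V, Disjoint Za Zb ∧ Za ∪ Zb ⊆ W ∪ {a, b} ∧ G.ConnSet Za ∧ G.ConnSet Zb ∧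
      a ∈ Za ∧ b ∈ Zb ∧ (c ∈ Za ∧ d ∈ Zb ∨ d ∈ Za ∧ c ∈ Zb) := by
  have one : ∀ e, e ∈ W ∪ {b} → ∃ Za Zb : Set V, Disjoint Za Zb ∧ Za ∪ Zb ⊆ W ∪ {a, b} ∧
      G.ConnSet Za ∧ G.ConnSet Zb ∧ a ∈ Za ∧ b ∈ Zb ∧ e ∈ Zb := by
    intro e he
    refine ⟨{a}, insert b W, ?_, ?_, connSet_singleton a, hW.insert hWb, rfl, Or.inl rfl, ?_⟩
    · rw [Set.disjoint_left]
      rintro _ rfl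
      grind
    · grind
    · grind
  have two : ∀ e, e ∈ W ∪ {a} → ∃ Za Zb : Set V, Disjoint Za Zb ∧ Za ∪ Zb ⊆ W ∪ {a, b} ∧
      G.ConnSet Za ∧ G.ConnSet Zb ∧ a ∈ Za ∧ b ∈ Zb ∧ e ∈ Za := by
    intro e he
    refine ⟨insert a W, {b}, ?_, ?_, hW.insert hWa, connSet_singleton b, Or.inl rfl, rfl, ?_⟩
    · rw [Set.disjoint_right]
      rintro _ rfl
      grind
    · grind
    · grind
  by_cases hca : c = a
  · obtain ⟨Za, Zb, h1, h2, h3, h4, h5, h6, h7⟩ := one d (by grind)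
    exact ⟨Za, Zb, h1, h2, h3, h4, h5, h6, Or.inl ⟨hca ▸ h5, h7⟩⟩
  by_cases hda : d = a
  · obtain ⟨Za, Zb, h1, h2, h3, h4, h5, h6, h7⟩ := one c (by grind)
    exact ⟨Za, Zb, h1, h2, h3, h4, h5, h6, Or.inr ⟨hda ▸ h5, h7⟩⟩
  by_cases hcb : c = b
  · obtain ⟨Za, Zb, h1, h2, h3, h4, h5, h6, h7⟩ := two d (by grind)
    exact ⟨Za, Zb, h1, h2, h3, h4, h5, h6, Or.inr ⟨h7, hcb ▸ h6⟩⟩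
  by_cases hdb : d = b
  · obtain ⟨Za, Zb, h1, h2, h3, h4, h5, h6, h7⟩ := two c (by grind)
    exact ⟨Za, Zb, h1, h2, h3, h4, h5, h6, Or.inl ⟨h7, hdb ▸ h6⟩⟩
  have hcW : c ∈ W := by grind
  have hdW : d ∈ W \ {c} := ⟨by grind, hcd.symm⟩
  -- The component of `d` in `W - c` touches `a` or `b`, and by minimality not both.
  set K := G.compIn (W \ {c}) d
  have hK : G.ConnSet K := connSet_compIn hdW
  have hdK : d ∈ K := mem_compIn_self hdW
  have hKW : K ⊆ W \ {c} := compIn_subset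
  have hcK : c ∉ K := fun h => (hKW h).2 rfl
  have hWK : G.ConnSet (W \ K) := hW.diff_of_attached hcW hcK fun e he f hf hfK hef => by
    by_contra hfc
    exact hfK (compIn_closed he ⟨hf, hfc⟩ hef)
  have hnot : ¬ (G.Touches K a ∧ G.Touches K b) := fun h => by
    have := hmin K (fun z hz => (hKW hz).1) ⟨hK, h⟩
    exact hcK (this.symm ▸ hcW)
  have hnot' : ¬ (G.Touches (W \ K) a ∧ G.Touches (W \ K) b) := fun h => by
    have := hmin (W \ K) (fun z hz => hz.1) ⟨hWK, h⟩
    exact (this.symm ▸ hdW.1 : d ∈ W \ K).2 hdK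
  have hor : ∀ {e}, G.Touches W e → G.Touches K e ∨ G.Touches (W \ K) e := by
    rintro e ⟨s, hs, hse⟩
    by_cases hsK : s ∈ K
    · exact Or.inl ⟨s, hsK, hse⟩
    · exact Or.inr ⟨s, ⟨hs, hsK⟩, hse⟩
  have hd1 : Disjoint (insert a K) (insert b (W \ K)) := by
    rw [Set.disjoint_left]
    grind
  have hd2 : Disjoint (insert a (W \ K)) (insert b K) := by
    rw [Set.disjoint_left]
    grind
  by_cases hKa : G.Touches K a
  · have hb' : G.Touches (W \ K) b := (hor hWb).resolve_left fun h => hnot ⟨hKa, h⟩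
    exact ⟨_, _, hd1, by grind, hK.insert hKa, hWK.insert hb', Or.inl rfl, Or.inl rfl,
      Or.inr ⟨Or.inr hdK, Or.inr ⟨hcW, hcK⟩⟩⟩
  · have ha' : G.Touches (W \ K) a := (hor hWa).resolve_left hKa
    have hb' : G.Touches K b := (hor hWb).resolve_right fun h => hnot' ⟨ha', h⟩
    exact ⟨_, _, hd2, by grind, hWK.insert ha', hK.insert hb', Or.inl rfl, Or.inl rfl,
      Or.inl ⟨Or.inr ⟨hcW, hcK⟩, Or.inr hdK⟩⟩

end Split

section Partition

variable {V : Type*} {G : SimpleGraph V} {P : Set V} {x₁ x₂ : V} {y : Fin 3 → V}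

/-- A connected set of vertices outside of `P` and different from the `y i` that touches all `y i`. -/
structure IsSide (G : SimpleGraph V) (P : Set V) (y : Fin 3 → V) (A : Set V) : Prop where
  conn : G.ConnSet A
  notMem_path : ∀ a ∈ A, a ∉ P
  ne : ∀ a ∈ A, ∀ i, a ≠ y i
  touches : ∀ i, G.Touches A (y i)

theorem IsSide.notMem {A : Set V} (hA : G.IsSide P y A) (i : Fin 3) : y i ∉ A :=
  fun h => hA.ne _ h i rfl

/-- Adding to a side a connected set attached to it. -/
theorem IsSide.union {A E : Set V} (hA : G.IsSide P y A) (hE : G.ConnSet E)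
    (hEP : ∀ e ∈ E, e ∉ P) (hEy : ∀ e ∈ E, ∀ i, e ≠ y i) {a e : V} (ha : a ∈ A) (he : e ∈ E)
    (hae : G.Adj a e) : G.IsSide P y (A ∪ E) :=
  ⟨hA.conn.union_of_adj hE ha he hae, fun v hv => hv.elim (hA.notMem_path v) (hEP v),
    fun v hv => hv.elim (hA.ne v) (hEy v), fun i => (hA.touches i).mono Set.subset_union_left⟩

/-- The vertices outside of the path and different from the `y i` are partitioned into two sides. -/
structure IsPartition (G : SimpleGraph V) (P : Set V) (y : Fin 3 → V) (A B : Set V) : Prop where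
  left : G.IsSide P y A
  right : G.IsSide P y B
  disj : Disjoint A B
  cover : ∀ v, v ∉ P → (∀ i, v ≠ y i) → v ∈ A ∨ v ∈ B

theorem IsPartition.symm {A B : Set V} (h : G.IsPartition P y A B) : G.IsPartition P y B A :=
  ⟨h.right, h.left, h.disj.symm, fun v hv hvy => (h.cover v hv hvy).symm⟩

namespace Config

/-- A vertex `c` leaves a connection between two vertices `v` and `e` of `G - P`. -/
theorem exists_conn_touching (h : G.Config P x₁ x₂ y) {v e c : V} (hv : v ∉ P) (he : e ∉ P)
    (hev : e ≠ v) (hec : e ≠ c) :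
    ∃ K, G.ConnSet K ∧ K ⊆ {w | w ∉ P ∧ w ≠ v} ∧ c ∉ K ∧ e ∈ K ∧ G.Touches K v := by
  by_cases hcv : c = v
  · have he' : e ∈ {w | w ∉ P ∧ w ≠ x₁} \ {v} := ⟨⟨he, fun h' => he (h' ▸ h.mem₁)⟩, hev⟩
    refine ⟨G.compIn ({w | w ∉ P ∧ w ≠ x₁} \ {v}) e, connSet_compIn he', fun w hw => ?_,
      fun hc => (compIn_subset hc).2 hcv, mem_compIn_self he', (h.conn_two x₁).touches_compIn ?_
        he'.1 hev⟩
    · exact ⟨(compIn_subset hw).1.1, (compIn_subset hw).2⟩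
    · exact ⟨hv, fun h' => hv (h' ▸ h.mem₁)⟩
  · have he' : e ∈ {w | w ∉ P ∧ w ≠ c} \ {v} := ⟨⟨he, hec⟩, hev⟩
    refine ⟨G.compIn ({w | w ∉ P ∧ w ≠ c} \ {v}) e, connSet_compIn he', fun w hw => ?_,
      fun hc => (compIn_subset hc).1.2 rfl, mem_compIn_self he', (h.conn_two c).touches_compIn ?_
        he'.1 hev⟩
    · exact ⟨(compIn_subset hw).1.1, (compIn_subset hw).2⟩
    · exact ⟨hv, Ne.symm hcv⟩

/-- An inner vertex `p` of the path is not adjacent to any `y i`: it would have a further neighbour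
outside of the path, and `x₁`, `x₂`, `y i`, `y j` and `p` would be the branch vertices of a
subdivision. -/
theorem not_adj_inner (h : G.Config P x₁ x₂ y) {A B : Set V} (hAB : G.IsPartition P y A B)
    {p : V} (hp : p ∈ P) (hp₁ : p ≠ x₁) (hp₂ : p ≠ x₂) (i : Fin 3) : ¬ G.Adj p (y i) := by
  classical
  intro hpi
  have hwin : ∀ j k, i ≠ j → i ≠ k → j ≠ k → ∀ {T₁ T₂ : Set V}, G.JoinedIn T₁ (y j) p →
      G.JoinedIn T₂ (y i) (y j) → Disjoint T₁ T₂ → (∀ w ∈ T₁ ∪ T₂, w ∉ P ∧ ∀ i, w ≠ y i) →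
      False := by
    intro j k hij hik hjk T₁ T₂ hT₁ hT₂ hT hTP
    have hyij := h.inj.ne hij
    have hyik := h.inj.ne hik
    have hyjk := h.inj.ne hjk
    obtain ⟨Q₁, Q₂, hQ, hQ₁, hQ₂, c₁, c₂, hx₁, hx₂, ht₁, ht₂⟩ := h.split_at p hp hp₁ hp₂
    have h1 := h.ne₁
    have h2 := h.ne₂
    have h3 := h.notMem
    have h4 := h.mem₁
    have h5 := h.mem₂
    have h6 := h.ne
    have hS : G.JoinedIn {y k} x₁ x₂ := (connSet_singleton (y k)).joinedIn_of_touches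
      ⟨_, rfl, (h.adj₁ k).symm⟩ ⟨_, rfl, (h.adj₂ k).symm⟩ subset_rfl
    have hpy : ∀ m, p ≠ y m := fun m e => h3 m (e ▸ hp)
    refine h.not_subdivision (containsSubdivision_top_five (x₁ := x₁) (x₂ := x₂) (a := y i)
      (b := y j) (c := p) ?_ (h.adj₁ i) (h.adj₁ j) (h.adj₂ i) (h.adj₂ j) hS
      (c₁.joinedIn ht₁ hx₁ subset_rfl) (c₂.joinedIn ht₂ hx₂ subset_rfl) hT₂
      (joinedIn_of_adj (W := ∅) hpi.symm) hT₁ ?_ ?_)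
    · simp only [List.nodup_cons, List.mem_cons, List.not_mem_nil, or_false, not_or]
      grind
    · rw [Set.disjoint_left] at hQ hT
      simp only [List.pairwise_cons, List.mem_cons, List.not_mem_nil, or_false, Set.disjoint_left,
        forall_eq_or_imp, forall_eq, Set.mem_singleton_iff, List.Pairwise.nil, and_true,
        Set.mem_sdiff]
      and_intros <;> grind
    · simp only [List.mem_cons, List.not_mem_nil, or_false, forall_eq_or_imp, forall_eq,
        Set.mem_singleton_iff, Set.mem_sdiff]
      and_intros <;> grind
  obtain ⟨j, k, hij, hik, hjk⟩ : ∃ j k, i ≠ j ∧ i ≠ k ∧ j ≠ k := by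
    clear * -
    revert i
    decide
  obtain ⟨w, hpw, hwP, hwi⟩ : ∃ w, G.Adj p w ∧ w ∉ P ∧ w ≠ y i := by
    by_contra! hno
    obtain ⟨a, b, hab⟩ := h.degree_path p hp
    have h1 : (insert p ({a, b, y i} : Finset V)).card ≤ 4 := Finset.card_le_four
    by_cases hpX : p ∈ ({a, b, y i} : Finset V)
    · obtain ⟨t, ht, htX⟩ := h.exists_notMem (U := {y i}ᶜ ∩ {y i}) (by simp) (by simp)
        (insert p {a, b, y i}) h1
      refine h.false_of_closed_five (U := {p}) (X := {a, b, y i} \ {p}) ?_ ?_ rfl (by simp) (t := t)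
        ?_ ?_
      · exact (Finset.card_le_card Finset.sdiff_subset).trans (Finset.card_le_three.trans (by omega))
      · rintro u rfl w huw
        by_cases hwP : w ∈ P
        · have := hab w hwP huw
          have := huw.ne
          simp
          grind
        · have := hno w huw hwP
          have := huw.ne
          simp
          grind
      · simp at htX ⊢
        grind
      · simp at htX ⊢
        grind
    · obtain ⟨t, ht, htX⟩ := h.exists_notMem (U := ∅) (by simp) (by simp)
        (insert p {a, b, y i}) h1
      refine h.false_of_closed_five (U := {p}) (X := {a, b, y i}) ?_ ?_ rfl hpX (t := t)
        ?_ ?_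
      · exact (Finset.card_le_three.trans (by omega))
      · rintro u rfl w huw
        by_cases hwP : w ∈ P
        · have := hab w hwP huw
          simp
          grind
        · have := hno w huw hwP
          simp
          grind
      · simp at htX ⊢
        grind
      · simp at htX ⊢
        grind
  have hside : ∀ {A B : Set V}, G.IsSide P y A → G.IsSide P y B → Disjoint A B → w ∈ A → False := by
    intro A B hA hB hd hw
    refine hwin j k hij hik hjk (hA.conn.joinedIn_of_touches (hA.touches j) ⟨w, hw, hpw.symm⟩
      subset_rfl) (hB.conn.joinedIn_of_touches (hB.touches i) (hB.touches j) subset_rfl) hd ?_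
    rintro v (hv | hv)
    · exact ⟨hA.notMem_path v hv, hA.ne v hv⟩
    · exact ⟨hB.notMem_path v hv, hB.ne v hv⟩
  by_cases hwy : ∀ m, w ≠ y m
  · rcases hAB.cover w hwP hwy with hw | hw
    · exact hside hAB.left hAB.right hAB.disj hw
    · exact hside hAB.right hAB.left hAB.disj.symm hw
  · push Not at hwy
    obtain ⟨m, rfl⟩ := hwy
    obtain ⟨n, hin, hmn⟩ : ∃ n, i ≠ n ∧ m ≠ n := by
      clear * -
      revert i m
      decide
    refine hwin m n (fun e => hwi (e ▸ rfl)) hin hmn (joinedIn_of_adj (W := ∅) hpw.symm)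
      (hAB.right.conn.joinedIn_of_touches (hAB.right.touches i) (hAB.right.touches m) subset_rfl)
      (Set.empty_disjoint _) ?_
    rintro v (hv | hv)
    · exact absurd hv (Set.notMem_empty v)
    · exact ⟨hAB.right.notMem_path v hv, hAB.right.ne v hv⟩

/-- A path between `y 0` and `y 1` through `y 2` closes up to a cycle through a disjoint connection
`R` between `y 0` and `y 1`. -/
theorem false_of_connection (h : G.Config P x₁ x₂ y) {R Z₀ Z₁ : Set V} (hR : G.ConnSet R)
    (hRP : R ⊆ {w | w ∉ P ∧ w ≠ y 0 ∧ w ≠ y 1}) (hR0 : G.Touches R (y 0))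
    (hR1 : G.Touches R (y 1)) (hR2 : y 2 ∉ R) (hZ : Disjoint Z₀ Z₁) (hRZ₀ : Disjoint R Z₀)
    (hRZ₁ : Disjoint R Z₁) (hZ₀ : G.ConnSet Z₀) (hZ₁ : G.ConnSet Z₁) (h0 : y 0 ∈ Z₀) (h1 : y 1 ∈ Z₁)
    (hZ₀2 : G.Touches Z₀ (y 2)) (hZ₁2 : G.Touches Z₁ (y 2))
    (hZP : ∀ z ∈ Z₀ ∪ Z₁, z ∉ P ∧ z ≠ y 2) : False := by
  have hij : (0 : Fin 3) ≠ 1 := by decide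
  have hik : (0 : Fin 3) ≠ 2 := by decide
  have hjk : (1 : Fin 3) ≠ 2 := by decide
  refine h.false_of_cycle hij hik hjk (R := R) (S := Z₀ \ {y 0}) (T := Z₁ \ {y 1})
    (hR.joinedIn_of_touches hR0 hR1 subset_rfl) (hZ₀.joinedIn hZ₀2 h0 subset_rfl).symm
    (hZ₁.joinedIn hZ₁2 h1 subset_rfl).symm (hRZ₀.mono_right Set.sdiff_subset)
    (hRZ₁.mono_right Set.sdiff_subset) (hZ.mono Set.sdiff_subset Set.sdiff_subset) ?_
  rw [Set.disjoint_left] at hZ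
  rintro w ((hw | hw) | hw)
  · exact ⟨(hRP hw).1, (hRP hw).2.1, (hRP hw).2.2, fun e => hR2 (e ▸ hw)⟩
  · exact ⟨(hZP w (Or.inl hw.1)).1, hw.2, fun e => hZ hw.1 (e ▸ h1), (hZP w (Or.inl hw.1)).2⟩
  · exact ⟨(hZP w (Or.inr hw.1)).1, fun e => hZ (e ▸ h0) hw.1, hw.2, (hZP w (Or.inr hw.1)).2⟩

/-- Of two disjoint connections between `y 0` and `y 1`, a minimal one does not contain `y 2`, since it
would be a path through `y 2` that the other one closes to a cycle. -/
theorem notMem_of_minimal (h : G.Config P x₁ x₂ y) {W W' : Set V} (hW : G.ConnSet W)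
    (hW' : G.ConnSet W') (hWP : W ⊆ {w | w ∉ P ∧ w ≠ y 0 ∧ w ≠ y 1})
    (hWP' : W' ⊆ {w | w ∉ P ∧ w ≠ y 0 ∧ w ≠ y 1}) (hW0 : G.Touches W (y 0))
    (hW1 : G.Touches W (y 1)) (hW0' : G.Touches W' (y 0)) (hW1' : G.Touches W' (y 1))
    (hd : ∀ ⦃z⦄, z ∈ W → z ∉ W')
    (hmin : ∀ W'' ⊆ W, (G.ConnSet W'' ∧ G.Touches W'' (y 0) ∧ G.Touches W'' (y 1)) → W'' = W) :
    y 2 ∉ W := by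
  have hyij := h.inj.ne (show (0 : Fin 3) ≠ 1 by decide)
  have hyik := h.inj.ne (show (0 : Fin 3) ≠ 2 by decide)
  have hyjk := h.inj.ne (show (1 : Fin 3) ≠ 2 by decide)
  intro h2
  obtain ⟨Z₀, Z₁, hZ, ⟨a1, a2, a3, a4⟩, ⟨b1, b2, b3, b4⟩⟩ := exists_branches_of_minimal hW hyij
    (fun h => (hWP h).2.1 rfl) (fun h => (hWP h).2.2 rfl) hW0 hW1 hmin h2
  refine h.false_of_connection hW' hWP' hW0' hW1' (hd h2) hZ ?_ ?_ a1 b1 a2 b2 a4 b4 ?_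
  · rw [Set.disjoint_left]
    intro z hz hz'
    rcases a3 hz' with rfl | hz'
    · exact (hWP' hz).2.1 rfl
    · exact hd hz'.1 hz
  · rw [Set.disjoint_left]
    intro z hz hz'
    rcases b3 hz' with rfl | hz'
    · exact (hWP' hz).2.2 rfl
    · exact hd hz'.1 hz
  · rintro z (hz | hz)
    · rcases a3 hz with rfl | hz
      · exact ⟨h.notMem 0, hyik⟩
      · exact ⟨(hWP hz.1).1, hz.2⟩
    · rcases b3 hz with rfl | hz
      · exact ⟨h.notMem 1, hyjk⟩
      · exact ⟨(hWP hz.1).1, hz.2⟩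

/-- If both ends `a`, `b` of a fan from `y 2` are on the same minimal connection `W` between `y 0` and
`y 1`, there is a cycle through all `y i`. -/
theorem false_of_fan_two (h : G.Config P x₁ x₂ y) {W W' Za Zb Z₀ Z₁ : Set V} {a b : V}
    (hW' : G.ConnSet W') (hWP : W ⊆ {w | w ∉ P ∧ w ≠ y 0 ∧ w ≠ y 1})
    (hWP' : W' ⊆ {w | w ∉ P ∧ w ≠ y 0 ∧ w ≠ y 1}) (hW0' : G.Touches W' (y 0))
    (hW1' : G.Touches W' (y 1)) (hWW : ∀ ⦃z⦄, z ∈ W → z ∉ W') (h2W : y 2 ∉ W) (h2W' : y 2 ∉ W')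
    (hd : Disjoint Za Zb) (hZa : G.ConnSet Za) (hZb : G.ConnSet Zb)
    (hZaP : Za ⊆ {w | w ∉ P ∧ w ≠ y 2}) (hZbP : Zb ⊆ {w | w ∉ P ∧ w ≠ y 2})
    (hZa2 : G.Touches Za (y 2)) (hZb2 : G.Touches Zb (y 2)) (haZ : a ∈ Za) (hbZ : b ∈ Zb)
    (ha' : ∀ z ∈ Za, z ∈ W ∪ W' ∪ {y 0, y 1} → z = a)
    (hb' : ∀ z ∈ Zb, z ∈ W ∪ W' ∪ {y 0, y 1} → z = b) (hZ : Disjoint Z₀ Z₁)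
    (hZW : Z₀ ∪ Z₁ ⊆ W ∪ {y 0, y 1}) (hZ₀ : G.ConnSet Z₀) (hZ₁ : G.ConnSet Z₁) (h0 : y 0 ∈ Z₀)
    (h1 : y 1 ∈ Z₁) (ha0 : a ∈ Z₀) (hb1 : b ∈ Z₁) : False := by
  have hyik := h.inj.ne (show (0 : Fin 3) ≠ 2 by decide)
  have hyjk := h.inj.ne (show (1 : Fin 3) ≠ 2 by decide)
  have hZ0W : ∀ z ∈ Z₀, z ∈ W ∪ {y 0, y 1} := fun z hz => hZW (Or.inl hz)
  have hZ1W : ∀ z ∈ Z₁, z ∈ W ∪ {y 0, y 1} := fun z hz => hZW (Or.inr hz)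
  have haW := hZ0W a ha0
  have hbW := hZ1W b hb1
  -- The sets `Za` and `Z₁` can only meet in `a`.
  have key : ∀ {c : V} {Z Z' : Set V}, (∀ z ∈ Z, z ∈ W ∪ W' ∪ {y 0, y 1} → z = c) →
      (∀ z ∈ Z', z ∈ W ∪ {y 0, y 1}) → c ∉ Z' → Disjoint Z Z' := by
    intro c Z Z' h1 h2 h3
    rw [Set.disjoint_left]
    intro z hz hz'
    have h4 := h2 z hz'
    exact h3 (h1 z hz (h4.elim (fun h => Or.inl (Or.inl h)) Or.inr) ▸ hz')
  have key' : ∀ {c : V} {Z : Set V}, (∀ z ∈ Z, z ∈ W ∪ W' ∪ {y 0, y 1} → z = c) →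
      c ∈ W ∪ {y 0, y 1} → Disjoint W' Z := by
    intro c Z h1 h2
    rw [Set.disjoint_left]
    intro z hz hz'
    have := h1 z hz' (Or.inl (Or.inr hz))
    subst this
    rcases h2 with h2 | rfl | rfl
    · exact hWW h2 hz
    · exact (hWP' hz).2.1 rfl
    · exact (hWP' hz).2.2 rfl
  have hW'Z : ∀ {Z : Set V}, (∀ z ∈ Z, z ∈ W ∪ {y 0, y 1}) → Disjoint W' Z := by
    intro Z h1
    rw [Set.disjoint_left]
    intro z hz hz'
    rcases h1 z hz' with h2 | rfl | rfl
    · exact hWW h2 hz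
    · exact (hWP' hz).2.1 rfl
    · exact (hWP' hz).2.2 rfl
  have hZP : ∀ {Z : Set V}, (∀ z ∈ Z, z ∈ W ∪ {y 0, y 1}) → ∀ z ∈ Z, z ∉ P ∧ z ≠ y 2 := by
    intro Z h1 z hz
    rcases h1 z hz with h2 | rfl | rfl
    · exact ⟨(hWP h2).1, fun e => h2W (e ▸ h2)⟩
    · exact ⟨h.notMem 0, hyik⟩
    · exact ⟨h.notMem 1, hyjk⟩
  refine h.false_of_connection hW' hWP' hW0' hW1' h2W' (Z₀ := Z₀ ∪ Za) (Z₁ := Z₁ ∪ Zb) ?_ ?_ ?_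
    (hZ₀.union_of_mem hZa ha0 haZ) (hZ₁.union_of_mem hZb hb1 hbZ) (Or.inl h0) (Or.inl h1)
    (hZa2.mono Set.subset_union_right) (hZb2.mono Set.subset_union_right) ?_
  · rw [Set.disjoint_union_left, Set.disjoint_union_right, Set.disjoint_union_right]
    exact ⟨⟨hZ, (key hb' hZ0W fun hb => Set.disjoint_left.1 hZ hb hb1).symm⟩,
      key ha' hZ1W fun ha => Set.disjoint_left.1 hZ ha0 ha, hd⟩
  · exact Set.disjoint_union_right.2 ⟨hW'Z hZ0W, key' ha' haW⟩
  · exact Set.disjoint_union_right.2 ⟨hW'Z hZ1W, key' hb' hbW⟩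
  · rintro z ((hz | hz) | (hz | hz))
    · exact hZP hZ0W z hz
    · exact hZaP hz
    · exact hZP hZ1W z hz
    · exact hZbP hz

variable [Finite V]

/-- In the `2`-connected graph `G - P` every vertex sends a fan of two paths to any two others. -/
theorem exists_fan_two (h : G.Config P x₁ x₂ y) {v e f : V} {T : Set V} (hv : v ∉ P) (he : e ∈ T)
    (hf : f ∈ T) (heP : e ∉ P) (hfP : f ∉ P) (hev : e ≠ v) (hfv : f ≠ v) (hef : e ≠ f) :
    ∃ a b, a ≠ b ∧ ∃ Za Zb, Disjoint Za Zb ∧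
      (G.ConnSet Za ∧ Za ⊆ {w | w ∉ P ∧ w ≠ v} ∧ G.Touches Za v ∧ Za ∩ T = {a}) ∧
      (G.ConnSet Zb ∧ Zb ⊆ {w | w ∉ P ∧ w ≠ v} ∧ G.Touches Zb v ∧ Zb ∩ T = {b}) := by
  have key : ∀ c, ∃ K, G.ConnSet K ∧ K ⊆ {w | w ∉ P ∧ w ≠ v} ∧ c ∉ K ∧
      (K ∩ {w | G.Adj w v}).Nonempty ∧ (K ∩ T).Nonempty := by
    intro c
    by_cases hec : e = c
    · obtain ⟨K, h1, h2, h3, h4, s, hs, hsv⟩ :=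
        h.exists_conn_touching hv hfP hfv (fun h => hef (hec.trans h.symm))
      exact ⟨K, h1, h2, h3, ⟨s, hs, hsv⟩, f, h4, hf⟩
    · obtain ⟨K, h1, h2, h3, h4, s, hs, hsv⟩ := h.exists_conn_touching hv heP hev hec
      exact ⟨K, h1, h2, h3, ⟨s, hs, hsv⟩, e, h4, he⟩
  obtain ⟨a, b, hab, Za, Zb, hd, ⟨a1, a2, a3, a4⟩, ⟨b1, b2, b3, b4⟩⟩ := exists_two_linkage
    (by obtain ⟨K, h1, h2, -, h3⟩ := key v; exact ⟨K, h1, h2, h3⟩) key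
  exact ⟨a, b, hab, Za, Zb, hd, ⟨a1, a2, a3, a4⟩, ⟨b1, b2, b3, b4⟩⟩

/-- The vertices `y i` are pairwise nonadjacent: an edge between two of them and a fan from the third
one to these two would be a cycle through all three. -/
theorem not_adj (h : G.Config P x₁ x₂ y) {i j : Fin 3} (hij : i ≠ j) : ¬ G.Adj (y i) (y j) := by
  intro hadj
  obtain ⟨k, hik, hjk⟩ : ∃ k, i ≠ k ∧ j ≠ k := by clear * -; revert i j; decide
  have hyij := h.inj.ne hij
  have hyik := h.inj.ne hik
  have hyjk := h.inj.ne hjk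
  have key : ∃ Zi Zj : Set V, Disjoint Zi Zj ∧
      (G.ConnSet Zi ∧ Zi ⊆ {w | w ∉ P ∧ w ≠ y k} ∧ G.Touches Zi (y k) ∧ Zi ∩ {y i, y j} = {y i}) ∧
      (G.ConnSet Zj ∧ Zj ⊆ {w | w ∉ P ∧ w ≠ y k} ∧ G.Touches Zj (y k) ∧
        Zj ∩ {y i, y j} = {y j}) := by
    obtain ⟨a, b, hab, Za, Zb, hd, hZa, hZb⟩ := h.exists_fan_two (v := y k) (T := {y i, y j})
      (h.notMem k) (Or.inl rfl) (Or.inr rfl) (h.notMem i) (h.notMem j) hyik hyjk hyij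
    have ha : a ∈ ({y i, y j} : Set V) := (hZa.2.2.2.symm.subset rfl).2
    have hb : b ∈ ({y i, y j} : Set V) := (hZb.2.2.2.symm.subset rfl).2
    rcases ha with rfl | rfl <;> rcases hb with rfl | rfl
    · exact absurd rfl hab
    · exact ⟨Za, Zb, hd, hZa, hZb⟩
    · exact ⟨Zb, Za, hd.symm, hZb, hZa⟩
    · exact absurd rfl hab
  obtain ⟨Zi, Zj, hd, ⟨i1, i2, i3, i4⟩, ⟨j1, j2, j3, j4⟩⟩ := key
  have hi : y i ∈ Zi := (i4.symm.subset rfl).1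
  have hj : y j ∈ Zj := (j4.symm.subset rfl).1
  refine h.false_of_cycle hij hik hjk (R := ∅) (S := Zi \ {y i}) (T := Zj \ {y j})
    (joinedIn_of_adj hadj) (i1.joinedIn i3 hi subset_rfl).symm (j1.joinedIn j3 hj subset_rfl).symm
    (Set.empty_disjoint _) (Set.empty_disjoint _)
    (hd.mono Set.sdiff_subset Set.sdiff_subset) ?_
  rintro w ((hw | hw) | hw)
  · exact absurd hw (Set.notMem_empty w)
  · refine ⟨(i2 hw.1).1, hw.2, fun e => ?_, (i2 hw.1).2⟩
    exact Set.disjoint_left.1 hd hw.1 (e ▸ hj)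
  · refine ⟨(j2 hw.1).1, fun e => ?_, hw.2, (j2 hw.1).2⟩
    exact Set.disjoint_left.1 hd (e ▸ hi) hw.1

/-- There are two disjoint connections between `y i` and `y j` in `G - P`. -/
theorem exists_two_connections (h : G.Config P x₁ x₂ y) {i j : Fin 3} (hij : i ≠ j) :
    ∃ W W' : Set V, Disjoint W W' ∧
      (G.ConnSet W ∧ W ⊆ {w | w ∉ P ∧ w ≠ y i ∧ w ≠ y j} ∧ G.Touches W (y i) ∧
        G.Touches W (y j)) ∧
      (G.ConnSet W' ∧ W' ⊆ {w | w ∉ P ∧ w ≠ y i ∧ w ≠ y j} ∧ G.Touches W' (y i) ∧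
        G.Touches W' (y j)) := by
  have hyij := h.inj.ne hij
  have hx : ∀ k, y k ≠ x₁ := fun k => (h.ne₁ k).symm
  have key : ∀ c, ∃ K, G.ConnSet K ∧ K ⊆ {w | w ∉ P ∧ w ≠ y i ∧ w ≠ y j} ∧ c ∉ K ∧
      (K ∩ {w | G.Adj w (y i)}).Nonempty ∧ (K ∩ {w | G.Adj w (y j)}).Nonempty := by
    intro c
    obtain ⟨c', hc'i, hc'j, hc'⟩ : ∃ c', y i ≠ c' ∧ y j ≠ c' ∧ (c = c' ∨ c = y i ∨ c = y j) := by
      by_cases hci : c = y i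
      · exact ⟨x₁, hx i, hx j, Or.inr (Or.inl hci)⟩
      by_cases hcj : c = y j
      · exact ⟨x₁, hx i, hx j, Or.inr (Or.inr hcj)⟩
      exact ⟨c, Ne.symm hci, Ne.symm hcj, Or.inl rfl⟩
    obtain ⟨K, h1, h2, h3, h4, s, hs, hsj⟩ :=
      h.exists_conn_touching (h.notMem j) (h.notMem i) hyij hc'i
    have hsi : s ≠ y i := fun e => h.not_adj hij (e ▸ hsj)
    have hs' : s ∈ K \ {y i} := ⟨hs, hsi⟩
    obtain ⟨t, ht, hti⟩ := h1.touches_compIn h4 hs hsi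
    refine ⟨G.compIn (K \ {y i}) s, connSet_compIn hs', fun w hw => ?_, fun hc => ?_, ⟨t, ht, hti⟩,
      s, mem_compIn_self hs', hsj⟩
    · obtain ⟨hw1, hw2⟩ := compIn_subset hw
      exact ⟨(h2 hw1).1, hw2, (h2 hw1).2⟩
    · obtain ⟨hw1, hw2⟩ := compIn_subset hc
      rcases hc' with rfl | hc' | hc'
      · exact h3 hw1
      · exact hw2 hc'
      · exact (h2 hw1).2 hc'
  obtain ⟨a, b, -, Za, Zb, hd, ⟨a1, a2, ⟨s, hs, hsi⟩, a4⟩, ⟨b1, b2, ⟨t, ht, hti⟩, b4⟩⟩ :=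
    exists_two_linkage (by obtain ⟨K, h1, h2, -, h3⟩ := key x₁; exact ⟨K, h1, h2, h3⟩) key
  have ha := a4.symm.subset rfl
  have hb := b4.symm.subset rfl
  exact ⟨Za, Zb, hd, ⟨a1, a2, ⟨s, hs, hsi⟩, a, ha.1, ha.2⟩, ⟨b1, b2, ⟨t, ht, hti⟩, b, hb.1, hb.2⟩⟩

/-- There are two disjoint sides. -/
theorem exists_sides (h : G.Config P x₁ x₂ y) :
    ∃ A B, Disjoint A B ∧ G.IsSide P y A ∧ G.IsSide P y B := by
  have hij : (0 : Fin 3) ≠ 1 := by decide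
  have hik : (0 : Fin 3) ≠ 2 := by decide
  have hjk : (1 : Fin 3) ≠ 2 := by decide
  have hyij := h.inj.ne hij
  have hyik := h.inj.ne hik
  have hyjk := h.inj.ne hjk
  obtain ⟨W₁, W₁', hWW, ⟨w1, w2, w3, w4⟩, ⟨v1, v2, v3, v4⟩⟩ := h.exists_two_connections hij
  obtain ⟨W, hW, hWc, hWi, hWj, hWmin⟩ := w1.exists_minimal_touching w3 w4
  obtain ⟨W', hW', hWc', hWi', hWj', hWmin'⟩ := v1.exists_minimal_touching v3 v4
  replace hWW := Set.disjoint_left.1 (hWW.mono hW hW')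
  replace hW := hW.trans w2
  replace hW' := hW'.trans v2
  clear! W₁ W₁'
  have hWni : y 0 ∉ W := fun h => (hW h).2.1 rfl
  have hWnj : y 1 ∉ W := fun h => (hW h).2.2 rfl
  have hWni' : y 0 ∉ W' := fun h => (hW' h).2.1 rfl
  have hWnj' : y 1 ∉ W' := fun h => (hW' h).2.2 rfl
  have h2W := h.notMem_of_minimal hWc hWc' hW hW' hWi hWj hWi' hWj' hWW hWmin
  have h2W' := h.notMem_of_minimal hWc' hWc hW' hW hWi' hWj' hWi hWj (fun z hz hz' => hWW hz' hz) hWmin'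
  obtain ⟨a, b, hab, Za, Zb, hd, ⟨a1, a2, a3, a4⟩, ⟨b1, b2, b3, b4⟩⟩ :=
    h.exists_fan_two (v := y 2) (e := y 0) (f := y 1) (T := W ∪ W' ∪ {y 0, y 1}) (h.notMem 2)
      (by simp) (by simp) (h.notMem 0) (h.notMem 1) hyik hyjk hyij
  have haZ := a4.symm.subset rfl
  have hbZ := b4.symm.subset rfl
  have ha' : ∀ z ∈ Za, z ∈ W ∪ W' ∪ {y 0, y 1} → z = a := fun z hz hz' => a4.subset ⟨hz, hz'⟩
  have hb' : ∀ z ∈ Zb, z ∈ W ∪ W' ∪ {y 0, y 1} → z = b := fun z hz hz' => b4.subset ⟨hz, hz'⟩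
  have hsame : ∀ {W W' : Set V}, G.ConnSet W → G.ConnSet W' →
      W ⊆ {w | w ∉ P ∧ w ≠ y 0 ∧ w ≠ y 1} → W' ⊆ {w | w ∉ P ∧ w ≠ y 0 ∧ w ≠ y 1} →
      G.Touches W (y 0) → G.Touches W (y 1) → G.Touches W' (y 0) → G.Touches W' (y 1) →
      (∀ ⦃z⦄, z ∈ W → z ∉ W') →
      (∀ W'' ⊆ W, (G.ConnSet W'' ∧ G.Touches W'' (y 0) ∧ G.Touches W'' (y 1)) → W'' = W) →
      (∀ z ∈ Za, z ∈ W ∪ W' ∪ {y 0, y 1} → z = a) → (∀ z ∈ Zb, z ∈ W ∪ W' ∪ {y 0, y 1} → z = b) →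
      y 2 ∉ W → y 2 ∉ W' → a ∈ W ∪ {y 0, y 1} → b ∈ W ∪ {y 0, y 1} → False := by
    intro W W' hW hW' hWP hWP' hW0 hW1 hW0' hW1' hWW hmin ha' hb' h2W h2W' haW hbW
    obtain ⟨Z₀, Z₁, hZ, hZW, hZ₀, hZ₁, h0, h1, hz⟩ := exists_split_of_minimal hW hyij
      (fun h => (hWP h).2.1 rfl) (fun h => (hWP h).2.2 rfl) hW0 hW1 hmin haW hbW hab
    rcases hz with ⟨ha0, hb1⟩ | ⟨hb0, ha1⟩
    · exact h.false_of_fan_two hW' hWP hWP' hW0' hW1' hWW h2W h2W' hd a1 b1 a2 b2 a3 b3 haZ.1 hbZ.1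
        ha' hb' hZ hZW hZ₀ hZ₁ h0 h1 ha0 hb1
    · exact h.false_of_fan_two hW' hWP hWP' hW0' hW1' hWW h2W h2W' hd.symm b1 a1 b2 a2 b3 a3 hbZ.1
        haZ.1 hb' ha' hZ hZW hZ₀ hZ₁ h0 h1 hb0 ha1
  have hside : ∀ {W : Set V} {c : V} {Zc : Set V}, G.ConnSet W →
      W ⊆ {w | w ∉ P ∧ w ≠ y 0 ∧ w ≠ y 1} → y 2 ∉ W → G.Touches W (y 0) → G.Touches W (y 1) →
      G.ConnSet Zc → Zc ⊆ {w | w ∉ P ∧ w ≠ y 2} → G.Touches Zc (y 2) → c ∈ Zc → c ∈ W →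
      y 0 ∉ Zc → y 1 ∉ Zc → G.IsSide P y (W ∪ Zc) := by
    intro W c Zc hW hWP h2W hW0 hW1 hZ hZP hZ2 hcZ hcW h0 h1
    refine ⟨hW.union_of_mem hZ hcW hcZ, ?_, ?_, ?_⟩
    · rintro z (hz | hz)
      · exact (hWP hz).1
      · exact (hZP hz).1
    · rintro z (hz | hz) i <;> fin_cases i
      · exact (hWP hz).2.1
      · exact (hWP hz).2.2
      · exact fun e => h2W (e ▸ hz)
      · exact fun e => h0 (e ▸ hz)
      · exact fun e => h1 (e ▸ hz)
      · exact (hZP hz).2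
    · intro i
      fin_cases i
      · exact hW0.mono Set.subset_union_left
      · exact hW1.mono Set.subset_union_left
      · exact hZ2.mono Set.subset_union_right
  have hne : ∀ {c : V} {Zc : Set V}, c ≠ y 0 → c ≠ y 1 →
      (∀ z ∈ Zc, z ∈ W ∪ W' ∪ {y 0, y 1} → z = c) → y 0 ∉ Zc ∧ y 1 ∉ Zc := fun h0 h1 hc =>
    ⟨fun h => h0 (hc _ h (by simp)).symm, fun h => h1 (hc _ h (by simp)).symm⟩
  rw [Set.disjoint_left] at hd
  have hcomm : ∀ z, z ∈ W' ∪ W ∪ {y 0, y 1} → z ∈ W ∪ W' ∪ {y 0, y 1} := by grind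
  have hS := hsame hWc hWc' hW hW' hWi hWj hWi' hWj' hWW hWmin ha' hb' h2W h2W'
  have hS' := hsame hWc' hWc hW' hW hWi' hWj' hWi hWj (fun z hz hz' => hWW hz' hz) hWmin'
    (fun z hz hz' => ha' z hz (hcomm z hz')) (fun z hz hz' => hb' z hz (hcomm z hz')) h2W' h2W
  by_cases haW : a ∈ W
  · have hbW : b ∈ W' := by grind
    have han := hne (c := a) (by grind) (by grind) ha'
    have hbn := hne (c := b) (by grind) (by grind) hb'
    refine ⟨W ∪ Za, W' ∪ Zb, ?_,
      hside hWc hW h2W hWi hWj a1 a2 a3 haZ.1 haW han.1 han.2,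
      hside hWc' hW' h2W' hWi' hWj' b1 b2 b3 hbZ.1 hbW hbn.1 hbn.2⟩
    rw [Set.disjoint_left]
    rintro z (hz | hz) (hz' | hz') <;> grind
  · have haW' : a ∈ W' := by grind
    have hbW : b ∈ W := by grind
    have han := hne (c := a) (by grind) (by grind) ha'
    have hbn := hne (c := b) (by grind) (by grind) hb'
    refine ⟨W ∪ Zb, W' ∪ Za, ?_,
      hside hWc hW h2W hWi hWj b1 b2 b3 hbZ.1 hbW hbn.1 hbn.2,
      hside hWc' hW' h2W' hWi' hWj' a1 a2 a3 haZ.1 haW' han.1 han.2⟩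
    rw [Set.disjoint_left]
    rintro z (hz | hz) (hz' | hz') <;> grind

/-- Two sides with a largest possible union form a partition: a remaining component could only be
attached to the path and to the `y i`, and this is excluded by `false_of_attached`. -/
theorem exists_partition (h : G.Config P x₁ x₂ y) : ∃ A B, G.IsPartition P y A B := by
  obtain ⟨A₀, B₀, hd₀, hA₀, hB₀⟩ := h.exists_sides
  obtain ⟨S, -, ⟨A, B, hd, hA, hB, rfl⟩, hmin⟩ := exists_minimal_subset
    (Q := fun S => ∃ A B, Disjoint A B ∧ G.IsSide P y A ∧ G.IsSide P y B ∧ S = (A ∪ B)ᶜ)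
    (S := (A₀ ∪ B₀)ᶜ) ⟨A₀, B₀, hd₀, hA₀, hB₀, rfl⟩
  refine ⟨A, B, hA, hB, hd, fun e heP hey => by_contra fun heAB => ?_⟩
  set W : Set V := {w | w ∉ P ∧ (∀ i, w ≠ y i) ∧ w ∉ A ∧ w ∉ B}
  have heW : e ∈ W := ⟨heP, hey, fun h => heAB (Or.inl h), fun h => heAB (Or.inr h)⟩
  set E := G.compIn W e
  have hE : G.ConnSet E := connSet_compIn heW
  have hEW : ∀ w ∈ E, w ∈ W := fun w hw => compIn_subset hw
  have heE : e ∈ E := mem_compIn_self heW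
  have hattach : ∀ {A B : Set V}, Disjoint A B → G.IsSide P y A → G.IsSide P y B →
      (∀ w ∈ E, w ∉ A ∧ w ∉ B) →
      (∀ S ⊆ (A ∪ B)ᶜ, (∃ A B, Disjoint A B ∧ G.IsSide P y A ∧ G.IsSide P y B ∧ S = (A ∪ B)ᶜ) →
        S = (A ∪ B)ᶜ) → ∀ u ∈ E, ∀ a ∈ A, ¬ G.Adj u a := by
    intro A B hd hA hB hEAB hmin u hu a ha hua
    rw [Set.disjoint_left] at hd
    have := hmin ((A ∪ E) ∪ B)ᶜ (by grind)
      ⟨A ∪ E, B, ?_, hA.union hE (fun v hv => (hEW v hv).1) (fun v hv => (hEW v hv).2.1) ha hu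
        hua.symm, hB, rfl⟩
    · have hu' : u ∈ ((A ∪ E) ∪ B)ᶜ := this ▸ fun h => h.elim (hEAB u hu).1 (hEAB u hu).2
      exact hu' (Or.inl (Or.inr hu))
    · rw [Set.disjoint_left]
      rintro z (hz | hz) hz'
      · exact hd hz hz'
      · exact (hEAB z hz).2 hz'
  have hEA := hattach hd hA hB (fun w hw => (hEW w hw).2.2) hmin
  have hEB := hattach hd.symm hB hA (fun w hw => ⟨(hEW w hw).2.2.2, (hEW w hw).2.2.1⟩)
    (by rwa [Set.union_comm B A])
  have hN : ∀ u ∈ E, ∀ w, G.Adj u w → w ∈ E ∨ w ∈ P ∨ ∃ i, w = y i := by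
    intro u hu w huw
    by_contra! hw
    exact hw.1 (compIn_closed hu ⟨hw.2.1, hw.2.2, fun hwA => hEA u hu w hwA huw,
      fun hwB => hEB u hu w hwB huw⟩ huw)
  have htwo : ∃ i j, i ≠ j ∧ G.Touches E (y i) ∧ G.Touches E (y j) := by
    by_contra! htwo
    obtain ⟨i, hi⟩ : ∃ i, ∀ j, G.Touches E (y j) → j = i := by
      by_cases hex : ∃ i, G.Touches E (y i)
      · obtain ⟨i, hi⟩ := hex
        exact ⟨i, fun j hj => by_contra fun hne => htwo j i hne hj hi⟩
      · exact ⟨0, fun j hj => absurd ⟨j, hj⟩ hex⟩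
    obtain ⟨j, hj⟩ : ∃ j, j ≠ i := by clear * -; revert i; decide
    refine h.false_of_closed_two (U := E) (c := y i) (fun u hu w hw huw => ?_) heE heP (hey i)
      (t := y j) (fun hj => (hEW _ hj).2.1 j rfl) (h.notMem j) (h.inj.ne hj)
    rcases hN u hu w huw with hw' | hw' | ⟨k, rfl⟩
    · exact Or.inl hw'
    · exact absurd hw' hw
    · exact Or.inr (congrArg y (hi k ⟨u, hu, huw⟩))
  obtain ⟨i, j, hij, hi, hj⟩ := htwo
  obtain ⟨k, hik, hjk, hall⟩ : ∃ k, i ≠ k ∧ j ≠ k ∧ ∀ m, m = i ∨ m = j ∨ m = k := by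
    clear * - hij
    revert i j
    decide
  have hyij := h.inj.ne hij
  have hyik := h.inj.ne hik
  have hyjk := h.inj.ne hjk
  have hPi := h.notMem i
  have hPj := h.notMem j
  have hAP := hA.notMem_path
  have hAy := hA.notMem
  have hEy : ∀ i, y i ∉ E := fun i hi => (hEW _ hi).2.1 i rfl
  refine h.false_of_attached (i := i) (j := j) (k := k) hE hEy (h.notMem k) hi hj
    (R := {y i}) (S := {y j}) (T := A) ?_ (connSet_singleton _) (connSet_singleton _) hA.conn rfl
    rfl rfl rfl (hA.touches i) (hA.touches j) ?_ ?_
  · intro u hu w huw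
    rcases hN u hu w huw with hw | hw | ⟨m, rfl⟩
    · exact Or.inl hw
    · exact Or.inr (Or.inl hw)
    · rcases hall m with rfl | rfl | rfl <;> simp
  · rintro w (((rfl | rfl) | hw) | hw)
    · exact hPi
    · exact hPj
    · exact hAP w hw
    · exact (hEW w hw).1
  · simp only [List.pairwise_cons, List.mem_cons, List.not_mem_nil, or_false, Set.disjoint_left,
      forall_eq_or_imp, forall_eq, Set.mem_singleton_iff, List.Pairwise.nil, and_true]
    have : ∀ w ∈ A, w ∉ E := fun w hw hwE => (hEW w hwE).2.2.1 hw
    and_intros <;> grind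

end Config

end Partition

end SimpleGraph

namespace SimpleGraph

/-! ### Separating vertices of a side -/

section Gate

variable {V : Type*} {G : SimpleGraph V} {P : Set V} {x₁ x₂ : V} {y : Fin 3 → V} {A B : Set V}

/-- The vertex `x` of `A` separates `y i` from the other two `y j` inside `A`. -/
def IsSep (G : SimpleGraph V) (y : Fin 3 → V) (A : Set V) (i : Fin 3) (x : V) : Prop :=
  x ∈ A ∧ ∀ Z ⊆ A \ {x}, G.ConnSet Z → G.Touches Z (y i) → ∀ j, j ≠ i → ¬ G.Touches Z (y j)

/-- The part of `A - x` that is connected to some `y j` with `j ≠ i`. -/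
def farSide (G : SimpleGraph V) (y : Fin 3 → V) (A : Set V) (i : Fin 3) (x : V) : Set V :=
  {a | ∃ Z ⊆ A \ {x}, G.ConnSet Z ∧ a ∈ Z ∧ ∃ j, j ≠ i ∧ G.Touches Z (y j)}

/-- A vertex separating `y i` from the other two `y j` inside `A`, as far away from `y i` as
possible. -/
def IsGate (G : SimpleGraph V) (y : Fin 3 → V) (A : Set V) (i : Fin 3) (x : V) : Prop :=
  G.IsSep y A i x ∧ ∀ x', G.IsSep y A i x' → G.farSide y A i x' ⊆ G.farSide y A i x →
    G.farSide y A i x' = G.farSide y A i x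

/-- Two disjoint connected subsets of `A`, together with the `y i`, of which one contains `u` and
`y p`, and the other one the two other `y i`. -/
def LinkedIn (G : SimpleGraph V) (y : Fin 3 → V) (A : Set V) (u : V) (p : Fin 3) : Prop :=
  ∃ Z Z', Disjoint Z Z' ∧ G.ConnSet Z ∧ G.ConnSet Z' ∧ Z ⊆ insert (y p) A ∧
    Z' ⊆ A ∪ {v | ∃ i, i ≠ p ∧ v = y i} ∧ u ∈ Z ∧ y p ∈ Z ∧ ∀ i, i ≠ p → y i ∈ Z'

/-- After the deletion of `t`, no two of the `y i` are connected inside `A`. -/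
def IsStarCenter (G : SimpleGraph V) (y : Fin 3 → V) (A : Set V) (t : V) : Prop :=
  t ∈ A ∧ ∀ Z ⊆ A \ {t}, G.ConnSet Z → ∀ i j, G.Touches Z (y i) → G.Touches Z (y j) → i = j

theorem farSide_subset {i : Fin 3} {x : V} : G.farSide y A i x ⊆ A \ {x} :=
  fun _ ⟨_, hZ, _, ha, _⟩ => hZ ha

theorem ConnSet.subset_farSide {i j : Fin 3} {x : V} {Z : Set V} (hZ : G.ConnSet Z)
    (hZA : Z ⊆ A \ {x}) (hj : j ≠ i) (h : G.Touches Z (y j)) : Z ⊆ G.farSide y A i x :=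
  fun _ hz => ⟨Z, hZA, hZ, hz, j, hj, h⟩

theorem farSide_closed {i : Fin 3} {x a b : V} (ha : a ∈ G.farSide y A i x) (hb : b ∈ A)
    (hbx : b ≠ x) (hab : G.Adj a b) : b ∈ G.farSide y A i x := by
  obtain ⟨Z, hZ, hZc, haZ, j, hj, hZj⟩ := ha
  exact ⟨insert b Z, Set.insert_subset ⟨hb, hbx⟩ hZ, hZc.insert ⟨a, haZ, hab⟩, Or.inl rfl, j, hj,
    hZj.mono (Set.subset_insert _ _)⟩

theorem IsSep.notMem_farSide {i : Fin 3} {x s : V} (hx : G.IsSep y A i x) (hs : G.Adj s (y i)) :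
    s ∉ G.farSide y A i x :=
  fun ⟨Z, hZ, hZc, hsZ, j, hj, hZj⟩ => hx.2 Z hZ hZc ⟨s, hsZ, hs⟩ j hj hZj

/-- What is not on the far side is connected. -/
theorem IsSep.connSet_near {i : Fin 3} {x : V} (hx : G.IsSep y A i x) (hA : G.ConnSet A) :
    G.ConnSet (A \ G.farSide y A i x) :=
  hA.diff_of_attached hx.1 (fun h => (farSide_subset h).2 rfl) fun _ he _ ha haf hea =>
    by_contra fun hax => haf (farSide_closed he ha hax hea)

theorem IsSep.touches_near {i : Fin 3} {x : V} (hx : G.IsSep y A i x) (hA : G.IsSide P y A) :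
    G.Touches (A \ G.farSide y A i x) (y i) := by
  obtain ⟨s, hs, hsi⟩ := hA.touches i
  exact ⟨s, ⟨hs, hx.notMem_farSide hsi⟩, hsi⟩

/-- A connected subset of `A` that contains `x` and touches `y j`, where `j ≠ i`, contains a way from
`x` to `y j` through the far side. -/
theorem exists_conn_farSide {i j : Fin 3} {x : V} {Z : Set V} (hZ : G.ConnSet Z) (hZA : Z ⊆ A)
    (hx : x ∈ Z) (hj : j ≠ i) (hZj : G.Touches Z (y j)) :
    ∃ K, G.ConnSet K ∧ K ⊆ insert (y j) (Z ∩ G.farSide y A i x) ∧ y j ∈ K ∧ G.Touches K x := by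
  obtain ⟨s, hs, hsj⟩ := hZj
  by_cases hsx : s = x
  · exact ⟨{y j}, connSet_singleton _, by simp, rfl, y j, rfl, hsx ▸ hsj.symm⟩
  · have hs' : s ∈ Z \ {x} := ⟨hs, hsx⟩
    have hC : G.ConnSet (G.compIn (Z \ {x}) s) := connSet_compIn hs'
    have hsC := mem_compIn_self (G := G) hs'
    have hCA : G.compIn (Z \ {x}) s ⊆ A \ {x} := fun z hz =>
      ⟨hZA (compIn_subset hz).1, (compIn_subset hz).2⟩
    have hCj : G.Touches (G.compIn (Z \ {x}) s) (y j) := ⟨s, hsC, hsj⟩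
    refine ⟨insert (y j) (G.compIn (Z \ {x}) s), hC.insert hCj, Set.insert_subset_insert ?_,
      Or.inl rfl, (hZ.touches_compIn hx hs hsx).mono (Set.subset_insert _ _)⟩
    exact fun z hz => ⟨(compIn_subset hz).1, hC.subset_farSide hCA hj hCj hz⟩

/-- Both sides give links for adjacent vertices `u`, `w`. If these lead to different vertices `y p`
and `y q`, there is a cycle through all `y i`. -/
theorem Config.eq_of_linkedIn (h : G.Config P x₁ x₂ y) (hA : G.IsSide P y A) (hB : G.IsSide P y B)
    (hd : Disjoint A B) {u w : V} (huw : G.Adj u w) {p q : Fin 3} (hu : G.LinkedIn y A u p)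
    (hw : G.LinkedIn y B w q) : p = q := by
  by_contra hpq
  obtain ⟨r, hpr, hqr⟩ : ∃ r, p ≠ r ∧ q ≠ r := by
    clear * -
    revert p q
    decide
  obtain ⟨Z, Z', a1, a2, a3, a4, a5, a6, a7, a8⟩ := hu
  obtain ⟨Y, Y', b1, b2, b3, b4, b5, b6, b7, b8⟩ := hw
  have hypq := h.inj.ne hpq
  have hypr := h.inj.ne hpr
  have hyqr := h.inj.ne hqr
  have hAy := hA.notMem
  have hBy := hB.notMem
  have hAP := hA.notMem_path
  have hBP := hB.notMem_path
  have hall : ∀ i, i = p ∨ i = q ∨ i = r := by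
    clear * - hpq hpr hqr
    revert p q r
    decide
  have a5' : ∀ z ∈ Z', z ∈ A ∨ z = y q ∨ z = y r := by
    intro z hz
    rcases a5 hz with hz | ⟨i, hi, rfl⟩
    · exact Or.inl hz
    · rcases hall i with rfl | rfl | rfl <;> simp at hi ⊢
  have b5' : ∀ z ∈ Y', z ∈ B ∨ z = y p ∨ z = y r := by
    intro z hz
    rcases b5 hz with hz | ⟨i, hi, rfl⟩
    · exact Or.inl hz
    · rcases hall i with rfl | rfl | rfl <;> simp at hi ⊢
  have a4' : ∀ z ∈ Z, z ∈ A ∨ z = y p := fun z hz => (a4 hz).symm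
  have b4' : ∀ z ∈ Y, z ∈ B ∨ z = y q := fun z hz => (b4 hz).symm
  have h1 : G.JoinedIn ((Z ∪ Y) \ {y p, y q}) (y p) (y q) :=
    ⟨Z ∪ Y, a2.union_of_adj b2 a6 b6 huw, Or.inl a7, Or.inr b7,
      by rw [Set.sdiff_union_self]; exact Set.subset_union_left⟩
  have h2 : G.JoinedIn (Y' \ {y p, y r}) (y p) (y r) :=
    ⟨Y', b3, b8 p hpq, b8 r (Ne.symm hqr),
      by rw [Set.sdiff_union_self]; exact Set.subset_union_left⟩
  have h3 : G.JoinedIn (Z' \ {y q, y r}) (y q) (y r) :=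
    ⟨Z', a3, a8 q (Ne.symm hpq), a8 r (Ne.symm hpr),
      by rw [Set.sdiff_union_self]; exact Set.subset_union_left⟩
  have hpP := h.notMem p
  have hqP := h.notMem q
  have hrP := h.notMem r
  rw [Set.disjoint_left] at hd a1 b1
  refine h.false_of_cycle hpq hpr hqr h1 h2 h3 ?_ ?_ ?_ ?_
  · rw [Set.disjoint_left]
    rintro z ⟨hz | hz, hz'⟩ ⟨hw, hw'⟩
    · have := a4' z hz
      have := b5' z hw
      simp only [Set.mem_insert_iff, Set.mem_singleton_iff, not_or] at hz' hw'
      grind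
    · exact b1 hz hw
  · rw [Set.disjoint_left]
    rintro z ⟨hz | hz, hz'⟩ ⟨hw, hw'⟩
    · exact a1 hz hw
    · have := b4' z hz
      have := a5' z hw
      simp only [Set.mem_insert_iff, Set.mem_singleton_iff, not_or] at hz' hw'
      grind
  · rw [Set.disjoint_left]
    rintro z ⟨hz, hz'⟩ ⟨hw, hw'⟩
    have := b5' z hz
    have := a5' z hw
    simp only [Set.mem_insert_iff, Set.mem_singleton_iff, not_or] at hz' hw'
    grind
  · simp only [Set.mem_union, Set.mem_sdiff, Set.mem_insert_iff, Set.mem_singleton_iff, not_or]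
    rintro z ((⟨hz | hz, hz'⟩ | ⟨hz, hz'⟩) | ⟨hz, hz'⟩)
    · have := a4' z hz
      grind
    · have := b4' z hz
      grind
    · have := b5' z hz
      grind
    · have := a5' z hz
      grind

variable [Finite V]

theorem exists_isGate {i : Fin 3} (h : ∃ x, G.IsSep y A i x) : ∃ x, G.IsGate y A i x := by
  obtain ⟨x, hx⟩ := h
  obtain ⟨S, -, ⟨x', hx', rfl⟩, hmin⟩ := exists_minimal_subset
    (Q := fun S => ∃ x, G.IsSep y A i x ∧ S = G.farSide y A i x) ⟨x, hx, rfl⟩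
  exact ⟨x', hx', fun x'' h1 h2 => hmin _ h2 ⟨x'', h1, rfl⟩⟩

/-- From a gate there are disjoint ways through the far side to the other two `y j`. A vertex
separating it from them would be a gate still farther away. -/
theorem IsGate.exists_links (hA : G.IsSide P y A) (hy : Function.Injective y) {i j k : Fin 3}
    (hij : j ≠ i) (hik : k ≠ i) (hjk : j ≠ k) {n : V} (hn : G.IsGate y A i n) :
    ∃ Rj Rk, Disjoint Rj Rk ∧
      (G.ConnSet Rj ∧ y j ∈ Rj ∧ Rj ⊆ insert (y j) (G.farSide y A i n) ∧ G.Touches Rj n) ∧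
      (G.ConnSet Rk ∧ y k ∈ Rk ∧ Rk ⊆ insert (y k) (G.farSide y A i n) ∧ G.Touches Rk n) := by
  have hcase : ∀ m, m = j ∨ m = k → m ≠ i := by
    rintro m (rfl | rfl) <;> assumption
  have key : ∀ c, ∃ K, G.ConnSet K ∧ K ⊆ G.farSide y A i n ∪ {y j, y k} ∧ c ∉ K ∧
      (K ∩ {w | G.Adj w n}).Nonempty ∧ (K ∩ {y j, y k}).Nonempty := by
    intro c
    by_contra hno
    have hway : ∀ {m Z}, m = j ∨ m = k → G.ConnSet Z → Z ⊆ A → n ∈ Z → c ∉ Z → c ≠ y m →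
        ¬ G.Touches Z (y m) := by
      intro m Z hm hZ hZA hnZ hcZ hcm hZm
      obtain ⟨K, h1, h2, h3, s, hs, hsn⟩ := exists_conn_farSide hZ hZA hnZ (hcase m hm) hZm
      have hm' : y m ∈ ({y j, y k} : Set V) := by rcases hm with rfl | rfl <;> simp
      refine hno ⟨K, h1, fun z hz => ?_, fun hc => ?_, ⟨s, hs, hsn⟩, y m, h3, hm'⟩
      · rcases h2 hz with rfl | hz
        · exact Or.inr hm'
        · exact Or.inl hz.2
      · rcases h2 hc with hc | hc
        · exact hcm hc
        · exact hcZ hc.1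
    have hcA : c ∈ A := by
      by_contra hcA
      obtain ⟨m, hm, hcm⟩ : ∃ m, (m = j ∨ m = k) ∧ c ≠ y m := by
        by_cases hcj : c = y j
        · exact ⟨k, Or.inr rfl, fun h => hjk (hy (hcj.symm.trans h))⟩
        · exact ⟨j, Or.inl rfl, hcj⟩
      exact hway hm hA.conn subset_rfl hn.1.1 hcA hcm (hA.touches m)
    have hcy := hA.ne c hcA
    have hall : ∀ m, m ≠ i → m = j ∨ m = k := by
      clear * - hij hik hjk
      revert i j k
      decide
    have hnZ : ∀ {m Z}, m ≠ i → G.ConnSet Z → Z ⊆ A \ {c} → G.Touches Z (y m) → Z ⊆ A \ {n} :=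
      fun hm hZ hZA hZm z hz => ⟨(hZA hz).1, fun e => hway (hall _ hm) hZ (fun z hz => (hZA hz).1)
        (e ▸ hz) (fun h => (hZA h).2 rfl) (hcy _) hZm⟩
    have hcsep : G.IsSep y A i c := ⟨hcA, fun Z hZA hZ hZi m hm hZm =>
      hn.1.2 Z (hnZ hm hZ hZA hZm) hZ hZi m hm hZm⟩
    have hsub : G.farSide y A i c ⊆ G.farSide y A i n := fun a ⟨Z, hZA, hZ, ha, m, hm, hZm⟩ =>
      ⟨Z, hnZ hm hZ hZA hZm, hZ, ha, m, hm, hZm⟩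
    have hcfar : c ∈ G.farSide y A i n := by
      by_contra hcfar
      obtain ⟨K, h1, h2, h3, s, hs, hsn⟩ := exists_conn_farSide hA.conn subset_rfl hn.1.1 hij
        (hA.touches j)
      refine hno ⟨K, h1, fun z hz => ?_, fun hc => ?_, ⟨s, hs, hsn⟩, y j, h3, Or.inl rfl⟩
      · exact (h2 hz).elim (fun h => Or.inr (Or.inl h)) fun h => Or.inl h.2
      · exact (h2 hc).elim (fun h => hcy j h) fun h => hcfar h.2
    rw [← hn.2 c hcsep hsub] at hcfar
    exact (farSide_subset hcfar).2 rfl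
  obtain ⟨a, b, hab, Za, Zb, hd, ⟨a1, a2, ⟨s, hs, hsn⟩, a4⟩, ⟨b1, b2, ⟨t, ht, htn⟩, b4⟩⟩ :=
    exists_two_linkage (by obtain ⟨K, h1, h2, -, h3⟩ := key n; exact ⟨K, h1, h2, h3⟩) key
  have fin : ∀ {a : V} {Z : Set V}, Z ⊆ G.farSide y A i n ∪ {y j, y k} → Z ∩ {y j, y k} = {a} →
      a ∈ Z ∧ Z ⊆ insert a (G.farSide y A i n) := by
    intro a Z h1 h2
    refine ⟨(h2.symm.subset rfl).1, fun z hz => ?_⟩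
    rcases h1 hz with hz' | hz'
    · exact Or.inr hz'
    · exact Or.inl (h2.subset ⟨hz, hz'⟩)
  have ha := fin a2 a4
  have hb := fin b2 b4
  have ha' : a ∈ ({y j, y k} : Set V) := (a4.symm.subset rfl).2
  have hb' : b ∈ ({y j, y k} : Set V) := (b4.symm.subset rfl).2
  rcases ha' with rfl | rfl <;> rcases hb' with rfl | rfl
  · exact absurd rfl hab
  · exact ⟨Za, Zb, hd, ⟨a1, ha.1, ha.2, s, hs, hsn⟩, ⟨b1, hb.1, hb.2, t, ht, htn⟩⟩
  · exact ⟨Zb, Za, hd.symm, ⟨b1, hb.1, hb.2, t, ht, htn⟩, ⟨a1, ha.1, ha.2, s, hs, hsn⟩⟩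
  · exact absurd rfl hab

/-- A vertex on the far side of a gate can be linked to one of the other two `y j`. -/
theorem IsGate.linkedIn_of_mem_farSide (hA : G.IsSide P y A) (hy : Function.Injective y)
    {i : Fin 3} {n u : V} (hn : G.IsGate y A i n) (hu : u ∈ G.farSide y A i n) :
    ∃ p, p ≠ i ∧ G.LinkedIn y A u p := by
  obtain ⟨j, k, hij, hik, hjk, hall⟩ : ∃ j k, j ≠ i ∧ k ≠ i ∧ j ≠ k ∧
      ∀ m, m ≠ i → m = j ∨ m = k := by
    clear * -
    revert i
    decide
  have huA : u ∈ A := (farSide_subset hu).1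
  set T : Set V := {y j, y k} with hT
  have hTm : ∀ m, m ≠ i → y m ∈ T := fun m hm => by rcases hall m hm with rfl | rfl <;> simp [hT]
  have key : ∀ c, ∃ K, G.ConnSet K ∧ K ⊆ A ∪ Set.range y ∧ c ∉ K ∧
      (K ∩ {u, y i}).Nonempty ∧ (K ∩ T).Nonempty := by
    intro c
    by_contra hno
    have hway : ∀ {m Z}, m ≠ i → G.ConnSet Z → Z ⊆ A → u ∈ Z → c ∉ Z → c ≠ y m →
        ¬ G.Touches Z (y m) := by
      intro m Z hm hZ hZA huZ hcZ hcm hZm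
      refine hno ⟨insert (y m) Z, hZ.insert hZm, ?_, ?_, ⟨u, Or.inr huZ, Or.inl rfl⟩, y m, Or.inl rfl,
        hTm m hm⟩
      · exact Set.insert_subset (Or.inr ⟨m, rfl⟩) (hZA.trans Set.subset_union_left)
      · rintro (hc | hc)
        · exact hcm hc
        · exact hcZ hc
    have hcA : c ∈ A := by
      by_contra hcA
      obtain ⟨m, hm, hcm⟩ : ∃ m, m ≠ i ∧ c ≠ y m := by
        by_cases hcj : c = y j
        · exact ⟨k, hik, fun h => hjk (hy (hcj.symm.trans h))⟩
        · exact ⟨j, hij, hcj⟩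
      exact hway hm hA.conn subset_rfl huA hcA hcm (hA.touches m)
    have hcy := hA.ne c hcA
    have hcsep : G.IsSep y A i c := by
      refine ⟨hcA, fun Z hZA hZ hZi m hm hZm => ?_⟩
      refine hno ⟨insert (y m) (insert (y i) Z),
        (hZ.insert hZi).insert (hZm.mono (Set.subset_insert _ _)), ?_, ?_,
        ⟨y i, Or.inr (Or.inl rfl), Or.inr rfl⟩, y m, Or.inl rfl, hTm m hm⟩
      · exact Set.insert_subset (Or.inr ⟨m, rfl⟩) (Set.insert_subset (Or.inr ⟨i, rfl⟩)
          fun z hz => Or.inl (hZA hz).1)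
      · rintro (hc | hc | hc)
        · exact hcy m hc
        · exact hcy i hc
        · exact (hZA hc).2 rfl
    have hcfar : c ∈ G.farSide y A i n := by
      obtain ⟨Z, hZA, hZ, huZ, m, hm, hZm⟩ := hu
      by_contra hcZ
      exact hway hm hZ (fun z hz => (hZA hz).1) huZ
        (fun h => hcZ ⟨Z, hZA, hZ, h, m, hm, hZm⟩) (hcy m) hZm
    have hsub : G.farSide y A i c ⊆ G.farSide y A i n := by
      rintro a ⟨Z, hZA, hZ, ha, m, hm, hZm⟩
      refine ⟨Z, fun z hz => ⟨(hZA hz).1, ?_⟩, hZ, ha, m, hm, hZm⟩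
      -- Otherwise `n` is in `Z`, and `Z` with the near side of `n` connects `y i` and `y m`.
      rintro rfl
      have hnear : z ∈ A \ G.farSide y A i z := ⟨hn.1.1, fun h => (farSide_subset h).2 rfl⟩
      refine hcsep.2 (Z ∪ (A \ G.farSide y A i z))
        (Set.union_subset hZA fun w hw => ⟨hw.1, fun e => hw.2 (e ▸ hcfar)⟩)
        (hZ.union_of_mem (hn.1.connSet_near hA.conn) hz hnear)
        ((hn.1.touches_near hA).mono Set.subset_union_right) m hm
        (hZm.mono Set.subset_union_left)
    rw [← hn.2 c hcsep hsub] at hcfar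
    exact (farSide_subset hcfar).2 rfl
  obtain ⟨a, b, hab, Za, Zb, hd, ⟨a1, a2, ⟨s, hs, hsu⟩, a4⟩, ⟨b1, b2, ⟨t, ht, htu⟩, b4⟩⟩ :=
    exists_two_linkage (by obtain ⟨K, h1, h2, -, h3⟩ := key u; exact ⟨K, h1, h2, h3⟩) key
  have fin : ∀ {a b : V} {Za Zb : Set V}, a ≠ b → Disjoint Za Zb → G.ConnSet Za → G.ConnSet Zb →
      Za ⊆ A ∪ Set.range y → Zb ⊆ A ∪ Set.range y → Za ∩ T = {a} → Zb ∩ T = {b} → u ∈ Za →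
      y i ∈ Zb → ∃ p, p ≠ i ∧ G.LinkedIn y A u p := by
    intro a b Za Zb hab hd a1 b1 a2 b2 a4 b4 hua hib
    have ha := a4.symm.subset rfl
    have hb := b4.symm.subset rfl
    obtain ⟨p, hp, rfl⟩ : ∃ p, p ≠ i ∧ a = y p := by
      rcases ha.2 with rfl | rfl
      exacts [⟨j, hij, rfl⟩, ⟨k, hik, rfl⟩]
    obtain ⟨q, hq, rfl⟩ : ∃ p, p ≠ i ∧ b = y p := by
      rcases hb.2 with rfl | rfl
      exacts [⟨j, hij, rfl⟩, ⟨k, hik, rfl⟩]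
    have hpq : p ≠ q := fun e => hab (e ▸ rfl)
    rw [Set.disjoint_left] at hd
    refine ⟨p, hp, Za, Zb, Set.disjoint_left.2 hd, a1, b1, fun z hz => ?_, fun z hz => ?_, hua, ha.1,
      fun m hm => ?_⟩
    · rcases a2 hz with h | ⟨m, rfl⟩
      · exact Or.inr h
      · by_cases hm : m = i
        · exact absurd (hm ▸ hib) (hd hz)
        · exact Or.inl (a4.subset ⟨hz, hTm m hm⟩)
    · rcases b2 hz with h | ⟨m, rfl⟩
      · exact Or.inl h
      · exact Or.inr ⟨m, fun e => hd ha.1 (e ▸ hz), rfl⟩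
    · have : m = i ∨ m = q := by
        clear * - hp hq hpq hm
        revert m p q i
        decide
      rcases this with rfl | rfl
      · exact hib
      · exact hb.1
  rw [Set.disjoint_left] at hd
  rcases hsu with rfl | rfl <;> rcases htu with rfl | rfl
  · exact absurd ht (hd hs)
  · exact fin hab (Set.disjoint_left.2 hd) a1 b1 a2 b2 a4 b4 hs ht
  · exact fin hab.symm (Set.disjoint_left.2 hd).symm b1 a1 b2 a2 b4 a4 ht hs
  · exact absurd ht (hd hs)

namespace Config

/-- Without a separating vertex there would be two disjoint connections in `A` from `y i` to the
other two `y j`, and hence a cycle using `B`. -/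
theorem exists_isSep (h : G.Config P x₁ x₂ y) (hA : G.IsSide P y A) (hB : G.IsSide P y B)
    (hd : Disjoint A B) (i : Fin 3) : ∃ x, G.IsSep y A i x := by
  by_contra! hno
  obtain ⟨j, k, hij, hik, hjk, hall⟩ : ∃ j k, j ≠ i ∧ k ≠ i ∧ j ≠ k ∧
      ∀ m, m ≠ i → m = j ∨ m = k := by
    clear * -
    revert i
    decide
  have hyij := h.inj.ne hij
  have hyik := h.inj.ne hik
  have hyjk := h.inj.ne hjk
  set T : Set V := {y j, y k} with hT
  have hTm : ∀ m, m ≠ i → y m ∈ T := fun m hm => by rcases hall m hm with rfl | rfl <;> simp [hT]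
  have key : ∀ c, ∃ K, G.ConnSet K ∧ K ⊆ A ∪ T ∧ c ∉ K ∧
      (K ∩ {w | G.Adj w (y i)}).Nonempty ∧ (K ∩ T).Nonempty := by
    intro c
    have hway : ∀ {m Z}, m ≠ i → G.ConnSet Z → Z ⊆ A → G.Touches Z (y i) → c ∉ Z → c ≠ y m →
        G.Touches Z (y m) → ∃ K, G.ConnSet K ∧ K ⊆ A ∪ T ∧ c ∉ K ∧
      (K ∩ {w | G.Adj w (y i)}).Nonempty ∧ (K ∩ T).Nonempty := by
      rintro m Z hm hZ hZA ⟨s, hs, hsi⟩ hcZ hcm hZm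
      refine ⟨insert (y m) Z, hZ.insert hZm, Set.insert_subset (Or.inr (hTm m hm))
        (hZA.trans Set.subset_union_left), ?_, ⟨s, Or.inr hs, hsi⟩, y m, Or.inl rfl, hTm m hm⟩
      rintro (hc | hc)
      · exact hcm hc
      · exact hcZ hc
    by_cases hcA : c ∈ A
    · have := hno c
      simp only [IsSep, not_and, not_forall, not_not] at this
      obtain ⟨Z, hZA, hZ, hZi, m, hm, hZm⟩ := this hcA
      exact hway hm hZ (fun z hz => (hZA hz).1) hZi (fun h => (hZA h).2 rfl) (hA.ne c hcA m) hZm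
    · obtain ⟨m, hm, hcm⟩ : ∃ m, m ≠ i ∧ c ≠ y m := by
        by_cases hcj : c = y j
        · exact ⟨k, hik, fun h => hyjk (hcj.symm.trans h)⟩
        · exact ⟨j, hij, hcj⟩
      exact hway hm hA.conn subset_rfl (hA.touches i) hcA hcm (hA.touches m)
  obtain ⟨a, b, hab, Za, Zb, hdZ, ⟨a1, a2, ⟨s, hs, hsi⟩, a4⟩, ⟨b1, b2, ⟨t, ht, hti⟩, b4⟩⟩ :=
    exists_two_linkage (by obtain ⟨K, h1, h2, -, h3⟩ := key x₁; exact ⟨K, h1, h2, h3⟩) key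
  have fin : ∀ {p q : Fin 3} {Zp Zq : Set V}, p ≠ i → q ≠ i → p ≠ q → Disjoint Zp Zq →
      G.ConnSet Zp → G.ConnSet Zq → Zp ⊆ A ∪ T → Zq ⊆ A ∪ T → G.Touches Zp (y i) →
      G.Touches Zq (y i) → Zp ∩ T = {y p} → Zq ∩ T = {y q} → False := by
    intro p q Zp Zq hp hq hpq hdZ a1 b1 a2 b2 a3 b3 a4 b4
    have ha := a4.symm.subset rfl
    have hb := b4.symm.subset rfl
    have ha' : ∀ z ∈ Zp \ {y p}, z ∈ A := fun z hz => (a2 hz.1).resolve_right fun h =>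
      hz.2 (a4.subset ⟨hz.1, h⟩)
    have hb' : ∀ z ∈ Zq \ {y q}, z ∈ A := fun z hz => (b2 hz.1).resolve_right fun h =>
      hz.2 (b4.subset ⟨hz.1, h⟩)
    refine h.false_of_cycle (Ne.symm hp) (Ne.symm hq) hpq (a1.joinedIn a3 ha.1 subset_rfl)
      (b1.joinedIn b3 hb.1 subset_rfl)
      (hB.conn.joinedIn_of_touches (hB.touches p) (hB.touches q) subset_rfl)
      (hdZ.mono Set.sdiff_subset Set.sdiff_subset) (hd.mono_left ha') (hd.mono_left hb') ?_
    rintro z ((hz | hz) | hz)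
    · exact ⟨hA.notMem_path z (ha' z hz), hA.ne z (ha' z hz) _, hA.ne z (ha' z hz) _,
        hA.ne z (ha' z hz) _⟩
    · exact ⟨hA.notMem_path z (hb' z hz), hA.ne z (hb' z hz) _, hA.ne z (hb' z hz) _,
        hA.ne z (hb' z hz) _⟩
    · exact ⟨hB.notMem_path z hz, hB.ne z hz _, hB.ne z hz _, hB.ne z hz _⟩
  have ha' : a ∈ T := (a4.symm.subset rfl).2
  have hb' : b ∈ T := (b4.symm.subset rfl).2
  rcases ha' with rfl | rfl <;> rcases hb' with rfl | rfl
  · exact hab rfl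
  · exact fin hij hik hjk hdZ a1 b1 a2 b2 ⟨s, hs, hsi⟩ ⟨t, ht, hti⟩ a4 b4
  · exact fin hik hij hjk.symm hdZ a1 b1 a2 b2 ⟨s, hs, hsi⟩ ⟨t, ht, hti⟩ a4 b4
  · exact hab rfl

end Config

end Gate

end SimpleGraph

namespace SimpleGraph

/-! ### Two sides with compatible separating vertices -/

section DoubleCut

variable {V : Type*} {G : SimpleGraph V} {P : Set V} {x₁ x₂ : V} {y : Fin 3 → V} {A B : Set V}
  {n m : Fin 3 → V} {C D : Fin 3 → Set V}

/-- For each `i`, the vertex `n i` of the side `A` cuts off a part `C i` of `A` that contains all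
neighbours of `y i` in `A` different from `n i`. -/
structure IsCut (G : SimpleGraph V) (y : Fin 3 → V) (A : Set V) (n : Fin 3 → V)
    (C : Fin 3 → Set V) : Prop where
  sub : ∀ i, C i ⊆ A
  mem : ∀ i, n i ∈ A
  notMem : ∀ i j, n i ∉ C j
  disj : ∀ i j, i ≠ j → Disjoint (C i) (C j)
  closed : ∀ i, ∀ a ∈ C i, ∀ b ∈ A, G.Adj a b → b ∈ C i ∨ b = n i
  nbr : ∀ i, ∀ a ∈ A, G.Adj a (y i) → a ∈ C i ∨ a = n i

namespace IsCut

theorem attached (h : G.IsCut y A n C) {i : Fin 3} {e a : V} (he : e ∈ C i) (ha : a ∈ A)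
    (haC : a ∉ C i) (hea : G.Adj e a) : a = n i :=
  (h.closed i e he a ha hea).resolve_left haC

theorem conn_diff (h : G.IsCut y A n C) (hA : G.ConnSet A) (i : Fin 3) : G.ConnSet (A \ C i) :=
  hA.diff_of_attached (h.mem i) (h.notMem i i) fun _ he _ ha haC hea => h.attached he ha haC hea

theorem conn_insert (h : G.IsCut y A n C) (hA : G.ConnSet A) (i : Fin 3) :
    G.ConnSet (insert (n i) (C i)) :=
  hA.insert_of_attached (h.mem i) (h.sub i) fun _ he _ ha haC hea => h.attached he ha haC hea

theorem touches_diff (h : G.IsCut y A n C) (hA : G.IsSide P y A) {i j : Fin 3} (hij : i ≠ j) :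
    G.Touches (A \ C i) (y j) := by
  obtain ⟨s, hs, hsj⟩ := hA.touches j
  refine ⟨s, ⟨hs, fun hsi => ?_⟩, hsj⟩
  rcases h.nbr j s hs hsj with h' | rfl
  · exact Set.disjoint_left.1 (h.disj i j hij) hsi h'
  · exact h.notMem j i hsi

/-- The part of `A` that belongs to no `C i` is connected, as each `C i` hangs on the vertex `n i` of
it. -/
theorem conn_middle (h : G.IsCut y A n C) (hA : G.ConnSet A) :
    G.ConnSet {a | a ∈ A ∧ ∀ i, a ∉ C i} := by
  have h1 := h.conn_diff hA 0
  have h2 : G.ConnSet ((A \ C 0) \ C 1) := h1.diff_of_attached ⟨h.mem 1, h.notMem 1 0⟩ (h.notMem 1 1)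
    fun _ he _ ha haC hea => h.attached he ha.1 haC hea
  have h3 : G.ConnSet (((A \ C 0) \ C 1) \ C 2) := h2.diff_of_attached
    ⟨⟨h.mem 2, h.notMem 2 0⟩, h.notMem 2 1⟩ (h.notMem 2 2)
    fun _ he _ ha haC hea => h.attached he ha.1.1 haC hea
  convert h3 using 1
  ext a
  simp only [Set.mem_sdiff, Fin.forall_fin_succ, Fin.forall_fin_zero]
  exact ⟨fun ⟨h1, h2, h3, h4, _⟩ => ⟨⟨⟨h1, h2⟩, h3⟩, h4⟩,
    fun ⟨⟨⟨h1, h2⟩, h3⟩, h4⟩ => ⟨h1, h2, h3, h4, trivial⟩⟩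

/-- Every vertex of `C i` is joined to `n i` through `C i`. -/
theorem exists_conn (h : G.IsCut y A n C) (hA : G.ConnSet A) {i : Fin 3} {u : V} (hu : u ∈ C i) :
    ∃ K ⊆ C i, G.ConnSet K ∧ u ∈ K ∧ G.Touches K (n i) := by
  have hne : u ≠ n i := fun e => h.notMem i i (e ▸ hu)
  have hu' : u ∈ insert (n i) (C i) \ {n i} := ⟨Or.inr hu, hne⟩
  exact ⟨_, fun z hz => (compIn_subset hz).1.resolve_left (compIn_subset hz).2, connSet_compIn hu',
    mem_compIn_self hu', (h.conn_insert hA i).touches_compIn (Or.inl rfl) (Or.inr hu) hne⟩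

end IsCut

/-- Cuts of the two sides of a partition such that `y i` together with the two parts cut off by `n i`
and `m i` has no neighbours in `G - P` besides `n i` and `m i`. -/
structure IsDoubleCut (G : SimpleGraph V) (P : Set V) (y : Fin 3 → V) (A B : Set V)
    (n m : Fin 3 → V) (C D : Fin 3 → Set V) : Prop where
  part : G.IsPartition P y A B
  cut_left : G.IsCut y A n C
  cut_right : G.IsCut y B m D
  left_right : ∀ i, ∀ u ∈ C i, ∀ w ∈ B, G.Adj u w → w ∈ D i ∨ w = m i
  right_left : ∀ i, ∀ w ∈ D i, ∀ u ∈ A, G.Adj w u → u ∈ C i ∨ u = n i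

namespace IsDoubleCut

theorem symm (h : G.IsDoubleCut P y A B n m C D) : G.IsDoubleCut P y B A m n D C :=
  ⟨h.part.symm, h.cut_right, h.cut_left, h.right_left, h.left_right⟩

/-- In `G - P`, the set `C i ∪ D i` has no neighbours besides `y i`, `n i` and `m i`. -/
theorem adj_cases (h : G.IsDoubleCut P y A B n m C D) {i : Fin 3} {u w : V} (hu : u ∈ C i ∪ D i)
    (huw : G.Adj u w) : w ∈ C i ∪ D i ∨ w ∈ P ∨ w = y i ∨ w = n i ∨ w = m i := by
  by_cases hwP : w ∈ P
  · exact Or.inr (Or.inl hwP)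
  by_cases hwy : ∃ j, w = y j
  · obtain ⟨j, rfl⟩ := hwy
    by_cases hij : i = j
    · exact Or.inr (Or.inr (Or.inl (hij ▸ rfl)))
    · exfalso
      rcases hu with hu | hu
      · rcases h.cut_left.nbr j u (h.cut_left.sub i hu) huw with h' | rfl
        · exact Set.disjoint_left.1 (h.cut_left.disj i j hij) hu h'
        · exact h.cut_left.notMem j i hu
      · rcases h.cut_right.nbr j u (h.cut_right.sub i hu) huw with h' | rfl
        · exact Set.disjoint_left.1 (h.cut_right.disj i j hij) hu h'
        · exact h.cut_right.notMem j i hu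
  · push Not at hwy
    rcases hu with hu | hu <;> rcases h.part.cover w hwP hwy with hw | hw
    · rcases h.cut_left.closed i u hu w hw huw with h' | h' <;> simp [h']
    · rcases h.left_right i u hu w hw huw with h' | h' <;> simp [h']
    · rcases h.right_left i u hu w hw huw with h' | h' <;> simp [h']
    · rcases h.cut_right.closed i u hu w hw huw with h' | h' <;> simp [h']

theorem notMem_path (h : G.IsDoubleCut P y A B n m C D) {i : Fin 3} {u : V} (hu : u ∈ C i ∪ D i) :
    u ∉ P :=
  hu.elim (fun hu => h.part.left.notMem_path u (h.cut_left.sub i hu))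
    fun hu => h.part.right.notMem_path u (h.cut_right.sub i hu)

theorem ne (h : G.IsDoubleCut P y A B n m C D) {i : Fin 3} {u : V} (hu : u ∈ C i ∪ D i)
    (j : Fin 3) : u ≠ y j :=
  hu.elim (fun hu => h.part.left.ne u (h.cut_left.sub i hu) j)
    fun hu => h.part.right.ne u (h.cut_right.sub i hu) j

theorem left_notMem (h : G.IsDoubleCut P y A B n m C D) (i : Fin 3) : n i ∉ C i ∪ D i := by
  rintro (h' | h')
  · exact h.cut_left.notMem i i h'
  · exact Set.disjoint_left.1 h.part.disj (h.cut_left.mem i) (h.cut_right.sub i h')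

/-- From a vertex of `C i ∪ D i` the path can be reached inside `C i ∪ D i` in spite of the deletion
of one vertex, since the four vertices `c`, `y i`, `n i`, `m i` do not separate `G`. -/
theorem exists_conn_to_path (H : G.IsDoubleCut P y A B n m C D) (h : G.Config P x₁ x₂ y)
    {i : Fin 3} {s c : V} (hs : s ∈ C i ∪ D i) (hsc : s ≠ c) :
    ∃ K, G.ConnSet K ∧ K ⊆ C i ∪ D i ∪ P ∧ s ∈ K ∧ c ∉ K ∧ (K ∩ P).Nonempty := by
  classical
  have hs' : s ∈ (C i ∪ D i) \ {c} := ⟨hs, hsc⟩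
  set W := G.compIn ((C i ∪ D i) \ {c}) s
  have hW : G.ConnSet W := connSet_compIn hs'
  have hWi : W ⊆ (C i ∪ D i) \ {c} := compIn_subset
  have hsW : s ∈ W := mem_compIn_self hs'
  obtain ⟨p, hpP, hpc, w, hw, hwp⟩ : ∃ p ∈ P, p ≠ c ∧ G.Touches W p := by
    by_contra! hno
    obtain ⟨j, k, hij, hik, hjk⟩ : ∃ j k, i ≠ j ∧ i ≠ k ∧ j ≠ k := by
      clear * -
      revert i
      decide
    -- A vertex `y j` different from `c` is not in `W` and none of the four separating vertices.
    obtain ⟨l, hil, hlc⟩ : ∃ l, i ≠ l ∧ y l ≠ c := by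
      by_cases hjc : y j = c
      · exact ⟨k, hik, fun e => hjk (h.inj (hjc.trans e.symm))⟩
      · exact ⟨j, hij, hjc⟩
    have hil' := h.inj.ne hil
    have hny := H.part.left.ne _ (H.cut_left.mem i) l
    have hmy := H.part.right.ne _ (H.cut_right.mem i) l
    refine h.false_of_closed_five (U := W) (X := {c, y i, n i, m i}) Finset.card_le_four ?_ hsW ?_
      (t := y l) (fun hl => H.ne (hWi hl).1 l rfl) ?_
    · intro u hu w huw
      by_cases hwc : w = c
      · simp [hwc]
      rcases H.adj_cases (hWi hu).1 huw with h' | h' | h' | h' | h'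
      · exact Or.inl (compIn_closed hu ⟨h', hwc⟩ huw)
      · exact absurd ⟨u, hu, huw⟩ (hno w h' hwc)
      all_goals simp [h']
    · have h1 := H.ne hs i
      have h2 : s ≠ n i := fun e => H.left_notMem i (e ▸ hs)
      have h3 : s ≠ m i := fun e => H.symm.left_notMem i (Set.union_comm _ _ ▸ e ▸ hs)
      simp [hsc, h1, h2, h3]
    · simp [hlc, hil'.symm, hny.symm, hmy.symm]
  refine ⟨insert p W, hW.insert ⟨w, hw, hwp⟩, Set.insert_subset (Or.inr hpP)
    fun z hz => Or.inl (hWi hz).1, Or.inr hsW, ?_, p, Or.inl rfl, hpP⟩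
  rintro (hc | hc)
  · exact hpc hc.symm
  · exact (hWi hc).2 rfl

/-- The part `C i` is connected if `n i` has only one neighbour in it. -/
theorem conn_left (H : G.IsDoubleCut P y A B n m C D) {i : Fin 3} {c : V} (hc : c ∈ C i)
    (huniq : ∀ s ∈ C i ∪ D i, G.Adj s (n i) → s = c) : G.ConnSet (C i) := by
  have := (H.cut_left.conn_insert H.part.left.conn i).diff_of_attached (E := {n i}) (n := c)
    (Or.inr hc) (fun e => H.cut_left.notMem i i (e ▸ hc)) ?_
  · rwa [Set.insert_sdiff_self_of_notMem (H.cut_left.notMem i i)] at this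
  · rintro e rfl a (rfl | ha) hae hadj
    · exact absurd rfl hae
    · exact huniq a (Or.inl ha) hadj.symm

variable [Finite V]

/-- A set closed in `C i ∪ D i` is attached to `m i`. Otherwise it would be attached to `y i`, `n i`
and the path only, which is excluded by `Config.false_of_attached`. -/
theorem touches_right (H : G.IsDoubleCut P y A B n m C D) (h : G.Config P x₁ x₂ y) {i : Fin 3}
    {U : Set V} (hU : G.ConnSet U) (hUi : U ⊆ C i ∪ D i)
    (hcl : ∀ u ∈ U, ∀ w ∈ C i ∪ D i, G.Adj u w → w ∈ U) : G.Touches U (m i) := by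
  by_contra hUm
  have hall : ∀ {u K}, u ∈ U → u ∈ K → G.ConnSet K → K ⊆ C i ∪ D i → K ⊆ U := by
    intro u K hu huK hK hKi w hw
    by_contra hwU
    obtain ⟨c, -, hcU, d, hdK, hdU, hcd⟩ := hK.exists_boundary (T := U) huK hu hw hwU
    exact hdU (hcl c hcU d (hKi hdK) hcd)
  have hUC : ∀ u ∈ U, u ∈ C i := by
    intro u hu
    refine (hUi hu).resolve_right fun huD => ?_
    obtain ⟨K, hKD, hK, huK, hKm⟩ := H.cut_right.exists_conn H.part.right.conn huD
    exact hUm (hKm.mono (hall hu huK hK (hKD.trans Set.subset_union_right)))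
  obtain ⟨u, hu⟩ := hU.1
  have hUn : G.Touches U (n i) := by
    obtain ⟨K, hKC, hK, huK, hKn⟩ := H.cut_left.exists_conn H.part.left.conn (hUC u hu)
    exact hKn.mono (hall hu huK hK (hKC.trans Set.subset_union_left))
  have hN : ∀ u ∈ U, ∀ w, G.Adj u w → w ∈ U ∨ w ∈ P ∨ w = y i ∨ w = n i := by
    intro u hu w huw
    rcases H.adj_cases (hUi hu) huw with h' | h' | h' | h' | rfl
    · exact Or.inl (hcl u hu w h' huw)
    · exact Or.inr (Or.inl h')
    · exact Or.inr (Or.inr (Or.inl h'))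
    · exact Or.inr (Or.inr (Or.inr h'))
    · exact absurd ⟨u, hu, huw⟩ hUm
  have hyU : ∀ j, y j ∉ U := fun j hj => H.ne (hUi hj) j rfl
  have hUy : G.Touches U (y i) := by
    by_contra hUy
    refine h.false_of_closed_two (U := U) (c := n i) (fun u hu w hw huw => ?_) hu
      (H.notMem_path (hUi hu)) (fun e => H.left_notMem i (e ▸ hUi hu)) (hyU i) (h.notMem i)
      (fun e => H.part.left.ne _ (H.cut_left.mem i) i e.symm)
    rcases hN u hu w huw with h' | h' | rfl | h'
    · exact Or.inl h'
    · exact absurd h' hw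
    · exact absurd ⟨u, hu, huw⟩ hUy
    · exact Or.inr h'
  obtain ⟨j, k, hij, hik, hjk⟩ : ∃ j k, i ≠ j ∧ i ≠ k ∧ j ≠ k := by
    clear * -
    revert i
    decide
  have hyij := h.inj.ne hij
  have hyik := h.inj.ne hik
  have hyjk := h.inj.ne hjk
  have hyA := H.part.left.notMem
  have hyB := H.part.right.notMem
  have hAB := Set.disjoint_left.1 H.part.disj
  have hCA : ∀ z ∈ C i, z ∈ A := fun z hz => H.cut_left.sub i hz
  refine h.false_of_attached (i := i) (j := j) (k := k) hU hyU (h.notMem i) hUy hUn (R := {y i})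
    (S := insert (y j) (A \ C i)) (T := B) (fun u hu w huw => ?_) (connSet_singleton _)
    ((H.cut_left.conn_diff H.part.left.conn i).insert (H.cut_left.touches_diff H.part.left hij))
    H.part.right.conn rfl (Or.inr ⟨H.cut_left.mem i, H.cut_left.notMem i i⟩) rfl (Or.inl rfl)
    (H.part.right.touches i) (H.part.right.touches j) ?_ ?_
  · rcases hN u hu w huw with h' | h' | h' | h' <;> simp [h']
  · rintro w (((rfl | rfl | hw) | hw) | hw)
    · exact h.notMem i
    · exact h.notMem j
    · exact H.part.left.notMem_path w hw.1
    · exact H.part.right.notMem_path w hw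
    · exact H.notMem_path (hUi hw)
  · simp only [List.pairwise_cons, List.mem_cons, List.not_mem_nil, or_false, Set.disjoint_left,
      forall_eq_or_imp, forall_eq, Set.mem_singleton_iff, List.Pairwise.nil, and_true,
      Set.mem_insert_iff, Set.mem_sdiff]
    and_intros <;> grind

/-- The neighbours of `y i` are `x₁`, `x₂`, and possibly `n i`, `m i` and vertices of
`C i ∪ D i`. -/
theorem adj_cases_center (H : G.IsDoubleCut P y A B n m C D) (h : G.Config P x₁ x₂ y) {i : Fin 3}
    {w : V} (hw : G.Adj (y i) w) :
    w ∈ C i ∪ D i ∨ w = x₁ ∨ w = x₂ ∨ w = n i ∨ w = m i := by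
  by_cases hwP : w ∈ P
  · by_contra! hne
    exact h.not_adj_inner H.part hwP hne.2.1 hne.2.2.1 i hw.symm
  by_cases hwy : ∃ j, w = y j
  · obtain ⟨j, rfl⟩ := hwy
    by_cases hij : i = j
    · subst hij
      exact absurd rfl hw.ne
    · exact absurd hw (h.not_adj hij)
  · push Not at hwy
    rcases H.part.cover w hwP hwy with hwA | hwB
    · rcases H.cut_left.nbr i w hwA hw.symm with h' | h' <;> simp [h']
    · rcases H.cut_right.nbr i w hwB hw.symm with h' | h' <;> simp [h']

/-- The vertex `y i` is not adjacent to `n i`. Otherwise a part of `C i ∪ D i` attached to `y i` and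
`m i` would be excluded by `Config.false_of_attached`. -/
theorem not_adj_left (H : G.IsDoubleCut P y A B n m C D) (h : G.Config P x₁ x₂ y) (i : Fin 3) :
    ¬ G.Adj (y i) (n i) := by
  classical
  intro hyn
  obtain ⟨j, k, hij, hik, hjk⟩ : ∃ j k, i ≠ j ∧ i ≠ k ∧ j ≠ k := by
    clear * -
    revert i
    decide
  have hyij := h.inj.ne hij
  have hyik := h.inj.ne hik
  have hyjk := h.inj.ne hjk
  have hny := H.part.left.ne _ (H.cut_left.mem i)
  have hmy := H.part.right.ne _ (H.cut_right.mem i)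
  obtain ⟨u, hu, huy⟩ : ∃ u ∈ C i ∪ D i, G.Adj u (y i) := by
    by_contra! hno
    have h1 := h.ne₁
    have h2 := h.ne₂
    refine h.false_of_closed_five (U := {y i}) (X := {x₁, x₂, n i, m i}) Finset.card_le_four
      ?_ rfl ?_ (t := y j) ?_ ?_
    · rintro u rfl w huw
      rcases H.adj_cases_center h huw with h' | h' | h' | h' | h'
      · exact absurd huw.symm (hno w h')
      all_goals simp [h']
    · simp [(h1 i).symm, (h2 i).symm, (hny i).symm, (hmy i).symm]
    · exact hyij.symm
    · simp [(h1 j).symm, (h2 j).symm, (hny j).symm, (hmy j).symm]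
  have hU : G.ConnSet (G.compIn (C i ∪ D i) u) := connSet_compIn hu
  have hUi : G.compIn (C i ∪ D i) u ⊆ C i ∪ D i := compIn_subset
  have huU := mem_compIn_self (G := G) hu
  have hUm := H.touches_right h hU hUi fun u hu w hw huw => compIn_closed hu hw huw
  have hcl : ∀ u' ∈ G.compIn (C i ∪ D i) u, ∀ w ∈ C i ∪ D i, G.Adj u' w →
      w ∈ G.compIn (C i ∪ D i) u := fun u' hu' w hw huw => compIn_closed hu' hw huw
  generalize G.compIn (C i ∪ D i) u = U at *
  have hyU : ∀ j, y j ∉ U := fun j hj => H.ne (hUi hj) j rfl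
  have hyA := H.part.left.notMem
  have hyB := H.part.right.notMem
  have hAB := Set.disjoint_left.1 H.part.disj
  have hCA : ∀ z ∈ C i, z ∈ A := fun z hz => H.cut_left.sub i hz
  have hDB : ∀ z ∈ D i, z ∈ B := fun z hz => H.cut_right.sub i hz
  have hUi' : ∀ z ∈ U, z ∈ C i ∨ z ∈ D i := fun z hz => hUi hz
  refine h.false_of_attached (i := i) (j := j) (k := k) (a := y i) (b := m i) (c := n i) hU hyU
    (H.part.left.notMem_path _ (H.cut_left.mem i)) ⟨u, huU, huy⟩ hUm (R := {y i})
    (S := insert (y j) (B \ D i)) (T := A \ C i) (fun u hu w huw => ?_) (connSet_singleton _)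
    ((H.cut_right.conn_diff H.part.right.conn i).insert (H.cut_right.touches_diff H.part.right hij))
    (H.cut_left.conn_diff H.part.left.conn i) rfl
    (Or.inr ⟨H.cut_right.mem i, H.cut_right.notMem i i⟩) rfl (Or.inl rfl)
    ⟨n i, ⟨H.cut_left.mem i, H.cut_left.notMem i i⟩, hyn.symm⟩
    (H.cut_left.touches_diff H.part.left hij) ?_ ?_
  · rcases H.adj_cases (hUi hu) huw with h' | h' | h' | h' | h'
    · exact Or.inl (hcl u hu w h' huw)
    all_goals simp [h']
  · rintro w (((rfl | rfl | hw) | hw) | hw)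
    · exact h.notMem i
    · exact h.notMem j
    · exact H.part.right.notMem_path w hw.1
    · exact H.part.left.notMem_path w hw.1
    · exact H.notMem_path (hUi hw)
  · simp only [List.pairwise_cons, List.mem_cons, List.not_mem_nil, or_false, Set.disjoint_left,
      forall_eq_or_imp, forall_eq, Set.mem_singleton_iff, List.Pairwise.nil, and_true,
      Set.mem_insert_iff, Set.mem_sdiff]
    and_intros <;> grind

/-- If there are disjoint ways from `n i` to the other two `y j` inside `A`, and if these are
connected by a set `T` on the other side, then some vertex `c` separates `n i` from the path in
`C i ∪ D i` together with `Q`: two disjoint ways to the path would contradict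
`Config.false_of_center`. -/
theorem exists_separator (H : G.IsDoubleCut P y A B n m C D) (h : G.Config P x₁ x₂ y)
    {i j k : Fin 3} (hij : i ≠ j) (hik : i ≠ k) (hjk : j ≠ k) {R S T Q : Set V}
    (hRS : Disjoint R S)
    (hR : G.ConnSet R ∧ y j ∈ R ∧ R ⊆ insert (y j) ((A \ C i) \ {n i}) ∧ G.Touches R (n i))
    (hS : G.ConnSet S ∧ y k ∈ S ∧ S ⊆ insert (y k) ((A \ C i) \ {n i}) ∧ G.Touches S (n i))
    (hQ : Q ⊆ B) (hT : G.ConnSet T) (hTB : T ⊆ (B \ D i) \ Q) (hTj : G.Touches T (y j))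
    (hTk : G.Touches T (y k)) :
    ∃ c, ∀ K, G.ConnSet K → K ⊆ C i ∪ D i ∪ P ∪ Q → c ∉ K → G.Touches K (n i) →
      ¬ (K ∩ P).Nonempty := by
  by_contra! hno
  obtain ⟨hR1, hR2, hR3, hR4⟩ := hR
  obtain ⟨hS1, hS2, hS3, hS4⟩ := hS
  have key : ∀ c, ∃ K, G.ConnSet K ∧ K ⊆ C i ∪ D i ∪ P ∪ Q ∧ c ∉ K ∧
      (K ∩ {w | G.Adj w (n i)}).Nonempty ∧ (K ∩ P).Nonempty := by
    intro c
    obtain ⟨K, h1, h2, h3, ⟨s, hs, hsn⟩, h5⟩ := hno c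
    exact ⟨K, h1, h2, h3, ⟨s, hs, hsn⟩, h5⟩
  obtain ⟨l, r, hlr, L, M, hLM, ⟨l1, l2, ⟨s, hs, hsn⟩, l4⟩, ⟨m1, m2, ⟨t, ht, htn⟩, m4⟩⟩ :=
    exists_two_linkage (by obtain ⟨K, h1, h2, -, h3⟩ := key x₁; exact ⟨K, h1, h2, h3⟩) key
  have hyij := h.inj.ne hij
  have hyik := h.inj.ne hik
  have hyjk := h.inj.ne hjk
  have hyA := H.part.left.notMem
  have hyB := H.part.right.notMem
  have hyP := h.notMem
  have hAB := Set.disjoint_left.1 H.part.disj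
  have hAP := H.part.left.notMem_path
  have hBP := H.part.right.notMem_path
  have hnA := H.cut_left.mem i
  have hnC := H.cut_left.notMem i i
  have hCA : ∀ z ∈ C i, z ∈ A := fun z hz => H.cut_left.sub i hz
  have hDB : ∀ z ∈ D i, z ∈ B := fun z hz => H.cut_right.sub i hz
  have hQB : ∀ z ∈ Q, z ∈ B := fun z hz => hQ hz
  have hR' : ∀ z ∈ R, z = y j ∨ ((z ∈ A ∧ z ∉ C i) ∧ z ≠ n i) := fun z hz => hR3 hz
  have hS' : ∀ z ∈ S, z = y k ∨ ((z ∈ A ∧ z ∉ C i) ∧ z ≠ n i) := fun z hz => hS3 hz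
  have hT' : ∀ z ∈ T, (z ∈ B ∧ z ∉ D i) ∧ z ∉ Q := fun z hz => hTB hz
  have hL' : ∀ z ∈ L, ((z ∈ C i ∨ z ∈ D i) ∨ z ∈ P) ∨ z ∈ Q := fun z hz => l2 hz
  have hM' : ∀ z ∈ M, ((z ∈ C i ∨ z ∈ D i) ∨ z ∈ P) ∨ z ∈ Q := fun z hz => m2 hz
  rw [Set.disjoint_left] at hRS hLM
  refine h.false_of_center (i := j) (j := k) (k := i) (v := n i) (hAP _ hnA) hR1 hS1 hT l1 m1 hR4
    hS4 ⟨s, hs, hsn⟩ ⟨t, ht, htn⟩ hR2 hS2 hTj hTk l4 m4 ?_ ?_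
  · rintro z ((hz | hz) | hz)
    · rcases hR' z hz with rfl | hz
      · exact hyP j
      · exact hAP z hz.1.1
    · rcases hS' z hz with rfl | hz
      · exact hyP k
      · exact hAP z hz.1.1
    · exact hBP z (hT' z hz).1.1
  · simp only [List.pairwise_cons, List.mem_cons, List.not_mem_nil, or_false, Set.disjoint_left,
      forall_eq_or_imp, forall_eq, Set.mem_singleton_iff, List.Pairwise.nil, and_true]
    clear l4 m4 hno key
    and_intros <;> grind

/-- The separating vertex of `exists_separator` is the only neighbour of `n i` in `C i ∪ D i`. -/
theorem eq_of_separator (H : G.IsDoubleCut P y A B n m C D) (h : G.Config P x₁ x₂ y) {i : Fin 3}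
    {c : V} {Q : Set V} (hc : ∀ K, G.ConnSet K → K ⊆ C i ∪ D i ∪ P ∪ Q → c ∉ K →
      G.Touches K (n i) → ¬ (K ∩ P).Nonempty) :
    c ∈ C i ∧ G.Adj c (n i) ∧ ∀ s ∈ C i ∪ D i, G.Adj s (n i) → s = c := by
  have huniq : ∀ s ∈ C i ∪ D i, G.Adj s (n i) → s = c := by
    intro s hs hsn
    by_contra hsc
    obtain ⟨K, h1, h2, h3, h4, h5⟩ := H.exists_conn_to_path h hs hsc
    exact hc K h1 (h2.trans Set.subset_union_left) h4 ⟨s, h3, hsn⟩ h5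
  obtain ⟨a, ha, hay⟩ := H.part.left.touches i
  have haC : a ∈ C i := (H.cut_left.nbr i a ha hay).resolve_right fun e =>
    H.not_adj_left h i (e ▸ hay.symm)
  obtain ⟨K, hKC, -, -, s, hs, hsn⟩ := H.cut_left.exists_conn H.part.left.conn haC
  have := huniq s (Or.inl (hKC hs)) hsn
  subst this
  exact ⟨hKC hs, hsn, huniq⟩

/-- If the separating vertex remains one when `m i` is taken into account, then `n i` and `m i` are
not adjacent. Otherwise it would separate `y i` from the other `y j` in `G - P`. -/
theorem not_adj_of_separator (H : G.IsDoubleCut P y A B n m C D) (h : G.Config P x₁ x₂ y)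
    {i : Fin 3} {c : V} (hc : ∀ K, G.ConnSet K → K ⊆ C i ∪ D i ∪ P ∪ {m i} → c ∉ K →
      G.Touches K (n i) → ¬ (K ∩ P).Nonempty) : ¬ G.Adj (n i) (m i) := by
  intro hnm
  obtain ⟨hcC, hcn, huniq⟩ := H.eq_of_separator h hc
  have hcm : c ≠ m i := fun e =>
    Set.disjoint_left.1 H.part.disj (H.cut_left.sub i hcC) (e ▸ H.cut_right.mem i)
  have huniq' : ∀ s ∈ C i ∪ D i, G.Adj s (m i) → s = c := by
    intro s hs hsm
    by_contra hsc
    obtain ⟨K, h1, h2, h3, h4, p, hp, hpP⟩ := H.exists_conn_to_path h hs hsc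
    refine hc (insert (m i) K) (h1.insert ⟨s, h3, hsm⟩) (Set.insert_subset (Or.inr rfl)
      (h2.trans Set.subset_union_left)) ?_ ⟨m i, Or.inl rfl, hnm.symm⟩ ⟨p, Or.inr hp, hpP⟩
    rintro (hc | hc)
    · exact hcm hc
    · exact h4 hc
  obtain ⟨j, hij⟩ : ∃ j, i ≠ j := by
    clear * -
    revert i
    decide
  have hCy := H.ne (Or.inl hcC : c ∈ C i ∪ D i)
  refine h.false_of_closed_two (U := insert (y i) (C i ∪ D i) \ {c}) (c := c) ?_
    (u := y i) ⟨Or.inl rfl, (hCy i).symm⟩ (h.notMem i) (hCy i).symm (t := y j) ?_ (h.notMem j)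
    (hCy j).symm
  · rintro u ⟨rfl | hu, huc⟩ w hw huw
    · rcases H.adj_cases_center h huw with h' | rfl | rfl | rfl | rfl
      · by_cases hwc : w = c
        · exact Or.inr hwc
        · exact Or.inl ⟨Or.inr h', hwc⟩
      · exact absurd h.mem₁ hw
      · exact absurd h.mem₂ hw
      · exact absurd huw (H.not_adj_left h i)
      · exact absurd huw (H.symm.not_adj_left h i)
    · by_cases hwc : w = c
      · exact Or.inr hwc
      rcases H.adj_cases hu huw with h' | h' | h' | rfl | rfl
      · exact Or.inl ⟨Or.inr h', hwc⟩
      · exact absurd h' hw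
      · exact Or.inl ⟨Or.inl h', hwc⟩
      · exact absurd (huniq u hu huw) huc
      · exact absurd (huniq' u hu huw) huc
  · rintro ⟨hj | hj, -⟩
    · exact hij (h.inj hj).symm
    · exact H.ne hj j rfl

/-- If every `n i` has only one neighbour `c i` in `C i ∪ D i`, then the middle part of `A` has
neighbours `c 0`, `c 1`, `c 2`, `z` and on the path only, and a fan from it is excluded by
`Config.false_of_fan`. -/
theorem false_of_middle (H : G.IsDoubleCut P y A B n m C D) (h : G.Config P x₁ x₂ y)
    {c : Fin 3 → V} {z : V} (hcC : ∀ i, c i ∈ C i) (hcn : ∀ i, G.Adj (c i) (n i))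
    (huniq : ∀ i, ∀ s ∈ C i ∪ D i, G.Adj s (n i) → s = c i) (hzB : z ∈ B ∨ z = c 0)
    (hz : ∀ u ∈ A, (∀ i, u ∉ C i) → ∀ w ∈ B, (∀ i, w ∉ D i) → G.Adj u w → w = z) : False := by
  classical
  set U : Set V := {a | a ∈ A ∧ ∀ i, a ∉ C i} with hUdef
  have hU : G.ConnSet U := H.cut_left.conn_middle H.part.left.conn
  have hAB := Set.disjoint_left.1 H.part.disj
  have hyP := h.notMem
  have hAP := H.part.left.notMem_path
  have hBP := H.part.right.notMem_path
  have hyA := H.part.left.notMem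
  have hyB := H.part.right.notMem
  have hCA : ∀ i, ∀ z ∈ C i, z ∈ A := fun i z hz => H.cut_left.sub i hz
  have hDB : ∀ i, ∀ z ∈ D i, z ∈ B := fun i z hz => H.cut_right.sub i hz
  have hCC : ∀ i j, i ≠ j → ∀ z ∈ C i, z ∉ C j := fun i j hij z hz =>
    Set.disjoint_left.1 (H.cut_left.disj i j hij) hz
  have hUP : ∀ u ∈ U, u ∉ P := fun u hu => hAP u hu.1
  have hUy : ∀ i, y i ∉ U := fun i hi => hyA i hi.1
  have hnU : ∀ i, n i ∈ U := fun i => ⟨H.cut_left.mem i, fun j => H.cut_left.notMem i j⟩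
  have hcU : ∀ i, c i ∉ U := fun i hi => hi.2 i (hcC i)
  have hzU : z ∉ U := by
    rcases hzB with hz | rfl
    · exact fun hzU => hAB hzU.1 hz
    · exact hcU 0
  have hN : ∀ u ∈ U, ∀ w, G.Adj u w → w ∈ U ∨ w ∈ P ∨ (∃ i, w = c i) ∨ w = z := by
    intro u hu w huw
    by_cases hwP : w ∈ P
    · exact Or.inr (Or.inl hwP)
    by_cases hwy : ∃ j, w = y j
    · obtain ⟨j, rfl⟩ := hwy
      rcases H.cut_left.nbr j u hu.1 huw with h' | rfl
      · exact absurd h' (hu.2 j)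
      · exact absurd huw.symm (H.not_adj_left h j)
    push Not at hwy
    rcases H.part.cover w hwP hwy with hw | hw
    · by_cases hwC : ∃ i, w ∈ C i
      · obtain ⟨i, hwi⟩ := hwC
        have := H.cut_left.attached hwi hu.1 (hu.2 i) huw.symm
        subst this
        exact Or.inr (Or.inr (Or.inl ⟨i, huniq i w (Or.inl hwi) huw.symm⟩))
      · push Not at hwC
        exact Or.inl ⟨hw, hwC⟩
    · by_cases hwD : ∃ i, w ∈ D i
      · obtain ⟨i, hwi⟩ := hwD
        rcases H.right_left i w hwi u hu.1 huw.symm with h' | rfl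
        · exact absurd h' (hu.2 i)
        · have := huniq i w (Or.inr hwi) huw.symm
          exact absurd hw (hAB (hCA i _ (this ▸ hcC i)))
      · push Not at hwD
        exact Or.inr (Or.inr (Or.inr (hz u hu.1 hu.2 w hw hwD huw)))
  have hN' : ∀ u ∈ U, ∀ w, G.Adj u w → w ∈ U ∨ w ∈ P ∨ w = c 0 ∨ w = c 1 ∨ w = c 2 ∨ w = z := by
    intro u hu w huw
    rcases hN u hu w huw with h' | h' | ⟨i, rfl⟩ | h'
    · exact Or.inl h'
    · exact Or.inr (Or.inl h')
    · fin_cases i <;> simp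
    · simp [h']
  obtain ⟨l, hlP, hUl⟩ : ∃ l ∈ P, G.Touches U l := by
    by_contra! hno
    have hX : ∀ t, t ∈ P ∨ t ∈ U → t ∉ ({c 0, c 1, c 2, z} : Finset V) := by
      intro t ht
      have hcP : ∀ i, c i ∉ P := fun i => hAP _ (hCA i _ (hcC i))
      have hzP : z ∉ P := by
        rcases hzB with hz | rfl
        · exact hBP z hz
        · exact hcP 0
      simp only [Finset.mem_insert, Finset.mem_singleton, not_or]
      grind
    refine h.false_of_closed_five (U := U) (X := {c 0, c 1, c 2, z}) Finset.card_le_four ?_ (hnU 0)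
      (hX _ (Or.inr (hnU 0))) (t := x₁) (fun hx => hUP _ hx h.mem₁) (hX _ (Or.inl h.mem₁))
    intro u hu w huw
    rcases hN' u hu w huw with h' | h' | h' | h' | h' | h'
    · exact Or.inl h'
    · exact absurd ⟨u, hu, huw⟩ (hno w h')
    all_goals simp [h']
  have hc01 : c 0 ≠ c 1 := fun e => hCC 0 1 (by decide) _ (hcC 0) (e ▸ hcC 1)
  have hcl : ∀ i, c i ≠ l := fun i e => hAP _ (hCA i _ (hcC i)) (e ▸ hlP)
  obtain ⟨v, X, Z, hZ, hX, h0X, h1X, hlX⟩ := hU.exists_fan_five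
    (fun X hX a ha b hb => ⟨_, h.conn_five X hX, ha, hb, fun c hc hc' => hc' hc⟩)
    (fun X hX => h.exists_notMem hUP hUy X hX) hc01 (hcl 0) (hcl 1) (hcU 0) (hcU 1)
    (fun hl => hUP l hl hlP) ⟨n 0, hnU 0, (hcn 0).symm⟩ ⟨n 1, hnU 1, (hcn 1).symm⟩ hUl
  have hy01 := h.inj.ne (show (0 : Fin 3) ≠ 1 by decide)
  have hy02 := h.inj.ne (show (0 : Fin 3) ≠ 2 by decide)
  have hy12 := h.inj.ne (show (1 : Fin 3) ≠ 2 by decide)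
  have hR : ∀ i, G.ConnSet (insert (y i) (C i)) := by
    intro i
    obtain ⟨a, ha, hay⟩ := H.part.left.touches i
    have haC : a ∈ C i := (H.cut_left.nbr i a ha hay).resolve_right fun e =>
      H.not_adj_left h i (e ▸ hay.symm)
    exact (H.conn_left (hcC i) (huniq i)).insert ⟨a, haC, hay⟩
  have hC01 := hCC 0 1 (by decide)
  have hC02 := hCC 0 2 (by decide)
  have hC12 := hCC 1 2 (by decide)
  have hU' : ∀ u ∈ U, u ∈ A ∧ u ∉ C 0 ∧ u ∉ C 1 ∧ u ∉ C 2 := fun u hu =>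
    ⟨hu.1, hu.2 0, hu.2 1, hu.2 2⟩
  by_cases hr : ∃ r ∈ X, r ∈ P ∧ r ≠ l
  · obtain ⟨r, hrX, hrP, hrl⟩ := hr
    refine h.false_of_fan (i := 0) (j := 1) (k := 2) (r := r) hZ h0X h1X hlX hrX (hR 0) (hR 1)
      H.part.right.conn (connSet_singleton r) (Or.inr (hcC 0)) (Or.inr (hcC 1)) rfl (Or.inl rfl)
      (Or.inl rfl) (H.part.right.touches 0) (H.part.right.touches 1) hlP (by simpa) hrl.symm ?_ ?_
    · rintro w ((((rfl | hw) | (rfl | hw)) | hw) | hw)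
      · exact hyP 0
      · exact hAP w (hCA 0 w hw)
      · exact hyP 1
      · exact hAP w (hCA 1 w hw)
      · exact hBP w hw
      · exact hUP w hw
    · simp only [List.pairwise_cons, List.mem_cons, List.not_mem_nil, or_false, Set.disjoint_left,
        forall_eq_or_imp, forall_eq, Set.mem_singleton_iff, Set.mem_insert_iff, List.Pairwise.nil,
        and_true]
      clear hN hN' hz hX hZ huniq
      and_intros <;> grind
  · push Not at hr
    -- All five ends are now known, and `c 2` is one of them.
    have hXsub : X ⊆ {c 0, c 1, c 2, z, l} := by
      intro t ht
      obtain ⟨u, hu, hut⟩ := hZ.touches_end ht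
      have := hZ.notMem t ht
      simp only [Finset.mem_insert, Finset.mem_singleton]
      rcases hN' u hu t hut with h' | h' | h' | h' | h' | h'
      · exact absurd h' this
      · simp [hr t ht h']
      all_goals simp [h']
    have h2X : c 2 ∈ X := by
      by_contra h2X
      have : X ⊆ {c 0, c 1, z, l} := by
        intro t ht
        have := hXsub ht
        simp only [Finset.mem_insert, Finset.mem_singleton] at this ⊢
        rcases this with h' | h' | h' | h' | h'
        · simp [h']
        · simp [h']
        · exact absurd (h' ▸ ht) h2X
        · simp [h']
        · simp [h']
      have := (Finset.card_le_card this).trans Finset.card_le_four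
      omega
    obtain ⟨K, hK, hKi, h2K, hlK, hKP⟩ := H.exists_conn_to_path h (i := 2) (Or.inl (hcC 2)) (hcl 2)
    obtain ⟨M, hMK, hM, h2M, r, hMr⟩ := hK.exists_trim h2K hKP
    have hlr : l ≠ r := by
      rintro rfl
      exact hlK (hMK (hMr.symm.subset rfl).1)
    have hM' : ∀ z ∈ M, (z ∈ C 2 ∨ z ∈ D 2) ∨ z ∈ P := fun z hz => hKi (hMK hz)
    refine h.false_of_fan (i := 0) (j := 1) (k := 2) (r := r) (T := B \ D 2) hZ h0X h1X hlX h2X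
      (hR 0) (hR 1) (H.cut_right.conn_diff H.part.right.conn 2) hM (Or.inr (hcC 0))
      (Or.inr (hcC 1)) h2M (Or.inl rfl) (Or.inl rfl)
      (H.cut_right.touches_diff H.part.right (by decide))
      (H.cut_right.touches_diff H.part.right (by decide)) hlP hMr hlr ?_ ?_
    · rintro w ((((rfl | hw) | (rfl | hw)) | hw) | hw)
      · exact hyP 0
      · exact hAP w (hCA 0 w hw)
      · exact hyP 1
      · exact hAP w (hCA 1 w hw)
      · exact hBP w hw.1
      · exact hUP w hw
    · have hA0 := hCA 0
      have hA1 := hCA 1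
      have hA2 := hCA 2
      have hB2 := hDB 2
      simp only [List.pairwise_cons, List.mem_cons, List.not_mem_nil, or_false, Set.disjoint_left,
        forall_eq_or_imp, forall_eq, Set.mem_singleton_iff, Set.mem_insert_iff, List.Pairwise.nil,
        and_true, Set.mem_sdiff]
      clear hN hN' hz hX hZ huniq hXsub hr hMr hKi hMK
      and_intros <;> grind

end IsDoubleCut

end DoubleCut

end SimpleGraph

namespace SimpleGraph

/-! ### Contradictions from double cuts -/

section Modes

variable {V : Type*} {G : SimpleGraph V} {P : Set V} {x₁ x₂ : V} {y : Fin 3 → V} {A B : Set V}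
  {n m : Fin 3 → V} {C D : Fin 3 → Set V}

/-- Every `n i` has disjoint ways to the other two `y j` in the part of `A` not cut off by it. -/
def HasLinks (G : SimpleGraph V) (y : Fin 3 → V) (A : Set V) (n : Fin 3 → V)
    (C : Fin 3 → Set V) : Prop :=
  ∀ i j k, i ≠ j → i ≠ k → j ≠ k → ∃ R S, Disjoint R S ∧
    (G.ConnSet R ∧ y j ∈ R ∧ R ⊆ insert (y j) ((A \ C i) \ {n i}) ∧ G.Touches R (n i)) ∧
    (G.ConnSet S ∧ y k ∈ S ∧ S ⊆ insert (y k) ((A \ C i) \ {n i}) ∧ G.Touches S (n i))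

variable [Finite V]

/-- The middle parts of the two sides cannot be connected through a single vertex `z` of `B`. -/
theorem IsDoubleCut.false_of_single (H : G.IsDoubleCut P y A B n m C D) (h : G.Config P x₁ x₂ y)
    (hl : G.HasLinks y A n C) {z : V} (hzB : z ∈ B)
    (hz : ∀ u ∈ A, (∀ i, u ∉ C i) → ∀ w ∈ B, (∀ i, w ∉ D i) → G.Adj u w → w = z) : False := by
  have hc : ∀ i, ∃ c, c ∈ C i ∧ G.Adj c (n i) ∧ ∀ s ∈ C i ∪ D i, G.Adj s (n i) → s = c := by
    intro i
    obtain ⟨j, k, hij, hik, hjk⟩ : ∃ j k, i ≠ j ∧ i ≠ k ∧ j ≠ k := by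
      clear * -
      revert i
      decide
    obtain ⟨R, S, hRS, hR, hS⟩ := hl i j k hij hik hjk
    obtain ⟨c, hc⟩ := H.exists_separator h hij hik hjk hRS hR hS (Set.empty_subset B)
      (H.cut_right.conn_diff H.part.right.conn i) (by simp)
      (H.cut_right.touches_diff H.part.right hij) (H.cut_right.touches_diff H.part.right hik)
    exact ⟨c, H.eq_of_separator h hc⟩
  choose c hcC hcn huniq using hc
  exact H.false_of_middle h hcC hcn huniq (Or.inl hzB) hz

/-- It is also impossible that the middle parts are connected only by edges between `n i` and
`m i`. -/
theorem IsDoubleCut.false_of_parallel (H : G.IsDoubleCut P y A B n m C D)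
    (h : G.Config P x₁ x₂ y) (hl : G.HasLinks y A n C)
    (hT : ∀ i, ∃ T ⊆ (B \ D i) \ {m i}, G.ConnSet T ∧ ∀ j, i ≠ j → G.Touches T (y j))
    (hz : ∀ u ∈ A, (∀ i, u ∉ C i) → ∀ w ∈ B, (∀ i, w ∉ D i) → G.Adj u w → ∃ i, u = n i ∧ w = m i) :
    False := by
  have hc : ∀ i, ∃ c, (c ∈ C i ∧ G.Adj c (n i) ∧ ∀ s ∈ C i ∪ D i, G.Adj s (n i) → s = c) ∧
      ¬ G.Adj (n i) (m i) := by
    intro i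
    obtain ⟨j, k, hij, hik, hjk⟩ : ∃ j k, i ≠ j ∧ i ≠ k ∧ j ≠ k := by
      clear * -
      revert i
      decide
    obtain ⟨R, S, hRS, hR, hS⟩ := hl i j k hij hik hjk
    obtain ⟨T, hTB, hT, hTy⟩ := hT i
    obtain ⟨c, hc⟩ := H.exists_separator h hij hik hjk hRS hR hS
      (Set.singleton_subset_iff.2 (H.cut_right.mem i)) hT hTB (hTy j hij) (hTy k hik)
    exact ⟨c, H.eq_of_separator h hc, H.not_adj_of_separator h hc⟩
  choose c hc hnm using hc
  refine H.false_of_middle h (fun i => (hc i).1) (fun i => (hc i).2.1) (fun i => (hc i).2.2)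
    (Or.inr rfl) fun u hu huC w hw hwD huw => ?_
  obtain ⟨i, rfl, rfl⟩ := hz u hu huC w hw hwD huw
  exact absurd huw (hnm i)

/-- A side without a star centre is cut by its gates. The vertices of `C i` and `n i` can be linked
to `y i`, every other vertex can be linked to some other `y p`. -/
theorem Config.exists_cut (h : G.Config P x₁ x₂ y) (hA : G.IsSide P y A) (hB : G.IsSide P y B)
    (hd : Disjoint A B) (hns : ∀ t, ¬ G.IsStarCenter y A t) :
    ∃ n C, G.IsCut y A n C ∧ G.HasLinks y A n C ∧
      (∀ i, ∃ T ⊆ (A \ C i) \ {n i}, G.ConnSet T ∧ ∀ j, i ≠ j → G.Touches T (y j)) ∧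
      (∀ i a, a ∈ C i ∨ a = n i → G.LinkedIn y A a i) ∧
      ∀ a ∈ A, ∀ q, (∀ p, G.LinkedIn y A a p → p = q) → a ∈ C q ∨ a = n q := by
  have hgate : ∀ i, ∃ n, G.IsGate y A i n := fun i => exists_isGate (h.exists_isSep hA hB hd i)
  choose n hn using hgate
  have hfarA : ∀ i, G.farSide y A i (n i) ⊆ A \ {n i} := fun i => farSide_subset
  have hZ : ∀ i, ∃ Z ⊆ G.farSide y A i (n i), G.ConnSet Z ∧ ∀ j, i ≠ j → G.Touches Z (y j) := by
    intro i
    have := hns (n i)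
    simp only [IsStarCenter, not_and, not_forall] at this
    obtain ⟨Z, hZA, hZ, p, q, hp, hq, hpq⟩ := this (hn i).1.1
    have hpi : p ≠ i := by
      rintro rfl
      exact (hn p).1.2 Z hZA hZ hp q (Ne.symm hpq) hq
    have hqi : q ≠ i := by
      rintro rfl
      exact (hn q).1.2 Z hZA hZ hq p hpq hp
    refine ⟨Z, hZ.subset_farSide hZA hpi hp, hZ, fun j hj => ?_⟩
    have : j = p ∨ j = q := by
      clear * - hpi hqi hpq hj
      revert i j p q
      decide
    rcases this with rfl | rfl <;> assumption
  choose Z hZfar hZ hZy using hZ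
  have hnfar : ∀ i j, i ≠ j → n j ∈ G.farSide y A i (n i) := by
    intro i j hij
    obtain ⟨k, hik, hjk⟩ : ∃ k, i ≠ k ∧ k ≠ j := by
      clear * -
      revert i j
      decide
    by_contra hnj
    exact (hn j).1.2 (Z i) (fun z hz => ⟨(hfarA i (hZfar i hz)).1, fun e => hnj (e ▸ hZfar i hz)⟩)
      (hZ i) (hZy i j hij) k hjk (hZy i k hik)
  have hnear : ∀ i j, i ≠ j → A \ G.farSide y A i (n i) ⊆ G.farSide y A j (n j) := by
    intro i j hij
    refine ((hn i).1.connSet_near hA.conn).subset_farSide (fun z hz => ⟨hz.1, fun e => hz.2 ?_⟩) hij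
      ((hn i).1.touches_near hA)
    rw [show z = n j from e]
    exact hnfar i j hij
  refine ⟨n, fun i => (A \ G.farSide y A i (n i)) \ {n i}, ⟨fun i z hz => hz.1.1, fun i => (hn i).1.1,
    fun i j => ?_, fun i j hij => ?_, fun i a ha b hb hab => ?_, fun i a ha hay => ?_⟩, ?_, ?_, ?_, ?_⟩
  · rintro ⟨⟨h1, h2⟩, h3⟩
    by_cases hij : j = i
    · exact h3 (hij ▸ rfl)
    · exact h2 (hnfar j i hij)
  · exact Set.disjoint_left.2 fun z hz hz' => hz'.1.2 (hnear i j hij hz.1)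
  · by_cases hbn : b = n i
    · exact Or.inr hbn
    · exact Or.inl ⟨⟨hb, fun hb' => ha.1.2 (farSide_closed hb' ha.1.1 ha.2 hab.symm)⟩, hbn⟩
  · by_cases han : a = n i
    · exact Or.inr han
    · exact Or.inl ⟨⟨ha, (hn i).1.notMem_farSide hay⟩, han⟩
  · intro i j k hij hik hjk
    obtain ⟨R, S, hRS, ⟨r1, r2, r3, r4⟩, ⟨s1, s2, s3, s4⟩⟩ :=
      (hn i).exists_links hA h.inj hij.symm hik.symm hjk
    have hsub : G.farSide y A i (n i) ⊆ (A \ ((A \ G.farSide y A i (n i)) \ {n i})) \ {n i} :=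
      fun z hz => ⟨⟨(hfarA i hz).1, fun h => h.1.2 hz⟩, (hfarA i hz).2⟩
    exact ⟨R, S, hRS, ⟨r1, r2, r3.trans (Set.insert_subset_insert hsub), r4⟩,
      ⟨s1, s2, s3.trans (Set.insert_subset_insert hsub), s4⟩⟩
  · exact fun i => ⟨Z i, fun z hz => ⟨⟨(hfarA i (hZfar i hz)).1, fun h => h.1.2 (hZfar i hz)⟩,
      (hfarA i (hZfar i hz)).2⟩, hZ i, hZy i⟩
  · intro i a ha
    obtain ⟨j, k, hij, hik, hjk, hall⟩ : ∃ j k, i ≠ j ∧ i ≠ k ∧ j ≠ k ∧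
        ∀ m, m ≠ i → m = j ∨ m = k := by
      clear * -
      revert i
      decide
    have haf : a ∈ A \ G.farSide y A i (n i) := by
      rcases ha with ha | rfl
      · exact ha.1
      · exact ⟨(hn i).1.1, fun h => (hfarA i h).2 rfl⟩
    refine ⟨insert (y i) (A \ G.farSide y A i (n i)), insert (y j) (insert (y k) (Z i)), ?_,
      ((hn i).1.connSet_near hA.conn).insert ((hn i).1.touches_near hA),
      ((hZ i).insert (hZy i k hik)).insert ((hZy i j hij).mono (Set.subset_insert _ _)),
      Set.insert_subset_insert fun z hz => hz.1, ?_, Or.inr haf, Or.inl rfl, fun m hm => ?_⟩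
    · rw [Set.disjoint_left]
      have h1 := h.inj.ne hij
      have h2 := h.inj.ne hik
      have h3 := hA.notMem
      rintro z (hz | hz) (hz' | hz' | hz')
      · exact h1 (hz.symm.trans hz')
      · exact h2 (hz.symm.trans hz')
      · exact h3 i (hz ▸ (hfarA i (hZfar i hz')).1)
      · exact h3 j (hz' ▸ hz.1)
      · exact h3 k (hz' ▸ hz.1)
      · exact hz.2 (hZfar i hz')
    · rintro z (rfl | rfl | hz)
      · exact Or.inr ⟨j, hij.symm, rfl⟩
      · exact Or.inr ⟨k, hik.symm, rfl⟩
      · exact Or.inl (hfarA i (hZfar i hz)).1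
    · rcases hall m hm with rfl | rfl
      · exact Or.inl rfl
      · exact Or.inr (Or.inl rfl)
  · intro a ha q hq
    by_cases haf : a ∈ G.farSide y A q (n q)
    · obtain ⟨p, hp, hl⟩ := (hn q).linkedIn_of_mem_farSide hA h.inj haf
      exact absurd (hq p hl) hp
    · by_cases han : a = n q
      · exact Or.inr han
      · exact Or.inl ⟨⟨ha, haf⟩, han⟩

/-- At least one of the two sides has a star centre. -/
theorem Config.false_of_not_isStarCenter (h : G.Config P x₁ x₂ y) (hAB : G.IsPartition P y A B)
    (hnsA : ∀ t, ¬ G.IsStarCenter y A t) (hnsB : ∀ t, ¬ G.IsStarCenter y B t) : False := by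
  obtain ⟨n, C, hC, hCl, -, hC1, hC2⟩ := h.exists_cut hAB.left hAB.right hAB.disj hnsA
  obtain ⟨m, D, hD, -, hDT, hD1, hD2⟩ := h.exists_cut hAB.right hAB.left hAB.disj.symm hnsB
  have hcon : ∀ u ∈ A, ∀ w ∈ B, G.Adj u w → ∃ i, (u ∈ C i ∨ u = n i) ∧ (w ∈ D i ∨ w = m i) := by
    intro u hu w hw huw
    have heq : ∀ {p q}, G.LinkedIn y A u p → G.LinkedIn y B w q → p = q :=
      fun hp hq => h.eq_of_linkedIn hAB.left hAB.right hAB.disj huw hp hq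
    obtain ⟨q, hq⟩ : ∃ q, G.LinkedIn y B w q := by
      by_contra! hno
      exact hno 0 (hD1 0 w (hD2 w hw 0 fun p hp => absurd hp (hno p)))
    have hu' := hC2 u hu q fun p hp => heq hp hq
    exact ⟨q, hu', hD2 w hw q fun p hp => (heq (hC1 q u hu') hp).symm⟩
  have huniq : ∀ {A : Set V} {n : Fin 3 → V} {C : Fin 3 → Set V}, G.IsCut y A n C →
      ∀ {i j u}, u ∈ C i → (u ∈ C j ∨ u = n j) → j = i := by
    rintro A n C hC i j u hu (hu' | rfl)
    · by_contra hij
      exact Set.disjoint_left.1 (hC.disj j i hij) hu' hu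
    · exact absurd hu (hC.notMem j i)
  have H : G.IsDoubleCut P y A B n m C D := by
    refine ⟨hAB, hC, hD, fun i u hu w hw huw => ?_, fun i w hw u hu hwu => ?_⟩
    · obtain ⟨q, hq1, hq2⟩ := hcon u (hC.sub i hu) w hw huw
      rwa [huniq hC hu hq1] at hq2
    · obtain ⟨q, hq1, hq2⟩ := hcon u hu w (hD.sub i hw) hwu.symm
      rwa [huniq hD hw hq2] at hq1
  refine H.false_of_parallel h hCl hDT fun u hu huC w hw hwD huw => ?_
  obtain ⟨i, hi1, hi2⟩ := hcon u hu w hw huw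
  exact ⟨i, hi1.resolve_left (huC i), hi2.resolve_left (hwD i)⟩

end Modes

/-! ### Star-shaped sides -/

section Star

variable {V : Type*} {G : SimpleGraph V} {P : Set V} {x₁ x₂ : V} {y : Fin 3 → V} {A B : Set V}
  {s t : V}

/-- The part of `A - t` that is connected to `y i`. -/
def starPart (G : SimpleGraph V) (y : Fin 3 → V) (A : Set V) (t : V) (i : Fin 3) : Set V :=
  {a | ∃ Z ⊆ A \ {t}, G.ConnSet Z ∧ a ∈ Z ∧ G.Touches Z (y i)}

theorem starPart_subset {i : Fin 3} : G.starPart y A t i ⊆ A \ {t} :=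
  fun _ ⟨_, hZ, _, ha, _⟩ => hZ ha

theorem starPart_mono (hAB : A ⊆ B) {i : Fin 3} : G.starPart y A t i ⊆ G.starPart y B t i :=
  fun _ ⟨Z, hZ, h⟩ => ⟨Z, fun _ hz => ⟨hAB (hZ hz).1, (hZ hz).2⟩, h⟩

theorem starPart_closed {i : Fin 3} {a b : V} (ha : a ∈ G.starPart y A t i) (hb : b ∈ A)
    (hbt : b ≠ t) (hab : G.Adj a b) : b ∈ G.starPart y A t i := by
  obtain ⟨Z, hZ, hZc, haZ, hZi⟩ := ha
  exact ⟨insert b Z, Set.insert_subset ⟨hb, hbt⟩ hZ, hZc.insert ⟨a, haZ, hab⟩, Or.inl rfl,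
    hZi.mono (Set.subset_insert _ _)⟩

theorem mem_starPart_of_adj {i : Fin 3} {a : V} (ha : a ∈ A) (hat : a ≠ t) (hai : G.Adj a (y i)) :
    a ∈ G.starPart y A t i :=
  ⟨{a}, Set.singleton_subset_iff.2 ⟨ha, hat⟩, connSet_singleton a, rfl, a, rfl, hai⟩

theorem IsStarCenter.eq_of_mem (ht : G.IsStarCenter y A t) {i j : Fin 3} {a : V}
    (hi : a ∈ G.starPart y A t i) (hj : a ∈ G.starPart y A t j) : i = j := by
  obtain ⟨Z, hZ, hZc, haZ, hZi⟩ := hi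
  obtain ⟨Z', hZ', hZc', haZ', hZj⟩ := hj
  exact ht.2 (Z ∪ Z') (Set.union_subset hZ hZ') (hZc.union_of_mem hZc' haZ haZ') i j
    (hZi.mono Set.subset_union_left) (hZj.mono Set.subset_union_right)

theorem IsStarCenter.isCut (ht : G.IsStarCenter y A t) :
    G.IsCut y A (fun _ => t) (G.starPart y A t) := by
  refine ⟨fun i z hz => (starPart_subset hz).1, fun _ => ht.1, fun i j h => (starPart_subset h).2 rfl,
    fun i j hij => Set.disjoint_left.2 fun z hz hz' => hij (ht.eq_of_mem hz hz'),
    fun i a ha b hb hab => ?_, fun i a ha hai => ?_⟩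
  · by_cases hbt : b = t
    · exact Or.inr hbt
    · exact Or.inl (starPart_closed ha hb hbt hab)
  · by_cases hat : a = t
    · exact Or.inr hat
    · exact Or.inl (mem_starPart_of_adj ha hat hai)

/-- The centre of a star is joined to `y i` through the part belonging to `y i`. -/
theorem IsStarCenter.exists_way (ht : G.IsStarCenter y A t) (hA : G.IsSide P y A) (i : Fin 3) :
    ∃ R, G.ConnSet R ∧ y i ∈ R ∧ R ⊆ insert (y i) (G.starPart y A t i) ∧ G.Touches R t := by
  obtain ⟨a, ha, hai⟩ := hA.touches i
  by_cases hat : a = t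
  · exact ⟨{y i}, connSet_singleton _, rfl, by simp, y i, rfl, hat ▸ hai.symm⟩
  · obtain ⟨K, hK, hKc, haK, hKt⟩ := ht.isCut.exists_conn hA.conn (mem_starPart_of_adj ha hat hai)
    exact ⟨insert (y i) K, hKc.insert ⟨a, haK, hai⟩, Or.inl rfl, Set.insert_subset_insert hK,
      hKt.mono (Set.subset_insert _ _)⟩

theorem IsStarCenter.linkedIn (ht : G.IsStarCenter y A t) (hA : G.IsSide P y A)
    (hy : Function.Injective y) {i : Fin 3} {a : V} (ha : a ∈ G.starPart y A t i) :
    G.LinkedIn y A a i := by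
  obtain ⟨j, k, hij, hik, hjk, hall⟩ : ∃ j k, i ≠ j ∧ i ≠ k ∧ j ≠ k ∧
      ∀ m, m ≠ i → m = j ∨ m = k := by
    clear * -
    revert i
    decide
  have hyij := hy.ne hij
  have hyik := hy.ne hik
  have hyA := hA.notMem
  have haA : a ∈ A \ {t} := starPart_subset ha
  have hK : G.ConnSet (G.compIn (A \ {t}) a) := connSet_compIn haA
  have haK := mem_compIn_self (G := G) haA
  have hKA : G.compIn (A \ {t}) a ⊆ A \ {t} := compIn_subset
  have hKi : G.Touches (G.compIn (A \ {t}) a) (y i) := by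
    obtain ⟨Z, hZ, hZc, haZ, hZi⟩ := ha
    exact hZi.mono (hZc.subset_compIn hZ haZ)
  have hR : G.ConnSet (A \ G.compIn (A \ {t}) a) :=
    hA.conn.diff_of_attached ht.1 (fun h => (hKA h).2 rfl) fun e he b hb hbK heb => by
      by_contra hbt
      exact hbK (compIn_closed he ⟨hb, hbt⟩ heb)
  have hRy : ∀ m, m ≠ i → G.Touches (A \ G.compIn (A \ {t}) a) (y m) := by
    intro m hm
    obtain ⟨b, hb, hbm⟩ := hA.touches m
    exact ⟨b, ⟨hb, fun hbK => hm (ht.2 _ hKA hK m i ⟨b, hbK, hbm⟩ hKi)⟩, hbm⟩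
  refine ⟨insert (y i) (G.compIn (A \ {t}) a),
    insert (y j) (insert (y k) (A \ G.compIn (A \ {t}) a)), ?_, hK.insert hKi,
    (hR.insert (hRy k hik.symm)).insert ((hRy j hij.symm).mono (Set.subset_insert _ _)),
    Set.insert_subset_insert fun z hz => (hKA hz).1, ?_, Or.inr haK, Or.inl rfl, fun m hm => ?_⟩
  · rw [Set.disjoint_left]
    rintro z (hz | hz) (hz' | hz' | hz')
    · exact hyij (hz.symm.trans hz')
    · exact hyik (hz.symm.trans hz')
    · exact hyA i (hz ▸ hz'.1)
    · exact hyA j (hz' ▸ (hKA hz).1)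
    · exact hyA k (hz' ▸ (hKA hz).1)
    · exact hz'.2 hz
  · rintro z (rfl | rfl | hz)
    · exact Or.inr ⟨j, hij.symm, rfl⟩
    · exact Or.inr ⟨k, hik.symm, rfl⟩
    · exact Or.inl hz.1
  · rcases hall m hm with rfl | rfl
    · exact Or.inl rfl
    · exact Or.inr (Or.inl rfl)

/-- The parts of a star-shaped side not connected to any `y i` outside of the centre can be moved to
the other side. -/
theorem Config.exists_full_star (h : G.Config P x₁ x₂ y) (hAB : G.IsPartition P y A B)
    (ht : G.IsStarCenter y B t) : ∃ A' B', G.IsPartition P y A' B' ∧ G.IsStarCenter y B' t ∧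
      (∀ b ∈ B', b ≠ t → ∃ i, b ∈ G.starPart y B' t i) ∧ A ⊆ A' ∧
      ∀ w ∈ A', w ∉ A → ∀ u ∈ B', G.Adj w u → u = t := by
  set E : Set V := {b | b ∈ B ∧ b ≠ t ∧ ∀ i, b ∉ G.starPart y B t i} with hE
  have htE : t ∉ E := fun h => h.2.1 rfl
  have hEB : ∀ e ∈ E, e ∈ B := fun e he => he.1
  have hEcl : ∀ e ∈ E, ∀ b ∈ B, b ∉ E → G.Adj e b → b = t := by
    intro e he b hb hbE heb
    by_contra hbt
    obtain ⟨i, hi⟩ : ∃ i, b ∈ G.starPart y B t i := by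
      by_contra! hno
      exact hbE ⟨hb, hbt, hno⟩
    exact he.2.2 i (starPart_closed hi he.1 he.2.1 heb.symm)
  have hEy : ∀ e ∈ E, ∀ i, ¬ G.Adj e (y i) := fun e he i hei =>
    he.2.2 i (mem_starPart_of_adj he.1 he.2.1 hei)
  have hd := Set.disjoint_left.1 hAB.disj
  have hB' : G.IsSide P y (B \ E) := by
    refine ⟨hAB.right.conn.diff_of_attached ht.1 htE hEcl, fun b hb => hAB.right.notMem_path b hb.1,
      fun b hb => hAB.right.ne b hb.1, fun i => ?_⟩
    obtain ⟨b, hb, hbi⟩ := hAB.right.touches i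
    exact ⟨b, ⟨hb, fun hbE => hEy b hbE i hbi⟩, hbi⟩
  -- Every component of `E` has a neighbour in `A`, since `t` does not separate `G - P`.
  have hreach : ∀ e ∈ E, ∃ K ⊆ A ∪ E, G.ConnSet K ∧ e ∈ K ∧ (K ∩ A).Nonempty := by
    intro e he
    have hK : G.ConnSet (G.compIn E e) := connSet_compIn he
    have heK := mem_compIn_self (G := G) he
    have hKE : G.compIn E e ⊆ E := compIn_subset
    obtain ⟨a, ha, hKa⟩ : ∃ a ∈ A, G.Touches (G.compIn E e) a := by
      by_contra! hno
      refine h.false_of_closed_two (U := G.compIn E e) (c := t) (fun u hu w hw huw => ?_) heK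
        (hAB.right.notMem_path e (hEB e he)) he.2.1 (t := y 0)
        (fun h0 => hAB.right.notMem 0 (hEB _ (hKE h0))) (h.notMem 0) (hAB.right.ne t ht.1 0).symm
      by_cases hwy : ∃ i, w = y i
      · obtain ⟨i, rfl⟩ := hwy
        exact absurd huw (hEy u (hKE hu) i)
      push Not at hwy
      rcases hAB.cover w hw hwy with hwA | hwB
      · exact absurd ⟨u, hu, huw⟩ (hno w hwA)
      · by_cases hwE : w ∈ E
        · exact Or.inl (compIn_closed hu hwE huw)
        · exact Or.inr (hEcl u (hKE hu) w hwB hwE huw)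
    refine ⟨insert a (G.compIn E e), Set.insert_subset (Or.inl ha) (hKE.trans Set.subset_union_right),
      hK.insert hKa, Or.inr heK, a, Or.inl rfl, ha⟩
  have hA' : G.IsSide P y (A ∪ E) := by
    refine ⟨⟨hAB.left.conn.1.mono Set.subset_union_left, fun T hT ⟨c, hc⟩ hcl => ?_⟩, ?_, ?_,
      fun i => (hAB.left.touches i).mono Set.subset_union_left⟩
    · have key : ∀ {K : Set V}, G.ConnSet K → K ⊆ A ∪ E → (K ∩ T).Nonempty → K ⊆ T := by
        intro K hK hKs hne x hx
        exact (hK.2 (K ∩ T) Set.inter_subset_left hne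
          (fun c hc d hd hcd => ⟨hd, hcl c hc.2 d (hKs hd) hcd⟩) hx).2
      have hAT : A ⊆ T := by
        rcases hT hc with hcA | hcE
        · exact key hAB.left.conn Set.subset_union_left ⟨c, hcA, hc⟩
        · obtain ⟨K, hKs, hK, hcK, a, haK, haA⟩ := hreach c hcE
          exact key hAB.left.conn Set.subset_union_left ⟨a, haA, key hK hKs ⟨c, hcK, hc⟩ haK⟩
      rintro e (heA | heE)
      · exact hAT heA
      · obtain ⟨K, hKs, hK, heK, a, haK, haA⟩ := hreach e heE
        exact key hK hKs ⟨a, haK, hAT haA⟩ heK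
    · rintro v (hv | hv)
      · exact hAB.left.notMem_path v hv
      · exact hAB.right.notMem_path v (hEB v hv)
    · rintro v (hv | hv)
      · exact hAB.left.ne v hv
      · exact hAB.right.ne v (hEB v hv)
  refine ⟨A ∪ E, B \ E, ⟨hA', hB', ?_, fun v hv hvy => ?_⟩, ⟨⟨ht.1, htE⟩, fun Z hZ =>
    ht.2 Z fun z hz => ⟨(hZ hz).1.1, (hZ hz).2⟩⟩, fun b hb hbt => ?_, Set.subset_union_left, ?_⟩
  · rw [Set.disjoint_left]
    rintro z (hz | hz) hz'
    · exact hd hz hz'.1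
    · exact hz'.2 hz
  · by_cases hvE : v ∈ E
    · exact Or.inl (Or.inr hvE)
    · exact (hAB.cover v hv hvy).imp Or.inl fun hvB => ⟨hvB, hvE⟩
  · obtain ⟨i, Z, hZ, hZc, hbZ, hZi⟩ : ∃ i, b ∈ G.starPart y B t i := by
      by_contra! hno
      exact hb.2 ⟨hb.1, hbt, hno⟩
    refine ⟨i, Z, fun z hz => ⟨⟨(hZ hz).1, fun hzE => ?_⟩, (hZ hz).2⟩, hZc, hbZ, hZi⟩
    exact hzE.2.2 i ⟨Z, hZ, hZc, hz, hZi⟩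
  · rintro w (hw | hw) hwA u hu hwu
    · exact absurd hw hwA
    · exact hEcl w hw u hu.1 hu.2 hwu

variable [Finite V]

/-- A star-shaped side and a side without a star centre. -/
theorem Config.false_of_star (h : G.Config P x₁ x₂ y) (hAB : G.IsPartition P y A B)
    (ht : G.IsStarCenter y B t) (hfull : ∀ b ∈ B, b ≠ t → ∃ i, b ∈ G.starPart y B t i)
    (hns : ∀ s, ¬ G.IsStarCenter y A s) : False := by
  obtain ⟨n, C, hC, hCl, -, hC1, hC2⟩ := h.exists_cut hAB.left hAB.right hAB.disj hns
  have heq : ∀ {u w p q}, G.Adj u w → G.LinkedIn y A u p → w ∈ G.starPart y B t q → p = q :=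
    fun huw hp hq => h.eq_of_linkedIn hAB.left hAB.right hAB.disj huw hp
      (ht.linkedIn hAB.right h.inj hq)
  have H : G.IsDoubleCut P y A B n (fun _ => t) C (G.starPart y B t) := by
    refine ⟨hAB, hC, ht.isCut, fun i u hu w hw huw => ?_, fun i w hw u hu hwu => ?_⟩
    · by_cases hwt : w = t
      · exact Or.inr hwt
      · obtain ⟨q, hq⟩ := hfull w hw hwt
        have := heq huw (hC1 i u (Or.inl hu)) hq
        exact Or.inl (this ▸ hq)
    · exact hC2 u hu i fun p hp => heq hwu.symm hp hw
  refine H.false_of_single h hCl ht.1 fun u hu huC w hw hwD huw => ?_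
  by_contra hwt
  obtain ⟨q, hq⟩ := hfull w hw hwt
  exact hwD q hq

/-- Two star-shaped sides whose centres together separate the `y i` from each other in `G - P`. -/
theorem Config.false_of_separated (h : G.Config P x₁ x₂ y) (hAB : G.IsPartition P y A B)
    (hs : G.IsStarCenter y A s) (ht : G.IsStarCenter y B t)
    (hfull : ∀ b ∈ B, b ≠ t → ∃ i, b ∈ G.starPart y B t i)
    (hsep : ∀ i j, y j ∈ G.compIn {v | v ∉ P ∧ v ≠ s ∧ v ≠ t} (y i) → i = j) : False := by
  set K : Set V := {v | v ∉ P ∧ v ≠ s ∧ v ≠ t} with hK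
  have hd := Set.disjoint_left.1 hAB.disj
  have hyK : ∀ i, y i ∈ K := fun i =>
    ⟨h.notMem i, (hAB.left.ne s hs.1 i).symm, (hAB.right.ne t ht.1 i).symm⟩
  have hAK : ∀ a ∈ A, a ≠ s → a ∈ K := fun a ha has =>
    ⟨hAB.left.notMem_path a ha, has, fun e => hd ha (e ▸ ht.1)⟩
  have hBK : ∀ b ∈ B, b ≠ t → b ∈ K := fun b hb hbt =>
    ⟨hAB.right.notMem_path b hb, fun e => hd hs.1 (e ▸ hb), hbt⟩
  have heq : ∀ {i j v}, v ∈ G.compIn K (y i) → v ∈ G.compIn K (y j) → i = j := by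
    rintro i j v ⟨Z, hZ, hZc, hiZ, hvZ⟩ ⟨Z', hZ', hZc', hjZ', hvZ'⟩
    exact hsep i j ⟨Z ∪ Z', Set.union_subset hZ hZ', hZc.union_of_mem hZc' hvZ hvZ', Or.inl hiZ,
      Or.inr hjZ'⟩
  have hpart : ∀ {A : Set V} {s : V}, (∀ a ∈ A, a ≠ s → a ∈ K) → ∀ {i v},
      v ∈ G.starPart y A s i → v ∈ G.compIn K (y i) := by
    rintro A s hAK i v ⟨Z, hZ, hZc, hvZ, hZi⟩
    exact ⟨insert (y i) Z, Set.insert_subset (hyK i) fun z hz => hAK z (hZ hz).1 (hZ hz).2,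
      hZc.insert hZi, Or.inl rfl, Or.inr hvZ⟩
  have hC : G.IsCut y A (fun _ => s) fun i => A ∩ G.compIn K (y i) := by
    refine ⟨fun i => Set.inter_subset_left, fun _ => hs.1,
      fun i j hs' => (compIn_subset hs'.2).2.1 rfl,
      fun i j hij => Set.disjoint_left.2 fun z hz hz' => hij (heq hz.2 hz'.2),
      fun i a ha b hb hab => ?_, fun i a ha hai => ?_⟩
    · by_cases hbs : b = s
      · exact Or.inr hbs
      · exact Or.inl ⟨hb, compIn_closed ha.2 (hAK b hb hbs) hab⟩
    · by_cases has : a = s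
      · exact Or.inr has
      · exact Or.inl ⟨ha, compIn_closed (mem_compIn_self (hyK i)) (hAK a ha has) hai.symm⟩
  have H : G.IsDoubleCut P y A B (fun _ => s) (fun _ => t) (fun i => A ∩ G.compIn K (y i))
      (G.starPart y B t) := by
    refine ⟨hAB, hC, ht.isCut, fun i u hu w hw huw => ?_, fun i w hw u hu hwu => ?_⟩
    · by_cases hwt : w = t
      · exact Or.inr hwt
      · obtain ⟨q, hq⟩ := hfull w hw hwt
        have := heq (compIn_closed hu.2 (hBK w hw hwt) huw) (hpart hBK hq)
        exact Or.inl (this ▸ hq)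
    · by_cases hus : u = s
      · exact Or.inr hus
      · exact Or.inl ⟨hu, compIn_closed (hpart hBK hw) (hAK u hu hus) hwu⟩
  refine H.false_of_single h (fun i j k hij hik hjk => ?_) ht.1 fun u hu huC w hw hwD huw => ?_
  · obtain ⟨R, r1, r2, r3, r4⟩ := hs.exists_way hAB.left j
    obtain ⟨S, s1, s2, s3, s4⟩ := hs.exists_way hAB.left k
    have hsub : ∀ j, i ≠ j →
        G.starPart y A s j ⊆ (A \ (A ∩ G.compIn K (y i))) \ {s} := fun j hij z hz =>
      ⟨⟨(starPart_subset hz).1, fun hz' => hij (heq hz'.2 (hpart hAK hz))⟩, (starPart_subset hz).2⟩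
    refine ⟨R, S, Set.disjoint_left.2 fun z hz hz' => ?_,
      ⟨r1, r2, r3.trans (Set.insert_subset_insert (hsub j hij)), r4⟩,
      ⟨s1, s2, s3.trans (Set.insert_subset_insert (hsub k hik)), s4⟩⟩
    rcases r3 hz with rfl | hz1 <;> rcases s3 hz' with hz2 | hz2
    · exact hjk (h.inj hz2)
    · exact hAB.left.notMem j (starPart_subset hz2).1
    · exact hAB.left.ne z (starPart_subset hz1).1 k hz2
    · exact hjk (hs.eq_of_mem hz1 hz2)
  · by_contra hwt
    obtain ⟨q, hq⟩ := hfull w hw hwt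
    exact hwD q hq

/-- No side is star-shaped. -/
theorem Config.not_isStarCenter (h : G.Config P x₁ x₂ y) (hAB : G.IsPartition P y A B) (t : V) :
    ¬ G.IsStarCenter y B t := by
  intro ht
  obtain ⟨A₁, B₁, hAB₁, ht₁, hfull₁, -, -⟩ := h.exists_full_star hAB ht
  clear ht hAB
  by_cases hns : ∀ s, ¬ G.IsStarCenter y A₁ s
  · exact h.false_of_star hAB₁ ht₁ hfull₁ hns
  push Not at hns
  obtain ⟨s, hs⟩ := hns
  by_cases hsep : ∀ i j, y j ∈ G.compIn {v | v ∉ P ∧ v ≠ s ∧ v ≠ t} (y i) → i = j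
  · exact h.false_of_separated hAB₁ hs ht₁ hfull₁ hsep
  push Not at hsep
  obtain ⟨i, j, ⟨Z, hZK, hZ, hiZ, hjZ⟩, hij⟩ := hsep
  -- Moving the superfluous parts of `A₁` to `B₁` makes `B₁` a side without a star centre.
  obtain ⟨B, A, hBA, hsA, hfullA, hBB, hBt⟩ := h.exists_full_star hAB₁.symm hs
  refine h.false_of_star hBA hsA hfullA fun t' ht' => ?_
  by_cases htt : t' = t
  · subst htt
    have hd := Set.disjoint_left.1 hBA.disj
    have hT : ∀ q, y q ∈ {v | v = y i ∨ v ∈ G.starPart y A s i ∨ v ∈ G.starPart y B t' i} → q = i := by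
      rintro q (hq | hq | hq)
      · exact h.inj hq
      · exact absurd (starPart_subset hq).1 (hBA.right.notMem q)
      · exact absurd (starPart_subset hq).1 (hBA.left.notMem q)
    have hlink : ∀ {u w p q}, G.Adj u w → u ∈ G.starPart y B t' p → w ∈ G.starPart y A s q → p = q :=
      fun huw hp hq => h.eq_of_linkedIn hBA.left hBA.right hBA.disj huw
        (ht'.linkedIn hBA.left h.inj hp) (hsA.linkedIn hBA.right h.inj hq)
    obtain ⟨c, hcZ, hcT, d, hdZ, hdT, hcd⟩ := hZ.exists_boundary
      (T := {v | v = y i ∨ v ∈ G.starPart y A s i ∨ v ∈ G.starPart y B t' i}) hiZ (Or.inl rfl) hjZ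
      (fun h' => hij (hT j h').symm)
    have hdK := hZK hdZ
    have hcK := hZK hcZ
    by_cases hdy : ∃ q, d = y q
    · obtain ⟨q, rfl⟩ := hdy
      have hqi : q ≠ i := fun e => hdT (e ▸ Or.inl rfl)
      rcases hcT with rfl | hc | hc
      · exact h.not_adj (Ne.symm hqi) hcd
      · exact hqi (hsA.eq_of_mem (mem_starPart_of_adj (starPart_subset hc).1 hcK.2.1 hcd) hc)
      · exact hqi (ht'.eq_of_mem (mem_starPart_of_adj (starPart_subset hc).1 hcK.2.2 hcd) hc)
    · push Not at hdy
      rcases hBA.cover d hdK.1 hdy with hdB | hdA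
      · refine hdT (Or.inr (Or.inr ?_))
        rcases hcT with rfl | hc | hc
        · exact mem_starPart_of_adj hdB hdK.2.2 hcd.symm
        · by_cases hdB₁ : d ∈ B₁
          · obtain ⟨q, hq⟩ := hfull₁ d hdB₁ hdK.2.2
            have hq' := starPart_mono hBB hq
            exact hlink hcd.symm hq' hc ▸ hq'
          · exact absurd (hBt d hdB hdB₁ c (starPart_subset hc).1 hcd.symm) hcK.2.1
        · exact starPart_closed hc hdB hdK.2.2 hcd
      · refine hdT (Or.inr (Or.inl ?_))
        rcases hcT with rfl | hc | hc
        · exact mem_starPart_of_adj hdA hdK.2.1 hcd.symm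
        · exact starPart_closed hc hdA hdK.2.1 hcd
        · obtain ⟨q, hq⟩ := hfullA d hdA hdK.2.1
          exact (hlink hcd hc hq).symm ▸ hq
  · by_cases htB : t' ∈ B₁
    · obtain ⟨q, hq⟩ := hfull₁ t' htB htt
      obtain ⟨j, k, hqj, hqk, hjk⟩ : ∃ j k, q ≠ j ∧ q ≠ k ∧ j ≠ k := by
        clear * -
        revert q
        decide
      exact hjk (ht'.2 (B₁ \ G.starPart y B₁ t q)
        (fun z hz => ⟨hBB hz.1, fun e => hz.2 ((show z = t' from e) ▸ hq)⟩)
        (ht₁.isCut.conn_diff hAB₁.right.conn q) j k (ht₁.isCut.touches_diff hAB₁.right hqj)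
        (ht₁.isCut.touches_diff hAB₁.right hqk))
    · have := ht'.2 B₁ (fun z hz => ⟨hBB hz, fun e => htB ((show z = t' from e) ▸ hz)⟩)
        hAB₁.right.conn 0 1 (hAB₁.right.touches 0) (hAB₁.right.touches 1)
      exact absurd this (by decide)

/-- There is no counterexample. -/
theorem Config.false (h : G.Config P x₁ x₂ y) : False := by
  obtain ⟨A, B, hAB⟩ := h.exists_partition
  exact h.false_of_not_isStarCenter hAB (h.not_isStarCenter hAB.symm) (h.not_isStarCenter hAB)

end Star

end SimpleGraph

namespace SimpleGraph

/-! ### The path -/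

section Path

variable {V : Type*} {G : SimpleGraph V}

theorem Walk.connSet_support {u v : V} (p : G.Walk u v) : G.ConnSet {w | w ∈ p.support} := by
  induction p with
  | nil => simpa using connSet_singleton _
  | cons h p ih =>
    have := ih.insert ⟨_, p.start_mem_support, h.symm⟩
    convert this using 1
    ext w
    simp

/-- Two vertices of a path are separated by a partition of the path into two paths. -/
theorem Walk.IsPath.exists_split {u v : V} {p : G.Walk u v} (hp : p.IsPath) {l r : V}
    (hl : l ∈ p.support) (hr : r ∈ p.support) (hlr : l ≠ r) :
    ∃ Q₁ Q₂ : Set V, Disjoint Q₁ Q₂ ∧ Q₁ ⊆ {w | w ∈ p.support} ∧ Q₂ ⊆ {w | w ∈ p.support} ∧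
      G.ConnSet Q₁ ∧ G.ConnSet Q₂ ∧ u ∈ Q₁ ∧ v ∈ Q₂ ∧ (l ∈ Q₁ ∧ r ∈ Q₂ ∨ r ∈ Q₁ ∧ l ∈ Q₂) := by
  induction p with
  | nil =>
    simp only [Walk.support_nil, List.mem_singleton] at hl hr
    exact absurd (hl.trans hr.symm) hlr
  | @cons u w v h p ih =>
    rw [Walk.cons_isPath_iff] at hp
    have hu : Disjoint ({u} : Set V) {w | w ∈ p.support} := by simpa using hp.2
    have hsub : {z | z ∈ p.support} ⊆ {z | z ∈ (Walk.cons h p).support} := fun z hz => by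
      simpa using Or.inr hz
    have husub : ({u} : Set V) ⊆ {z | z ∈ (Walk.cons h p).support} := by simp
    simp only [Walk.support_cons, List.mem_cons] at hl hr
    rcases hl with rfl | hl
    · have hr' : r ∈ p.support := hr.resolve_left hlr.symm
      exact ⟨_, _, hu, husub, hsub, connSet_singleton l, p.connSet_support, rfl, p.end_mem_support,
        Or.inl ⟨rfl, hr'⟩⟩
    rcases hr with rfl | hr
    · exact ⟨_, _, hu, husub, hsub, connSet_singleton r, p.connSet_support, rfl, p.end_mem_support,
        Or.inr ⟨rfl, hl⟩⟩
    obtain ⟨Q₁, Q₂, hd, h1, h2, h3, h4, h5, h6, h7⟩ := ih hp.1 hl hr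
    refine ⟨insert u Q₁, Q₂, ?_, Set.insert_subset (by simp) (h1.trans hsub), h2.trans hsub,
      h3.insert ⟨w, h5, h.symm⟩, h4, Or.inl rfl, h6,
      h7.imp (fun h => ⟨Or.inr h.1, h.2⟩) fun h => ⟨Or.inr h.1, h.2⟩⟩
    rw [Set.insert_eq, Set.disjoint_union_left]
    exact ⟨hu.mono_right h2, hd⟩

/-- An inner vertex of a path is adjacent to both parts into which it separates the path. -/
theorem Walk.IsPath.exists_split_at {u v : V} {p : G.Walk u v} (hp : p.IsPath) {w : V}
    (hw : w ∈ p.support) (hwu : w ≠ u) (hwv : w ≠ v) :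
    ∃ Q₁ Q₂ : Set V, Disjoint Q₁ Q₂ ∧ Q₁ ⊆ {z | z ∈ p.support} \ {w} ∧
      Q₂ ⊆ {z | z ∈ p.support} \ {w} ∧ G.ConnSet Q₁ ∧ G.ConnSet Q₂ ∧ u ∈ Q₁ ∧ v ∈ Q₂ ∧
      G.Touches Q₁ w ∧ G.Touches Q₂ w := by
  induction p with
  | nil =>
    simp only [Walk.support_nil, List.mem_singleton] at hw
    exact absurd hw hwu
  | @cons u a v h p ih =>
    rw [Walk.cons_isPath_iff] at hp
    have hw' : w ∈ p.support := by
      simp only [Walk.support_cons, List.mem_cons] at hw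
      exact hw.resolve_left hwu
    by_cases hwa : w = a
    · subst hwa
      cases p with
      | nil => exact absurd rfl hwv
      | @cons _ b _ h' p =>
        have hp' := (Walk.cons_isPath_iff h' p).1 hp.1
        simp only [Walk.support_cons, List.mem_cons, not_or] at hp
        refine ⟨{u}, {z | z ∈ p.support}, by simpa using hp.2.2, ?_, ?_, connSet_singleton u,
          p.connSet_support, rfl, p.end_mem_support, ⟨u, rfl, h⟩, b, p.start_mem_support, h'.symm⟩
        · rintro z rfl
          exact ⟨by simp, hwu.symm⟩
        · intro z hz
          have hz' : z ∈ p.support := hz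
          exact ⟨by simp [hz'], fun e => hp'.2 ((show z = w from e) ▸ hz')⟩
    · obtain ⟨Q₁, Q₂, hd, h1, h2, h3, h4, h5, h6, h7, h8⟩ := ih hp.1 hw' hwa hwv
      have hsub : {z | z ∈ p.support} \ {w} ⊆ {z | z ∈ (Walk.cons h p).support} \ {w} :=
        fun z hz => ⟨by simpa using Or.inr hz.1, hz.2⟩
      refine ⟨insert u Q₁, Q₂, ?_, Set.insert_subset ⟨by simp, hwu.symm⟩ (h1.trans hsub),
        h2.trans hsub, h3.insert ⟨a, h5, h.symm⟩, h4, Or.inl rfl, h6,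
        h7.mono (Set.subset_insert _ _), h8⟩
      rw [Set.disjoint_left] at hd ⊢
      rintro z (rfl | hz) hz'
      · exact hp.2 (h2 hz').1
      · exact hd hz hz'

/-- On a path, no vertex is next to more than two others, and its first vertex is next to at most
one. -/
theorem Walk.IsPath.exists_adj_toSubgraph {u v : V} {p : G.Walk u v} (hp : p.IsPath) :
    (∃ a, ∀ z, p.toSubgraph.Adj u z → z = a) ∧
      ∀ w, ∃ a b, ∀ z, p.toSubgraph.Adj w z → z = a ∨ z = b := by
  induction p with
  | @nil u =>
    exact ⟨⟨u, fun z hz => absurd hz (by simp)⟩, fun w => ⟨u, u, fun z hz => absurd hz (by simp)⟩⟩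
  | @cons u a v h p ih =>
    rw [Walk.cons_isPath_iff] at hp
    obtain ⟨⟨b, hb⟩, hall⟩ := ih hp.1
    have hu : ∀ z, ¬ p.toSubgraph.Adj u z := fun z hz =>
      hp.2 ((Walk.mem_verts_toSubgraph p).1 hz.fst_mem)
    have hiff : ∀ w z, (Walk.cons h p).toSubgraph.Adj w z ↔
        (u = w ∧ a = z ∨ u = z ∧ a = w) ∨ p.toSubgraph.Adj w z := by
      intro w z
      simp [Walk.toSubgraph, Subgraph.sup_adj, subgraphOfAdj_adj]
    have hua := h.ne
    refine ⟨⟨a, fun z hz => ?_⟩, fun w => ?_⟩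
    · rcases (hiff u z).1 hz with (⟨-, h'⟩ | ⟨-, h'⟩) | h'
      · exact h'.symm
      · exact absurd h'.symm hua
      · exact absurd h' (hu z)
    · by_cases hwu : w = u
      · subst hwu
        refine ⟨a, a, fun z hz => ?_⟩
        rcases (hiff w z).1 hz with (⟨-, h'⟩ | ⟨-, h'⟩) | h'
        · exact Or.inl h'.symm
        · exact absurd h'.symm hua
        · exact absurd h' (hu z)
      · by_cases hwa : w = a
        · subst hwa
          refine ⟨u, b, fun z hz => ?_⟩
          rcases (hiff w z).1 hz with (⟨h', -⟩ | ⟨h', -⟩) | h'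
          · exact absurd h'.symm hwu
          · exact Or.inl h'.symm
          · exact Or.inr (hb z h')
        · obtain ⟨c, d, hcd⟩ := hall w
          refine ⟨c, d, fun z hz => ?_⟩
          rcases (hiff w z).1 hz with (⟨h', -⟩ | ⟨-, h'⟩) | h'
          · exact absurd h'.symm hwu
          · exact absurd h'.symm hwa
          · exact hcd z h'

end Path

/-! ### Connectivity in terms of vertex sets -/

section Connectivity

variable {V : Type*} {G : SimpleGraph V}

theorem Connected.connSet_of_induce {S : Set V} {T : Set S} (h : ((G.induce S).induce T).Connected) :
    G.ConnSet (Subtype.val '' T) := by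
  obtain ⟨⟨a, ha⟩⟩ := h.nonempty
  refine ⟨⟨a, a, ha, rfl⟩, fun U hU ⟨u, hu⟩ hcl => ?_⟩
  have key : ∀ (c d : T), ((G.induce S).induce T).Walk c d → c.1.1 ∈ U → d.1.1 ∈ U := by
    intro c d p
    induction p with
    | nil => exact id
    | @cons c e d h p ih => exact fun hc => ih (hcl _ hc _ ⟨e.1, e.2, rfl⟩ h)
  obtain ⟨u', hu', rfl⟩ := hU hu
  rintro _ ⟨w, hw, rfl⟩
  obtain ⟨p⟩ := h.preconnected ⟨u', hu'⟩ ⟨w, hw⟩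
  exact key _ _ p hu

theorem IsVertexConnected.connSet_compl {k : ℕ} (h : G.IsVertexConnected k) {X : Finset V}
    (hX : X.card < k) : G.ConnSet {v | v ∉ X} := by
  obtain ⟨⟨a, ha⟩⟩ := (h.2 X hX).nonempty
  refine ⟨⟨a, ha⟩, fun U hU ⟨u, hu⟩ hcl w hw => ?_⟩
  have key : ∀ (c d : {v | v ∉ X}), (G.induce {v | v ∉ X}).Walk c d → c.1 ∈ U → d.1 ∈ U := by
    intro c d p
    induction p with
    | nil => exact id
    | @cons c e d h p ih => exact fun hc => ih (hcl _ hc _ e.2 h)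
  obtain ⟨p⟩ := (h.2 X hX).preconnected ⟨u, hU hu⟩ ⟨w, hw⟩
  exact key _ _ p hu

theorem IsVertexConnected.connSet_induce {S : Set V} (h : (G.induce S).IsVertexConnected 2) (c : V) :
    G.ConnSet {v | v ∈ S ∧ v ≠ c} := by
  classical
  by_cases hc : c ∈ S
  · have := (h.2 {⟨c, hc⟩} (by simp)).connSet_of_induce
    convert this using 1
    ext v
    simp only [Finset.mem_singleton, Set.mem_image, Subtype.exists, exists_and_right,
      exists_eq_right]
    exact ⟨fun hv => ⟨hv.1, fun e => hv.2 (congrArg Subtype.val e)⟩,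
      fun ⟨h1, h2⟩ => ⟨h1, fun e => h2 (Subtype.ext e)⟩⟩
  · have := (h.2 ∅ (by simp)).connSet_of_induce
    convert this using 1
    ext v
    simp only [Finset.notMem_empty, not_false_eq_true, Set.mem_image, Subtype.exists,
      exists_and_right, exists_eq_right]
    exact ⟨fun hv => ⟨hv.1, trivial⟩, fun ⟨h1, _⟩ => ⟨h1, fun e => hc (e ▸ h1)⟩⟩

end Connectivity

end SimpleGraph

/-- `K` is a copy of `K_{2,3}` in `G`, with `3`-valent vertices `K (inl 0)`, `K (inl 1)` and
`2`-valent vertices `K (inr 0)`, `K (inr 1)`, `K (inr 2)`. -/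
theorem mainTheorem2 {V : Type*} [Finite V] (G : SimpleGraph V)
    (hG : G.IsVertexConnected 5)
    (K : SimpleGraph.Copy (completeBipartiteGraph (Fin 2) (Fin 3)) G)
    (P : G.Walk (K (Sum.inl 0)) (K (Sum.inl 1)))
    (hP : P.IsPath)
    (hPind : P.toSubgraph.IsInduced)
    (hPK : ∀ i : Fin 3, K (Sum.inr i) ∉ P.support)
    (hGP : (G.induce {v | v ∉ P.support}).IsVertexConnected 2) :
    G.ContainsSubdivision (⊤ : SimpleGraph (Fin 5)) := by
  by_contra hno
  have hinj : Function.Injective K := K.injective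
  have hadj : ∀ i j, G.Adj (K (Sum.inl i)) (K (Sum.inr j)) := fun i j =>
    K.toHom.map_adj (by simp)
  have h : G.Config {v | v ∈ P.support} (K (Sum.inl 0)) (K (Sum.inl 1)) (fun i => K (Sum.inr i)) :=
    { not_subdivision := hno
      conn_five := fun X hX => hG.connSet_compl (by omega)
      conn_two := fun c => hGP.connSet_induce c
      conn_path := P.connSet_support
      mem₁ := P.start_mem_support
      mem₂ := P.end_mem_support
      ne := hinj.ne (by simp)
      inj := fun i j hij => Sum.inr_injective (hinj hij)
      notMem := hPK
      adj₁ := hadj 0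
      adj₂ := hadj 1
      split := fun l hl r hr hlr => hP.exists_split hl hr hlr
      split_at := fun p hp hp₁ hp₂ => hP.exists_split_at hp hp₁ hp₂
      degree_path := fun p hp => by
        obtain ⟨a, b, hab⟩ := hP.exists_adj_toSubgraph.2 p
        refine ⟨a, b, fun q hq hpq => hab q (hPind ?_ ?_ hpq)⟩
        · exact (SimpleGraph.Walk.mem_verts_toSubgraph P).2 hp
        · exact (SimpleGraph.Walk.mem_verts_toSubgraph P).2 hq }
  exact h.false
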